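/- Let $X$ be a smooth (Hausdorff) manifold of dimension $N\ge 1$ and let $Y=Y^{(b)}\times_X Y^{(m)}$ be the fibered product of two fibered manifolds over $X$ (surjective submersions), with fibered charts $(x^i,y^A,y^\sigma)$ ($y^A$ background, $y^\sigma$ matter coordinates; $(x^i,y^A)$ and $(x^i,y^\sigma)$ are fibered charts of the two factors over the same chart $(x^i)$ of $X$). In such a chart put $\omega_0=dx^1\wedge\dots\wedge dx^N$, $\omega_j=\mathbf i_{\partial/\partial x^j}\omega_0$, $\omega^A=dy^A-y^A_{\ j}dx^j$; $h$ denotes horizontalization of forms on jet spaces, i.e. $J^{k+1}\gamma^*(h\rho)=J^k\gamma^*\rho$ for all local sections $\gamma$ and all forms $\rho$ on $J^kY$. Let $l:\xi\mapsto\Xi=\xi^i\partial_i+\Xi^A(x,y^B)\partial_A+\Xi^\sigma(x,y^\mu)\partial_\sigma$ be an $\mathbb R$-linear lift of vector fields on $X$ to projectable vector fields on $Y$, with $\Xi$ projecting to $\xi$ and the support of $\Xi$ lying over the support of $\xi$, which is of index at most $1$ in the background variables: in every fibered chart $$\Xi^A=C^A_{\ i}\,\xi^i+C^{Aj}_{\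 \ i}\,\xi^i_{,j}$$ with functions $C^A_{\ i},C^{Aj}_{\ \ i}$ of $(x^k,y^B)$ independent of $\xi$. Let $\lambda_m=\mathcal L_m\omega_0$ be a Lagrangian of order $r$ on $Y$ (a horizontal $N$-form on $J^rY$), and let $\tau$ be its energy-momentum source form, i.e. its Euler-Lagrange form with respect to the background variables: in every fibered chart $$\tau=\frac{\delta\mathcal L_m}{\delta y^A}\,\omega^A\wedge\omega_0,\qquad \frac{\delta\mathcal L_m}{\delta y^A}=\sum_{|\alpha|\le r}(-1)^{|\alpha|}d_\alpha\frac{\partial\mathcal L_m}{\partial y^A_\alpha}$$ (sum over multi-indices $\alpha$, $d_\alpha$ the iterated total derivatives). Then: 1. $\tau$ exists and is unique as a globally defined form of order $q$, for every $q\ge 2r$. 2. Whenever $\tau$ is of order $q$, there is exactly one $C^\infty(X)$-linear map $\mathcal T$ from vector fields on $X$ to horizontal $(N-1)$-forms of order $q$ (the energy-momentum tensor) for which there is a $C^\infty(X)$-linear map $\mathcal B$ from vector fields on $X$ to horizontal $N$-forms of order $q+1$ with $$h\,\mathbf i_{\Xi}\tau=\mathcal B(\xi)+h\,d(\mathcal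 T(\xi))\quad\text{for all vector fields }\xi\text{ on }X .$$ ($\tau$ is generated by the $dx^i$ and $dy^A$, so the contraction with a jet prolongation of $\Xi$ depends on $\Xi$ only.) 3. In every fibered chart $$\mathcal T(\xi)=\mathcal T^j_{\ i}\,\xi^i\,\omega_j,\qquad \mathcal T^j_{\ i}=C^{Aj}_{\ \ i}\,\frac{\delta\mathcal L_m}{\delta y^A}.$$ 4. With respect to fibered coordinate changes, from $(x^i,y^A,y^\sigma)$ to $(x^{i'},y^{A'},y^{\sigma'})$, these functions obey the rule $$\mathcal T^j_{\ i}=\frac{\partial x^j}{\partial x^{j'}}\,\frac{\partial x^{i'}}{\partial x^i}\,\det\Big(\frac{\partial x^{k'}}{\partial x^k}\Big)\,\mathcal T^{j'}_{\ i'} .$$ -/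

import Mathlib

open scoped Manifold ContDiff Topology

noncomputable section

namespace EMTensor

/-- The model space `ℝⁿ`. -/
abbrev Rn (n : ℕ) : Type := EuclideanSpace ℝ (Fin n)

/-- The `i`-th standard basis vector of `ℝⁿ`. -/
def basisVec {n : ℕ} (i : Fin n) : Rn n := EuclideanSpace.single i 1

/-- The standard volume form `dx¹ ∧ ... ∧ dxⁿ` on `ℝⁿ`. -/
def volForm (n : ℕ) : Rn n [⋀^Fin n]→L[ℝ] ℝ :=
  { (EuclideanSpace.basisFun (Fin n) ℝ).toBasis.det with
    cont := by
      change Continuous fun v : Fin n → Rn n =>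
        (EuclideanSpace.basisFun (Fin n) ℝ).toBasis.det v
      simp only [Module.Basis.det_apply]
      refine Continuous.matrix_det (continuous_matrix fun i j => ?_)
      simp only [Module.Basis.toMatrix_apply, OrthonormalBasis.coe_toBasis_repr_apply,
        EuclideanSpace.basisFun_repr]
      fun_prop }

/-- The exterior product `θ ∧ η` of a `1`-form and a `k`-form on a normed space. -/
def wedgeOne {V : Type*} [NormedAddCommGroup V] [NormedSpace ℝ V] {k : ℕ}
    (θ : V →L[ℝ] ℝ) (η : V [⋀^Fin k]→L[ℝ] ℝ) : V [⋀^Fin (k + 1)]→L[ℝ] ℝ :=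
  ContinuousAlternatingMap.alternatizeUncurryFin (θ.smulRight η)

/-! ### Multi-indices, jet coordinates, total derivatives -/

/-- The composite `D₀^{α₀} ∘ D₁^{α₁} ∘ ...` for a multi-index `α`. -/
def multiIter {n : ℕ} {A : Type*} (D : Fin n → A → A) (α : Fin n → ℕ) (f : A) : A :=
  (List.finRange n).foldr (fun i g => (D i)^[α i] g) f

/-- The multi-indices of order at most `q`. -/
def orderLE (n q : ℕ) : Finset (Fin n → ℕ) :=
  (Fintype.piFinset fun _ => Finset.range (q + 1)).filter fun α => ∑ i, α i ≤ q

/-- The partial derivative `∂u/∂xⁱ` of a map on `ℝⁿ`. -/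
def pderiv {n : ℕ} {V : Type*} [NormedAddCommGroup V] [NormedSpace ℝ V]
    (i : Fin n) (u : Rn n → V) : Rn n → V :=
  fun p => fderiv ℝ u p (basisVec i)

/-- Values of the coordinates `(xⁱ, y^A_α, y^σ_α)` on the jet spaces, for all multi-indices `α`
at once; the coordinates on the `r`-th jet space are those with `|α| ≤ r`. The background fibre
coordinates are `y^A`, `A < a`, the matter fibre coordinates are `y^σ`, `σ < m`. -/
abbrev JetCoord (n a m : ℕ) : Type :=
  Rn n × ((Fin n → ℕ) → Rn a) × ((Fin n → ℕ) → Rn m)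

/-- The coordinates of order at most `q`. -/
abbrev TruncCoord (n a m q : ℕ) : Type :=
  Rn n × (orderLE n q → Rn a) × (orderLE n q → Rn m)

def trunc {n a m : ℕ} (q : ℕ) (p : JetCoord n a m) : TruncCoord n a m q :=
  (p.1, fun α => p.2.1 α, fun α => p.2.2 α)

/-- `f` is, on `D`, a smooth function of the jet coordinates of order at most `q`. -/
def SmoothOfOrder {n a m : ℕ} {V : Type*} [NormedAddCommGroup V] [NormedSpace ℝ V]
    (q : ℕ) (D : Set (JetCoord n a m)) (f : JetCoord n a m → V) : Prop :=
  ∃ g : TruncCoord n a m q → V,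
    ∀ p ∈ D, ContDiffAt ℝ ∞ g (trunc q p) ∧ f p = g (trunc q p)

/-- The direction `∂_i + ∑ y^A_{α+i} ∂/∂y^A_α + ∑ y^σ_{α+i} ∂/∂y^σ_α` at a point. -/
def totalDir {n a m : ℕ} (i : Fin n) (p : JetCoord n a m) : JetCoord n a m :=
  (basisVec i, fun α => p.2.1 (α + Pi.single i 1), fun α => p.2.2 (α + Pi.single i 1))

/-- The total derivative `d_i f`. -/
def totalDeriv {n a m : ℕ} (i : Fin n) (f : JetCoord n a m → ℝ) : JetCoord n a m → ℝ :=
  fun p => lineDeriv ℝ f p (totalDir i p)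

/-- The partial derivative `∂f/∂y^A_α` with respect to a background jet coordinate. -/
def bgPartial {n a m : ℕ} (A : Fin a) (α : Fin n → ℕ) (f : JetCoord n a m → ℝ) :
    JetCoord n a m → ℝ :=
  fun p => lineDeriv ℝ f p (0, Pi.single α (basisVec A), 0)

/-- The Euler-Lagrange expression `δL/δy^A = ∑_{|α| ≤ r} (-1)^{|α|} d_α (∂L/∂y^A_α)` of an `r`-th
order Lagrangian function with respect to the background variable `y^A`. -/
def eulerLagrange {n a m : ℕ} (r : ℕ) (L : JetCoord n a m → ℝ) (A : Fin a) :
    JetCoord n a m → ℝ :=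
  fun p => ∑ α ∈ orderLE n r,
    (-1 : ℝ) ^ (∑ i, α i) * multiIter totalDeriv α (bgPartial A α L) p

/-- The contact form `ω^A = dy^A - y^A_j dx^j` at a point with jet coordinates `p`. -/
def contactForm {n a m : ℕ} (A : Fin a) (p : JetCoord n a m) : (Rn n × Rn a) →L[ℝ] ℝ :=
  (EuclideanSpace.proj A).comp (ContinuousLinearMap.snd ℝ (Rn n) (Rn a)) -
    ∑ j : Fin n, (p.2.1 (Pi.single j 1) A) •
      (EuclideanSpace.proj j).comp (ContinuousLinearMap.fst ℝ (Rn n) (Rn a))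

/-- The form `ω^A ∧ ω₀`. -/
def contactVol {n a m : ℕ} (A : Fin a) (p : JetCoord n a m) :
    (Rn n × Rn a) [⋀^Fin (n + 1)]→L[ℝ] ℝ :=
  wedgeOne (contactForm A p)
    ((volForm n).compContinuousLinearMap (ContinuousLinearMap.fst ℝ (Rn n) (Rn a)))

/-! ### Forms and vector fields on the base -/

section Base

variable {n : ℕ} {X : Type*} [TopologicalSpace X] [ChartedSpace (Rn n) X]

variable (n X) in
/-- Smooth vector fields on the base manifold. -/
abbrev BaseField [IsManifold 𝓘(ℝ, Rn n) ∞ X] : Type _ :=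
  Cₛ^∞⟮𝓘(ℝ, Rn n); Rn n, (TangentSpace 𝓘(ℝ, Rn n) : X → Type)⟯

/-- The differential `(dx¹, ..., dxⁿ)` of a chart, at a point. -/
def coframe (φ : OpenPartialHomeomorph X (Rn n)) (x : X) :
    TangentSpace 𝓘(ℝ, Rn n) x →L[ℝ] Rn n :=
  mfderiv 𝓘(ℝ, Rn n) 𝓘(ℝ, Rn n) φ x

/-- The inverse of a chart pushes vectors of `ℝⁿ` forward to the manifold. -/
def frame (φ : OpenPartialHomeomorph X (Rn n)) (u : Rn n) :
    Rn n →L[ℝ] TangentSpace 𝓘(ℝ, Rn n) (φ.symm u) :=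
  mfderiv 𝓘(ℝ, Rn n) 𝓘(ℝ, Rn n) φ.symm u

/-- The exterior derivative of a `k`-form on a manifold, computed at `x` in the preferred chart
at `x`. -/
def extDerivM {k : ℕ}
    (η : (x : X) → (TangentSpace 𝓘(ℝ, Rn n) x) [⋀^Fin k]→L[ℝ] ℝ) (x : X) :
    (TangentSpace 𝓘(ℝ, Rn n) x) [⋀^Fin (k + 1)]→L[ℝ] ℝ :=
  (extDeriv (fun u : Rn n =>
      (η ((chartAt (Rn n) x).symm u)).compContinuousLinearMap (frame (chartAt (Rn n) x) u))
    (chartAt (Rn n) x x)).compContinuousLinearMap (coframe (chartAt (Rn n) x) x)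

/-- The component `ξⁱ` of a vector field in a chart. -/
def comp [IsManifold 𝓘(ℝ, Rn n) ∞ X] (φ : OpenPartialHomeomorph X (Rn n)) (ξ : BaseField n X)
    (i : Fin n) (x : X) : ℝ :=
  coframe φ x (ξ x) i

/-- The partial derivative `ξⁱ_{,j}` of a component of a vector field in a chart. -/
def compDeriv [IsManifold 𝓘(ℝ, Rn n) ∞ X] (φ : OpenPartialHomeomorph X (Rn n))
    (ξ : BaseField n X) (i j : Fin n) (x : X) : ℝ :=
  pderiv j (fun u => comp φ ξ i (φ.symm u)) (φ x)

/-- The form `ω₀ = dx¹ ∧ ... ∧ dxⁿ` of a chart. -/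
def omegaZero (φ : OpenPartialHomeomorph X (Rn n)) (x : X) :
    (TangentSpace 𝓘(ℝ, Rn n) x) [⋀^Fin n]→L[ℝ] ℝ :=
  (volForm n).compContinuousLinearMap (coframe φ x)

end Base

/-- The form `ω_j = i_{∂/∂x^j} ω₀` of a chart of an `(n+1)`-dimensional manifold. -/
def omega {n : ℕ} {X : Type*} [TopologicalSpace X] [ChartedSpace (Rn (n + 1)) X]
    (φ : OpenPartialHomeomorph X (Rn (n + 1))) (j : Fin (n + 1)) (x : X) :
    (TangentSpace 𝓘(ℝ, Rn (n + 1)) x) [⋀^Fin n]→L[ℝ] ℝ :=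
  ((volForm (n + 1)).curryLeft (basisVec j)).compContinuousLinearMap (coframe φ x)

/-! ### Fibered manifolds, fibered charts and jets

The configuration manifold is the fibered product over `X` of a background manifold `Yb` and a
matter manifold `Ym`. Its points are pairs of points over the same base point, its sections are
pairs of sections. -/

/-- A fibered manifold: a surjective submersion, with `m`-dimensional fibres. -/
structure IsFiberedManifold (n m : ℕ) {X Y : Type*}
    [TopologicalSpace X] [ChartedSpace (Rn n) X]
    [TopologicalSpace Y] [ChartedSpace (Rn n × Rn m) Y] (π : Y → X) : Prop where
  surjective : Function.Surjective π
  submersion : Manifold.IsSubmersion 𝓘(ℝ, Rn n × Rn m) 𝓘(ℝ, Rn n) ∞ π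

/-- `γ` is, near `x`, a smooth section of `π`. -/
def IsSectionNear (n m : ℕ) {X Y : Type*}
    [TopologicalSpace X] [ChartedSpace (Rn n) X]
    [TopologicalSpace Y] [ChartedSpace (Rn n × Rn m) Y] (π : Y → X) (γ : X → Y) (x : X) : Prop :=
  ∀ᶠ x' in 𝓝 x, π (γ x') = x' ∧ ContMDiffAt 𝓘(ℝ, Rn n) 𝓘(ℝ, Rn n × Rn m) ∞ γ x'

/-- A configuration manifold `Y = Yb ×_X Ym`, given by its two factors: a fibered manifold `Yb`
with `a`-dimensional fibres (the background) and a fibered manifold `Ym` with `m`-dimensional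
fibres (the matter) over the same `n`-dimensional base `X`. -/
structure Configuration (n a m : ℕ) (X Yb Ym : Type*)
    [TopologicalSpace X] [ChartedSpace (Rn n) X]
    [TopologicalSpace Yb] [ChartedSpace (Rn n × Rn a) Yb]
    [TopologicalSpace Ym] [ChartedSpace (Rn n × Rn m) Ym] where
  πb : Yb → X
  πm : Ym → X
  fibered_bg : IsFiberedManifold n a πb
  fibered_mat : IsFiberedManifold n m πm

section Jets

variable {n a m : ℕ} {X Yb Ym : Type*}
  [TopologicalSpace X] [ChartedSpace (Rn n) X]
  [TopologicalSpace Yb] [ChartedSpace (Rn n × Rn a) Yb]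
  [TopologicalSpace Ym] [ChartedSpace (Rn n × Rn m) Ym]

/-- A fibered chart `(xⁱ, y^A, y^σ)` on the fibered product of the background and matter
manifolds: two fibered charts over the same chart `(xⁱ)` of the base. -/
structure FiberedChart (P : Configuration n a m X Yb Ym) where
  base : OpenPartialHomeomorph X (Rn n)
  bg : OpenPartialHomeomorph Yb (Rn n × Rn a)
  mat : OpenPartialHomeomorph Ym (Rn n × Rn m)
  base_mem : base ∈ IsManifold.maximalAtlas 𝓘(ℝ, Rn n) ∞ X
  bg_mem : bg ∈ IsManifold.maximalAtlas 𝓘(ℝ, Rn n × Rn a) ∞ Yb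
  mat_mem : mat ∈ IsManifold.maximalAtlas 𝓘(ℝ, Rn n × Rn m) ∞ Ym
  bg_base : ∀ y ∈ bg.source, P.πb y ∈ base.source ∧ (bg y).1 = base (P.πb y)
  mat_base : ∀ y ∈ mat.source, P.πm y ∈ base.source ∧ (mat y).1 = base (P.πm y)

/-- A local smooth section near `x` of the fibered product. -/
structure LocalSection (P : Configuration n a m X Yb Ym) (x : X) where
  bg : X → Yb
  mat : X → Ym
  isSection_bg : IsSectionNear n a P.πb bg x
  isSection_mat : IsSectionNear n m P.πm mat x

variable {P : Configuration n a m X Yb Ym}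

/-- The local section passes at `x` through the chart domain. -/
def FiberedChart.Mem (c : FiberedChart P) {x : X} (γ : LocalSection P x) : Prop :=
  γ.bg x ∈ c.bg.source ∧ γ.mat x ∈ c.mat.source

/-- The values of the jet coordinates that are compatible with the chart. -/
def FiberedChart.domain (c : FiberedChart P) : Set (JetCoord n a m) :=
  {p | (p.1, p.2.1 0) ∈ c.bg.target ∧ (p.1, p.2.2 0) ∈ c.mat.target}

/-- The jet coordinates of a local section at `x`: the values at `x` of the coordinates `xⁱ` and
of all the partial derivatives of the functions `y^A(x)`, `y^σ(x)` representing the section. -/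
def FiberedChart.coords (c : FiberedChart P) {x : X} (γ : LocalSection P x) :
    JetCoord n a m :=
  (c.base x,
    fun α => multiIter pderiv α (fun u => (c.bg (γ.bg (c.base.symm u))).2) (c.base x),
    fun α => multiIter pderiv α (fun u => (c.mat (γ.mat (c.base.symm u))).2) (c.base x))

variable (P) in
/-- Two local sections have the same `q`-jet at `x` if they have the same value at `x` and the same
partial derivatives up to order `q` in fibered charts around it. -/
def jetSetoid (q : ℕ) (x : X) : Setoid (LocalSection P x) where
  r γ γ' := γ.bg x = γ'.bg x ∧ γ.mat x = γ'.mat x ∧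
    ∀ c : FiberedChart P, c.Mem γ → trunc q (c.coords γ) = trunc q (c.coords γ')
  iseqv :=
    { refl := fun _ => ⟨rfl, rfl, fun _ _ => rfl⟩
      symm := fun {γ γ'} h => ⟨h.1.symm, h.2.1.symm, fun c hc =>
        (h.2.2 c ⟨by rw [h.1]; exact hc.1, by rw [h.2.1]; exact hc.2⟩).symm⟩
      trans := fun {γ γ' γ''} h h' => ⟨h.1.trans h'.1, h.2.1.trans h'.2.1, fun c hc =>
        (h.2.2 c hc).trans (h'.2.2 c ⟨by rw [← h.1]; exact hc.1, by rw [← h.2.1]; exact hc.2⟩)⟩ }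

variable (P) in
/-- The fibre over `x` of the jet space `J^q Y`. -/
def Jet (q : ℕ) (x : X) : Type _ := Quotient (jetSetoid P q x)

/-- The `q`-jet at `x` of a local section. -/
def LocalSection.jet (q : ℕ) {x : X} (γ : LocalSection P x) : Jet P q x :=
  Quotient.mk (jetSetoid P q x) γ

/-- The projection of a jet to the background manifold. -/
def Jet.bgPoint {q : ℕ} {x : X} (j : Jet P q x) : Yb :=
  Quotient.lift (fun γ : LocalSection P x => γ.bg x)
    (fun γ γ' (h : (jetSetoid P q x).r γ γ') => h.1) j

/-! ### Horizontal forms -/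

variable (P) in
/-- A horizontal `k`-form of order `q`, that is, a `k`-form
`(1/k!) A_{i₁...i_k} dx^{i₁} ∧ ... ∧ dx^{i_k}` on `J^q Y` whose coefficients in a fibered chart are
smooth functions of the jet coordinates of order at most `q`. Being horizontal, it is a map from
`J^q Y` to the `k`-covectors of the base. -/
@[ext]
structure HorizontalForm (q k : ℕ) where
  toFun : (x : X) → Jet P q x → (TangentSpace 𝓘(ℝ, Rn n) x) [⋀^Fin k]→L[ℝ] ℝ
  smooth : ∀ c : FiberedChart P, ∃ G : JetCoord n a m → Rn n [⋀^Fin k]→L[ℝ] ℝ,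
    SmoothOfOrder q c.domain G ∧
    ∀ (x : X) (γ : LocalSection P x), c.Mem γ →
      toFun x (γ.jet q) = (G (c.coords γ)).compContinuousLinearMap (coframe c.base x)

open Classical in
/-- The pullback of a horizontal form `ρ` by the prolongation `J^q γ` of a (local) section `γ`, a
`k`-form on (an open subset of) the base. -/
def HorizontalForm.pullback {q k : ℕ} (ρ : HorizontalForm P q k) (γb : X → Yb) (γm : X → Ym)
    (x : X) : (TangentSpace 𝓘(ℝ, Rn n) x) [⋀^Fin k]→L[ℝ] ℝ :=
  if h : IsSectionNear n a P.πb γb x ∧ IsSectionNear n m P.πm γm x then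
    ρ.toFun x (LocalSection.jet q ⟨γb, γm, h.1, h.2⟩)
  else 0

/-- The horizontal differential `h d ρ` of a horizontal form of order `q`, evaluated at the
`(q+1)`-jet of `γ` at `x`; it is characterised by `J^{q+1}γ^* (h d ρ) = d (J^q γ^* ρ)`. -/
def HorizontalForm.hd {q k : ℕ} (ρ : HorizontalForm P q k) {x : X}
    (γ : LocalSection P x) : (TangentSpace 𝓘(ℝ, Rn n) x) [⋀^Fin (k + 1)]→L[ℝ] ℝ :=
  extDerivM (ρ.pullback γ.bg γ.mat) x

variable (P) in
/-- A Lagrangian of order `r`: a horizontal form of degree `dim X`. -/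
abbrev Lagrangian (r : ℕ) : Type _ := HorizontalForm P r n

/-- `L` is the local expression of `lam` in the chart: `lam = L ω₀`. -/
def FiberedChart.IsLocalLagrangian (c : FiberedChart P) {r : ℕ} (lam : Lagrangian P r)
    (L : JetCoord n a m → ℝ) : Prop :=
  SmoothOfOrder r c.domain L ∧
    ∀ (x : X) (γ : LocalSection P x), c.Mem γ →
      lam.toFun x (γ.jet r) = L (c.coords γ) • omegaZero c.base x

/-! ### The energy-momentum source form -/

variable (P) in
/-- `k`-forms on `J^q Y` generated by the differentials `dxⁱ`, `dy^A`: at each `q`-jet, a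
`k`-covector at the point of the background manifold under the jet. -/
abbrev BackgroundForm (q k : ℕ) : Type _ :=
  (x : X) → (j : Jet P q x) →
    (TangentSpace 𝓘(ℝ, Rn n × Rn a) j.bgPoint) [⋀^Fin k]→L[ℝ] ℝ

/-- `τ` is the energy-momentum source form of `lam`, i.e. the Euler-Lagrange form of `lam` with
respect to the background variables: `τ = (δL/δy^A) ω^A ∧ ω₀` in any fibered chart. -/
def IsSourceForm {r q : ℕ} (lam : Lagrangian P r)
    (τ : BackgroundForm P q (n + 1)) : Prop :=
  ∀ (c : FiberedChart P) (L : JetCoord n a m → ℝ), c.IsLocalLagrangian lam L →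
    ∀ (x : X) (γ : LocalSection P x), c.Mem γ →
      τ x (γ.jet q) = (∑ A : Fin a, eulerLagrange r L A (c.coords γ) •
        contactVol A (c.coords γ)).compContinuousLinearMap
          (mfderiv 𝓘(ℝ, Rn n × Rn a) 𝓘(ℝ, Rn n × Rn a) c.bg (γ.bg x))

/-! ### Lifts of vector fields -/

section Lift

variable [IsManifold 𝓘(ℝ, Rn n) ∞ X] [IsManifold 𝓘(ℝ, Rn n × Rn a) ∞ Yb]
  [IsManifold 𝓘(ℝ, Rn n × Rn m) ∞ Ym]

variable (n m) in
/-- Smooth vector fields on the total space of a fibered manifold. -/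
abbrev TotalField (Y : Type*) [TopologicalSpace Y] [ChartedSpace (Rn n × Rn m) Y]
    [IsManifold 𝓘(ℝ, Rn n × Rn m) ∞ Y] : Type _ :=
  Cₛ^∞⟮𝓘(ℝ, Rn n × Rn m); Rn n × Rn m, (TangentSpace 𝓘(ℝ, Rn n × Rn m) : Y → Type)⟯

variable (P) in
/-- A lift `ξ ↦ Ξ = ξⁱ ∂_i + Ξ^A(x, y^B) ∂_A + Ξ^σ(x, y^μ) ∂_σ` of vector fields on `X` to
projectable vector fields on the fibered product, given by its background and matter parts. It is
`ℝ`-linear, `Ξ` projects to `ξ`, and the support of `Ξ` lies over the support of `ξ`. -/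
structure VectorLift where
  bg : BaseField n X →ₗ[ℝ] TotalField n a Yb
  mat : BaseField n X →ₗ[ℝ] TotalField n m Ym
  bg_project : ∀ (ξ : BaseField n X) (y : Yb),
    mfderiv 𝓘(ℝ, Rn n × Rn a) 𝓘(ℝ, Rn n) P.πb y (bg ξ y) = ξ (P.πb y)
  mat_project : ∀ (ξ : BaseField n X) (y : Ym),
    mfderiv 𝓘(ℝ, Rn n × Rn m) 𝓘(ℝ, Rn n) P.πm y (mat ξ y) = ξ (P.πm y)
  bg_support : ∀ ξ : BaseField n X,
    P.πb '' closure {y | bg ξ y ≠ 0} ⊆ closure {x | ξ x ≠ 0}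
  mat_support : ∀ ξ : BaseField n X,
    P.πm '' closure {y | mat ξ y ≠ 0} ⊆ closure {x | ξ x ≠ 0}

/-- The fibre component `Ξ^A` of a vector field on the background manifold. -/
def FiberedChart.vertComp (c : FiberedChart P) (Ξ : TotalField n a Yb) (A : Fin a)
    (y : Yb) : ℝ :=
  let v : Rn n × Rn a := mfderiv 𝓘(ℝ, Rn n × Rn a) 𝓘(ℝ, Rn n × Rn a) c.bg y (Ξ y)
  v.2 A

/-- In the chart, the background components of the lift are
`Ξ^A = C^A_i ξⁱ + C^{Aj}_i ξⁱ_{,j}`, with `C^A_i = C₀ A i` and `C^{Aj}_i = C₁ A j i` functions on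
the background manifold. -/
def FiberedChart.IsLiftCoeff (c : FiberedChart P) (l : VectorLift P)
    (C₀ : Fin a → Fin n → Yb → ℝ) (C₁ : Fin a → Fin n → Fin n → Yb → ℝ) : Prop :=
  ∀ (ξ : BaseField n X) (A : Fin a), ∀ y ∈ c.bg.source,
    c.vertComp (l.bg ξ) A y =
      ∑ i, C₀ A i y * comp c.base ξ i (P.πb y) +
      ∑ i, ∑ j, C₁ A j i y * compDeriv c.base ξ i j (P.πb y)

/-- The lift is of index at most `1` in the background variables. -/
def VectorLift.IndexLEOne (l : VectorLift P) : Prop :=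
  ∀ c : FiberedChart P, ∃ C₀ C₁, c.IsLiftCoeff l C₀ C₁

/-- Linearity over the ring of smooth functions on `X`. -/
def IsFunctionLinear {q k : ℕ} (T : BaseField n X → HorizontalForm P q k) : Prop :=
  (∀ (ξ η : BaseField n X) (x : X) (j : Jet P q x),
    (T (ξ + η)).toFun x j = (T ξ).toFun x j + (T η).toFun x j) ∧
  ∀ (f : C^∞⟮𝓘(ℝ, Rn n), X; ℝ⟯) (ξ η : BaseField n X), (∀ x, η x = f x • ξ x) →
    ∀ (x : X) (j : Jet P q x), (T η).toFun x j = f x • (T ξ).toFun x j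

/-- The horizontal form `h i_Ξ τ`, evaluated at the jet of `γ` at `x`. It is characterised by
`J^{q+1}γ^* (h i_Ξ τ) = J^q γ^* (i_Ξ τ)`; as `τ` is generated by `dxⁱ` and `dy^A`, only the
background part of `Ξ` (and no prolongation of it) enters, and the pullback is the pullback of
covectors by the differential of the background part of `γ`. -/
def hContract {q k : ℕ} (τ : BackgroundForm P q (k + 1)) (Ξ : TotalField n a Yb) {x : X}
    (γ : LocalSection P x) : (TangentSpace 𝓘(ℝ, Rn n) x) [⋀^Fin k]→L[ℝ] ℝ :=
  let η : (Rn n × Rn a) [⋀^Fin (k + 1)]→L[ℝ] ℝ := τ x (γ.jet q)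
  let v : Rn n × Rn a := Ξ (γ.bg x)
  (η.curryLeft v).compContinuousLinearMap (mfderiv 𝓘(ℝ, Rn n) 𝓘(ℝ, Rn n × Rn a) γ.bg x)

end Lift

/-- The Jacobian matrix `(∂x^{i'}/∂x^i)` at `x` of the change from the base coordinates `xⁱ` of `c`
to the base coordinates `x^{i'}` of `c'`; rows are indexed by `i'`, columns by `i`. -/
def FiberedChart.jacobian (c c' : FiberedChart P) (x : X) : Matrix (Fin n) (Fin n) ℝ :=
  Matrix.of fun i' i => pderiv i (fun u => c'.base (c.base.symm u)) (c.base x) i'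

/-- The functions `T^j_i = C^{Aj}_i δL/δy^A`, at the jet of `γ` at `x`. -/
def FiberedChart.emComponent (c : FiberedChart P) (r : ℕ)
    (C₁ : Fin a → Fin n → Fin n → Yb → ℝ) (L : JetCoord n a m → ℝ) (j i : Fin n) {x : X}
    (γ : LocalSection P x) : ℝ :=
  ∑ A : Fin a, C₁ A j i (γ.bg x) * eulerLagrange r L A (c.coords γ)

end Jets

/-- `T` is the energy-momentum tensor determined by the source form `τ` (of order `q`) and the
lift `ξ ↦ Ξ`: `T` and some `B` are function-linear, take horizontal values of orders `q` and
`q + 1`, and `h i_Ξ τ = B(ξ) + h d (T(ξ))` for all vector fields `ξ`. -/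
def IsEnergyMomentumTensor {n a m : ℕ} {X Yb Ym : Type*}
    [TopologicalSpace X] [ChartedSpace (Rn (n + 1)) X]
    [TopologicalSpace Yb] [ChartedSpace (Rn (n + 1) × Rn a) Yb]
    [TopologicalSpace Ym] [ChartedSpace (Rn (n + 1) × Rn m) Ym]
    [IsManifold 𝓘(ℝ, Rn (n + 1)) ∞ X] [IsManifold 𝓘(ℝ, Rn (n + 1) × Rn a) ∞ Yb]
    [IsManifold 𝓘(ℝ, Rn (n + 1) × Rn m) ∞ Ym] {P : Configuration (n + 1) a m X Yb Ym} {q : ℕ}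
    (l : VectorLift P) (τ : BackgroundForm P q (n + 2))
    (T : BaseField (n + 1) X → HorizontalForm P q n) : Prop :=
  ∃ B : BaseField (n + 1) X → HorizontalForm P (q + 1) (n + 1),
    IsFunctionLinear T ∧ IsFunctionLinear B ∧
    ∀ (ξ : BaseField (n + 1) X) (x : X) (γ : LocalSection P x),
      hContract τ (l.bg ξ) γ = (B ξ).toFun x (γ.jet (q + 1)) + (T ξ).hd γ

end EMTensor

end

open EMTensor

/-! Write E_A for δL/δy^A and N = n + 1 for the dimension of the base. Two facts carry the theorem:
the way the E_A change with the chart, and the extent to which the contraction with a lifted field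
fails to be linear over functions.

Covariance. Because the Lagrangian is a form, its local expressions satisfy L = det(∂x'/∂x) L' along
every section, in particular along sections whose background part has been varied by εφ.
Differentiating at ε = 0 compares the first variations (`first_variation_covariance`). For φ of
compact support, integration by parts moves all derivatives away from φ (`exists_adjoint`), and the
fundamental lemma of the calculus of variations gives E_A = det(∂x'/∂x) E'_B ∂y'^B/∂y^A
(`eulerLagrange_covariance`). Since ω'^B = (∂y'^B/∂y^A) ω^A along sections (`contactForm_change`)
and ω'_0 = det(∂x'/∂x) ω_0, the local expressions E_A ω^A ∧ ω_0 agree on overlaps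
(`sourceExpr_change`). They therefore glue to a unique τ, of order 2r because d_α adds |α| ≤ r to
the order r of ∂L/∂y^A_α.

The tensor. In a chart, h i_Ξ τ = E_A (Ξ^A - y^A_j ξ^j) ω_0 (`hContract_eq`). When ξ is replaced by
fξ, only the term with ξ^i_{,j} fails to be multiplied by f, and the deviation is E_A C^{Aj}_i ξ^i
(∂_j f) ω_0 = df ∧ (T^j_i ξ^i ω_j), where T^j_i = C^{Aj}_i E_A (`hContract_smul_eq_wedge`). For
function-linear T, the Leibniz rule gives h d(T(fξ)) = f h d(T(ξ)) + df ∧ T(ξ). Hence B(ξ) = h i_Ξ τ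
- h d(T(ξ)) satisfies B(fξ) = f B(ξ) exactly when df ∧ T(ξ) is that deviation. A form of degree N -
1 is determined by its products with the dx^k, so this fixes T(ξ) pointwise (`eq_emExpr`). The
characterisation does not refer to the chart, so it yields uniqueness, the local formula, agreement
on overlaps (`emExpr_change`) and hence existence, and the transformation rule.

Jets. Jets are classes of local sections, while the formal calculus runs on tuples of all jet
coordinates. The two are linked by `totalDeriv_jetMap` (total derivatives are derivatives along
sections), `FiberedChart.exists_section` (every finite jet is attained) and `jet_eq_of_trunc_eq`
(equality of jets can be tested in one chart). The order q of a given τ may be smaller than 2r; that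
the E_A then have order q is deduced from τ in `smoothOfOrder_eulerLagrange`. -/

noncomputable section

namespace EMTensor

set_option linter.unusedSectionVars false

section

open Filter

/-! ### Iterated operators -/

section MultiIter

variable {n : ℕ} {A B : Type*}

/-- A graded relation that is preserved by all the operators is preserved by their composites. -/
lemma multiIter_rel {D : Fin n → A → A} {D' : Fin n → B → B} {R : ℕ → A → B → Prop}
    (hstep : ∀ k i f g, R k f g → R (k + 1) (D i f) (D' i g)) {k : ℕ} {f : A} {g : B}
    (h : R k f g) (α : Fin n → ℕ) :
    R (k + ∑ i, α i) (multiIter D α f) (multiIter D' α g) := by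
  have hit : ∀ (i : Fin n) (s k : ℕ) f g, R k f g → R (k + s) ((D i)^[s] f) ((D' i)^[s] g) := by
    intro i s
    induction s with
    | zero => intro k f g h; simpa using h
    | succ s ih =>
      intro k f g h
      rw [Function.iterate_succ', Function.iterate_succ']
      exact hstep _ _ _ _ (ih _ _ _ h)
  have key : ∀ l : List (Fin n), R (k + (l.map α).sum)
      (l.foldr (fun i g => (D i)^[α i] g) f) (l.foldr (fun i g => (D' i)^[α i] g) g) := by
    intro l
    induction l with
    | nil => simpa using h
    | cons i l ih =>
      simp only [List.foldr_cons, List.map_cons, List.sum_cons]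
      have := hit i (α i) _ _ _ ih
      rwa [show k + (α i + (l.map α).sum) = k + (l.map α).sum + α i by ring]
  have := key (List.finRange n)
  rwa [show ∑ i, α i = ((List.finRange n).map α).sum from Fin.sum_univ_def α]

/-- An ungraded relation that is preserved by all the operators is preserved by their composites. -/
lemma multiIter_rel' {D : Fin n → A → A} {D' : Fin n → B → B} {R : A → B → Prop}
    (hstep : ∀ i f g, R f g → R (D i f) (D' i g)) {f : A} {g : B}
    (h : R f g) (α : Fin n → ℕ) : R (multiIter D α f) (multiIter D' α g) :=
  multiIter_rel (R := fun _ => R) (fun _ => hstep) (k := 0) h α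

@[simp] lemma multiIter_zero (D : Fin n → A → A) (f : A) : multiIter D 0 f = f := by
  unfold multiIter
  induction List.finRange n with
  | nil => rfl
  | cons i l => simp_all

/-- The composite applies the operators in a fixed order, so the additional factor has to be moved
past the operators standing before it, which commutation allows. For the induction the list is
arbitrary and contributes one factor per occurrence of `i`; the full list contains `i` exactly once.
-/
lemma multiIter_add_single {D : Fin n → A → A} (hD : ∀ i j, Function.Commute (D i) (D j))
    (α : Fin n → ℕ) (i : Fin n) (f : A) :
    multiIter D (α + Pi.single i 1) f = D i (multiIter D α f) := by
  have key : ∀ l : List (Fin n),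
      l.foldr (fun j g => (D j)^[(α + Pi.single i 1 : Fin n → ℕ) j] g) f =
        (D i)^[l.count i] (l.foldr (fun j g => (D j)^[α j] g) f) := by
    intro l
    induction l with
    | nil => rfl
    | cons j l ih =>
      simp only [List.foldr_cons, ih]
      by_cases hj : j = i
      · subst hj
        simp only [Pi.add_apply, Pi.single_eq_same, List.count_cons_self,
          ← Function.iterate_add_apply]
        refine congrArg (fun k => (D j)^[k] _) ?_
        ring
      · simp only [Pi.add_apply, Pi.single_eq_of_ne hj, add_zero,
          List.count_cons_of_ne hj]
        exact (((hD j i).iterate_left (α j)).iterate_right (l.count i)).eq _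
  have := key (List.finRange n)
  rwa [List.count_eq_one_of_mem (List.nodup_finRange n) (List.mem_finRange i)] at this

lemma multiIter_comm {D : Fin n → A → A} {T : A → A} (hT : ∀ i, Function.Commute (D i) T)
    (α : Fin n → ℕ) (f : A) : multiIter D α (T f) = T (multiIter D α f) :=
  multiIter_rel' (R := fun a b => a = T b) (D' := D)
    (fun i a b h => by rw [h]; exact (hT i).eq b) rfl α

end MultiIter

/-! ### Directional derivatives -/

section DirD

variable {n : ℕ} {E V W : Type*} [NormedAddCommGroup E] [NormedSpace ℝ E]
  [NormedAddCommGroup V] [NormedSpace ℝ V] [NormedAddCommGroup W] [NormedSpace ℝ W]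

/-- The directional derivative of a function along a constant vector. -/
def dirD (v : E) (f : E → V) : E → V := fun p => fderiv ℝ f p v

lemma contDiff_dirD {f : E → V} (hf : ContDiff ℝ ∞ f) (v : E) : ContDiff ℝ ∞ (dirD v f) :=
  (hf.fderiv_right (m := ∞) (by simp)).clm_apply contDiff_const

lemma contDiffAt_dirD {f : E → V} {p : E} (hf : ContDiffAt ℝ ∞ f p) (v : E) :
    ContDiffAt ℝ ∞ (dirD v f) p :=
  (hf.fderiv_right (m := ∞) (by simp)).clm_apply contDiffAt_const

lemma dirD_comm {f : E → V} (hf : ContDiff ℝ ∞ f) (v w : E) :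
    dirD v (dirD w f) = dirD w (dirD v f) := by
  have key : ∀ v w p, dirD v (dirD w f) p = fderiv ℝ (fderiv ℝ f) p v w := by
    intro v w p
    have h : DifferentiableAt ℝ (fderiv ℝ f) p :=
      ((hf.fderiv_right (m := ∞) (by simp)).differentiable (by simp)) p
    unfold dirD
    rw [fderiv_clm_apply h (differentiableAt_const w)]
    simp
  ext p
  rw [key, key]
  exact ((hf.contDiffAt).isSymmSndFDerivAt
    (by simpa using (show (2 : ℕ∞ω) ≤ ∞ from ENat.LEInfty.out))).eq v w

lemma dirD_congr {f g : E → V} {p : E} (h : f =ᶠ[𝓝 p] g) (v : E) :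
    dirD v f =ᶠ[𝓝 p] dirD v g := by
  filter_upwards [h.eventuallyEq_nhds] with p' hp'
  simp only [dirD, hp'.fderiv_eq]

lemma multiIter_dirD_congr {f g : E → V} {p : E} (w : Fin n → E) (h : f =ᶠ[𝓝 p] g)
    (α : Fin n → ℕ) :
    multiIter (fun i => dirD (w i)) α f =ᶠ[𝓝 p] multiIter (fun i => dirD (w i)) α g :=
  multiIter_rel' (R := fun f g => f =ᶠ[𝓝 p] g) (fun i _ _ h => dirD_congr h (w i)) h α

lemma contDiff_multiIter_dirD {f : E → V} (w : Fin n → E) (hf : ContDiff ℝ ∞ f) (α : Fin n → ℕ) :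
    ContDiff ℝ ∞ (multiIter (fun i => dirD (w i)) α f) :=
  multiIter_rel' (R := fun f (_ : E → V) => ContDiff ℝ ∞ f) (D' := fun i => dirD (w i))
    (fun i _ _ h => contDiff_dirD h (w i)) (g := f) hf α

/-- Directional derivatives, as operators on smooth functions. -/
def smoothDirD (v : E) (f : {f : E → V // ContDiff ℝ ∞ f}) : {f : E → V // ContDiff ℝ ∞ f} :=
  ⟨dirD v f.1, contDiff_dirD f.2 v⟩

/-- Directional derivatives commute on smooth functions only, while `multiIter_add_single` asks for
operators that commute everywhere. Restriction to the subtype of smooth functions reconciles the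
two. -/
lemma smoothDirD_commute (v w : E) :
    Function.Commute (smoothDirD (V := V) v) (smoothDirD (V := V) w) :=
  fun f => Subtype.ext (dirD_comm f.2 v w)

lemma multiIter_smoothDirD (w : Fin n → E) (α : Fin n → ℕ) (f : {f : E → V // ContDiff ℝ ∞ f}) :
    (multiIter (fun i => smoothDirD (w i)) α f).1 = multiIter (fun i => dirD (w i)) α f.1 :=
  multiIter_rel' (R := fun (a : {f : E → V // ContDiff ℝ ∞ f}) b => a.1 = b)
    (fun i a b h => by rw [← h]; rfl) rfl α

lemma multiIter_dirD_add_single {f : E → V} (hf : ContDiff ℝ ∞ f) (w : Fin n → E)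
    (α : Fin n → ℕ) (i : Fin n) :
    multiIter (fun i => dirD (w i)) (α + Pi.single i 1) f =
      dirD (w i) (multiIter (fun i => dirD (w i)) α f) := by
  have := congrArg Subtype.val (multiIter_add_single
    (fun i j => smoothDirD_commute (V := V) (w i) (w j)) α i ⟨f, hf⟩)
  rw [multiIter_smoothDirD] at this
  exact this.trans (congrArg (dirD (w i)) (multiIter_smoothDirD w α ⟨f, hf⟩))

lemma multiIter_dirD_comm {f : E → V} (hf : ContDiff ℝ ∞ f) (w : Fin n → E)
    (α : Fin n → ℕ) (v : E) :
    multiIter (fun i => dirD (w i)) α (dirD v f) =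
      dirD v (multiIter (fun i => dirD (w i)) α f) := by
  have := congrArg Subtype.val (multiIter_comm
    (fun i => smoothDirD_commute (V := V) (w i) v) α ⟨f, hf⟩)
  rw [multiIter_smoothDirD] at this
  exact this.trans (congrArg (dirD v) (multiIter_smoothDirD w α ⟨f, hf⟩))

/-- Smoothness in a neighbourhood of a point. -/
def SmoothNear (f : E → V) (p : E) : Prop := ∀ᶠ p' in 𝓝 p, ContDiffAt ℝ ∞ f p'

lemma SmoothNear.contDiffAt {f : E → V} {p : E} (h : SmoothNear f p) : ContDiffAt ℝ ∞ f p :=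
  h.self_of_nhds

lemma SmoothNear.eventually {f : E → V} {p : E} (h : SmoothNear f p) :
    ∀ᶠ p' in 𝓝 p, SmoothNear f p' := eventually_eventually_nhds.2 h

lemma _root_.ContDiff.smoothNear {f : E → V} (h : ContDiff ℝ ∞ f) (p : E) : SmoothNear f p :=
  Eventually.of_forall fun _ => h.contDiffAt

lemma SmoothNear.congr {f g : E → V} {p : E} (h : SmoothNear f p) (hfg : f =ᶠ[𝓝 p] g) :
    SmoothNear g p := by
  filter_upwards [h, hfg.eventuallyEq_nhds] with p' h1 h2
  exact h1.congr_of_eventuallyEq h2.symm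

lemma SmoothNear.comp {g : V → W} {f : E → V} {p : E} (hg : SmoothNear g (f p))
    (hf : SmoothNear f p) : SmoothNear (fun x => g (f x)) p := by
  filter_upwards [hf, hf.contDiffAt.continuousAt.eventually hg] with p' h1 h2
  exact h2.comp p' h1

lemma SmoothNear.prodMk {f : E → V} {g : E → W} {p : E} (hf : SmoothNear f p)
    (hg : SmoothNear g p) : SmoothNear (fun x => (f x, g x)) p := by
  filter_upwards [hf, hg] with p' h1 h2
  exact h1.prodMk h2

/-- A function that is smooth near a point coincides there with a globally smooth function. -/
lemma SmoothNear.exists_contDiff [FiniteDimensional ℝ E] {f : E → V} {p : E}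
    (h : SmoothNear f p) : ∃ g : E → V, ContDiff ℝ ∞ g ∧ g =ᶠ[𝓝 p] f := by
  obtain ⟨ε, hε, hball⟩ := Metric.eventually_nhds_iff_ball.1 h
  let χ : ContDiffBump p := ⟨ε / 4, ε / 2, by positivity, by linarith⟩
  refine ⟨fun x => χ x • f x, contDiff_iff_contDiffAt.2 fun x => ?_, ?_⟩
  · by_cases hx : x ∈ Metric.ball p ε
    · exact χ.contDiff.contDiffAt.smul (hball x hx)
    · have hx' : x ∉ tsupport χ := by
        rw [χ.tsupport_eq]
        intro h'
        simp only [Metric.mem_closedBall, Metric.mem_ball, not_lt] at h' hx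
        have : χ.rOut = ε / 2 := rfl
        linarith
      have : (fun x => χ x • f x) =ᶠ[𝓝 x] fun _ => 0 := by
        filter_upwards [notMem_tsupport_iff_eventuallyEq.1 hx'] with y hy
        simp [hy]
      exact contDiffAt_const.congr_of_eventuallyEq this
  · filter_upwards [χ.eventuallyEq_one] with x hx
    simp [hx]

lemma SmoothNear.multiIter_dirD [FiniteDimensional ℝ E] {f : E → V} {p : E} (h : SmoothNear f p)
    (w : Fin n → E) (α : Fin n → ℕ) : SmoothNear (multiIter (fun i => dirD (w i)) α f) p := by
  obtain ⟨g, hg, hgf⟩ := h.exists_contDiff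
  exact ((contDiff_multiIter_dirD w hg α).smoothNear p).congr (multiIter_dirD_congr w hgf α)

lemma SmoothNear.multiIter_dirD_add_single [FiniteDimensional ℝ E] {f : E → V} {p : E}
    (h : SmoothNear f p) (w : Fin n → E) (α : Fin n → ℕ) (i : Fin n) :
    multiIter (fun i => dirD (w i)) (α + Pi.single i 1) f =ᶠ[𝓝 p]
      dirD (w i) (multiIter (fun i => dirD (w i)) α f) := by
  obtain ⟨g, hg, hgf⟩ := h.exists_contDiff
  refine (multiIter_dirD_congr w hgf.symm _).trans ?_
  rw [EMTensor.multiIter_dirD_add_single hg]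
  exact dirD_congr (multiIter_dirD_congr w hgf _) _

lemma multiIter_pderiv_congr {f g : Rn n → V} {p : Rn n} (h : f =ᶠ[𝓝 p] g)
    (α : Fin n → ℕ) : multiIter pderiv α f =ᶠ[𝓝 p] multiIter pderiv α g :=
  multiIter_dirD_congr _ h α

/-- The coordinate derivatives of a smooth family of functions, as derivatives of a function of
the parameter and the coordinates. -/
lemma multiIter_pderiv_slice {K : ℝ × Rn n → V} (hK : ContDiff ℝ ∞ K) (ε : ℝ) (α : Fin n → ℕ) :
    multiIter pderiv α (fun u => K (ε, u)) =
      fun u => multiIter (fun i => dirD ((0, basisVec i) : ℝ × Rn n)) α K (ε, u) := by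
  refine (multiIter_rel' (D := pderiv) (D' := fun i => dirD ((0, basisVec i) : ℝ × Rn n))
    (R := fun f g => ContDiff ℝ ∞ g ∧ f = fun u => g (ε, u)) ?_ ⟨hK, rfl⟩ α).2
  rintro i f g ⟨hg, rfl⟩
  refine ⟨contDiff_dirD hg _, ?_⟩
  ext u
  have h1 : HasFDerivAt (fun u : Rn n => (ε, u)) (ContinuousLinearMap.inr ℝ ℝ (Rn n)) u :=
    hasFDerivAt_prodMk_right ε u
  have h2 := ((hg.differentiable (by simp)) (ε, u)).hasFDerivAt.comp u h1
  have h3 := congrArg (fun T => T (basisVec i)) h2.fderiv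
  simpa [pderiv, dirD, Function.comp_def] using h3

/-- Coordinate derivatives commute with the derivative in the parameter of a smooth family. -/
lemma hasDerivAt_multiIter_pderiv {K : ℝ × Rn n → V} {u : Rn n} (hK : SmoothNear K (0, u))
    (α : Fin n → ℕ) :
    HasDerivAt (fun ε => multiIter pderiv α (fun u => K (ε, u)) u)
      (multiIter pderiv α (fun u => dirD (1, 0) K (0, u)) u) 0 := by
  obtain ⟨g, hg, hgK⟩ := hK.exists_contDiff
  have hd : HasDerivAt (fun ε => multiIter pderiv α (fun u => g (ε, u)) u)
      (multiIter pderiv α (fun u => dirD (1, 0) g (0, u)) u) 0 := by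
    simp only [multiIter_pderiv_slice hg]
    rw [multiIter_pderiv_slice (contDiff_dirD hg _), multiIter_dirD_comm hg]
    have h1 : HasDerivAt (fun ε : ℝ => (ε, u)) ((1, 0) : ℝ × Rn n) 0 :=
      (hasDerivAt_id _).prodMk (hasDerivAt_const _ _)
    exact ((((contDiff_multiIter_dirD _ hg α).differentiable (by simp))
      (0, u)).hasFDerivAt).comp_hasDerivAt (0 : ℝ) h1
  have e1 : (fun u => dirD (1, 0) g (0, u)) =ᶠ[𝓝 u] fun u => dirD (1, 0) K (0, u) := by
    have : Tendsto (fun u : Rn n => ((0 : ℝ), u)) (𝓝 u) (𝓝 (0, u)) := by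
      exact (Continuous.prodMk_right (0 : ℝ)).tendsto u
    exact this.eventually (dirD_congr hgK (1, 0))
  rw [(multiIter_pderiv_congr e1 α).eq_of_nhds] at hd
  refine hd.congr_of_eventuallyEq ?_
  -- Agreement on a neighbourhood of (0, u) is curried: for each small ε the two slices agree near
  -- u, as required for their iterated derivatives at u to coincide.
  have : ∀ᶠ ε in 𝓝 (0 : ℝ), ∀ᶠ u' in 𝓝 u, g (ε, u') = K (ε, u') := by
    have := hgK
    rw [EventuallyEq, nhds_prod_eq] at this
    exact this.curry
  filter_upwards [this] with ε hε
  exact (multiIter_pderiv_congr hε α).eq_of_nhds.symm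

end DirD

end

section

open Filter

/-! ### Functions on jet coordinates -/

section Jet

variable {n a m : ℕ} {V W : Type*} [NormedAddCommGroup V] [NormedSpace ℝ V]
  [NormedAddCommGroup W] [NormedSpace ℝ W]

lemma mem_orderLE {n q : ℕ} {α : Fin n → ℕ} : α ∈ orderLE n q ↔ ∑ i, α i ≤ q := by
  simp only [orderLE, Finset.mem_filter, Fintype.mem_piFinset, Finset.mem_range, and_iff_right_iff_imp]
  intro h i
  exact Nat.lt_succ_of_le ((Finset.single_le_sum (fun _ _ => Nat.zero_le _) (Finset.mem_univ i)).trans h)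

lemma orderLE_mono {n q q' : ℕ} (h : q ≤ q') : orderLE n q ⊆ orderLE n q' := fun _ hα =>
  mem_orderLE.2 ((mem_orderLE.1 hα).trans h)

lemma zero_mem_orderLE {n q : ℕ} : (0 : Fin n → ℕ) ∈ orderLE n q := mem_orderLE.2 (by simp)

lemma add_single_mem_orderLE {n q : ℕ} {α : Fin n → ℕ} (h : α ∈ orderLE n q) (i : Fin n) :
    α + Pi.single i 1 ∈ orderLE n (q + 1) := by
  rw [mem_orderLE] at *
  simpa [Finset.sum_add_distrib] using h

/-- The coordinates of order zero. -/
def base0 (p : JetCoord n a m) : Rn n × Rn a × Rn m := (p.1, p.2.1 0, p.2.2 0)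

/-- The jet coordinates over a set of coordinates of order zero. -/
def jetDomain (O : Set (Rn n × Rn a × Rn m)) : Set (JetCoord n a m) := {p | base0 p ∈ O}

lemma trunc_add_smul (q : ℕ) (p v : JetCoord n a m) (t : ℝ) :
    trunc q (p + t • v) = trunc q p + t • trunc q v := rfl

lemma trunc_mono {q q' : ℕ} (h : q ≤ q') {p p' : JetCoord n a m}
    (hp : trunc q' p = trunc q' p') : trunc q p = trunc q p' := by
  simp only [trunc, Prod.mk.injEq] at hp ⊢
  refine ⟨hp.1, funext fun α => ?_, funext fun α => ?_⟩
  · exact congrFun hp.2.1 ⟨α, orderLE_mono h α.2⟩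
  · exact congrFun hp.2.2 ⟨α, orderLE_mono h α.2⟩

lemma base0_eq_of_trunc_eq {q : ℕ} {p p' : JetCoord n a m} (hp : trunc q p = trunc q p') :
    base0 p = base0 p' := by
  simp only [trunc, Prod.mk.injEq] at hp
  exact Prod.ext hp.1 (Prod.ext (congrFun hp.2.1 ⟨0, zero_mem_orderLE⟩)
    (congrFun hp.2.2 ⟨0, zero_mem_orderLE⟩))

lemma eventually_add_smul_mem {O : Set (Rn n × Rn a × Rn m)} (hO : IsOpen O)
    {p : JetCoord n a m} (hp : p ∈ jetDomain O) (v : JetCoord n a m) :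
    ∀ᶠ t : ℝ in 𝓝 0, p + t • v ∈ jetDomain O := by
  have hc : Continuous fun t : ℝ => base0 p + t • base0 v := by fun_prop
  exact hc.tendsto 0 (hO.mem_nhds (by simpa [jetDomain] using hp))

/-- The space of all jet coordinates carries no norm. A function of finite order factors through a
normed truncation, and its line derivatives are values of a Fréchet derivative there; openness is
needed only along lines and only in the coordinates of order zero. -/
lemma hasLineDerivAt_of_order {q : ℕ} {O : Set (Rn n × Rn a × Rn m)} (hO : IsOpen O)
    {f : JetCoord n a m → V} {g : TruncCoord n a m q → V}
    (hg : ∀ p ∈ jetDomain O, ContDiffAt ℝ ∞ g (trunc q p) ∧ f p = g (trunc q p))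
    {p : JetCoord n a m} (hp : p ∈ jetDomain O) (v : JetCoord n a m) :
    HasLineDerivAt ℝ f (fderiv ℝ g (trunc q p) (trunc q v)) p v := by
  have h1 : HasDerivAt (fun t : ℝ => trunc q p + t • trunc q v) (trunc q v) 0 := by
    simpa using ((hasDerivAt_id (0 : ℝ)).smul_const (trunc q v)).const_add (trunc q p)
  have h2 : HasFDerivAt g (fderiv ℝ g (trunc q p)) (trunc q p + (0 : ℝ) • trunc q v) := by
    simpa using ((hg p hp).1.differentiableAt (by simp)).hasFDerivAt
  refine (h2.comp_hasDerivAt (0 : ℝ) h1).congr_of_eventuallyEq ?_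
  filter_upwards [eventually_add_smul_mem hO hp v] with t ht
  rw [(hg _ ht).2, trunc_add_smul]; rfl

/-! #### Closure properties -/

lemma SmoothOfOrder.mono {q q' : ℕ} (h : q ≤ q') {D : Set (JetCoord n a m)}
    {f : JetCoord n a m → V} (hf : SmoothOfOrder q D f) : SmoothOfOrder q' D f := by
  obtain ⟨g, hg⟩ := hf
  let R : TruncCoord n a m q' → TruncCoord n a m q := fun t =>
    (t.1, fun α => t.2.1 ⟨α, orderLE_mono h α.2⟩, fun α => t.2.2 ⟨α, orderLE_mono h α.2⟩)
  have hR : ContDiff ℝ ∞ R := by fun_prop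
  exact ⟨fun t => g (R t), fun p hp =>
    ⟨ContDiffAt.comp (trunc q' p) (hg p hp).1 hR.contDiffAt, (hg p hp).2⟩⟩

lemma SmoothOfOrder.comp {q : ℕ} {D : Set (JetCoord n a m)} {f : JetCoord n a m → V} {h : V → W}
    (hf : SmoothOfOrder q D f) (hh : ∀ p ∈ D, ContDiffAt ℝ ∞ h (f p)) :
    SmoothOfOrder q D fun p => h (f p) := by
  obtain ⟨g, hg⟩ := hf
  refine ⟨fun t => h (g t), fun p hp => ⟨?_, congrArg h (hg p hp).2⟩⟩
  exact ContDiffAt.comp (trunc q p) (by rw [← (hg p hp).2]; exact hh p hp) (hg p hp).1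

lemma SmoothOfOrder.prodMk {q : ℕ} {D : Set (JetCoord n a m)} {f : JetCoord n a m → V}
    {h : JetCoord n a m → W} (hf : SmoothOfOrder q D f) (hh : SmoothOfOrder q D h) :
    SmoothOfOrder q D fun p => (f p, h p) := by
  obtain ⟨g, hg⟩ := hf
  obtain ⟨k, hk⟩ := hh
  exact ⟨fun t => (g t, k t), fun p hp => ⟨(hg p hp).1.prodMk (hk p hp).1,
    Prod.ext (hg p hp).2 (hk p hp).2⟩⟩

lemma smoothOfOrder_const {q : ℕ} {D : Set (JetCoord n a m)} (v : V) :
    SmoothOfOrder q D fun _ => v := ⟨fun _ => v, fun _ _ => ⟨contDiffAt_const, rfl⟩⟩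

lemma SmoothOfOrder.add {q : ℕ} {D : Set (JetCoord n a m)} {f h : JetCoord n a m → V}
    (hf : SmoothOfOrder q D f) (hh : SmoothOfOrder q D h) : SmoothOfOrder q D fun p => f p + h p :=
  (hf.prodMk hh).comp (h := fun x : V × V => x.1 + x.2) fun _ _ => by fun_prop

lemma SmoothOfOrder.sub {q : ℕ} {D : Set (JetCoord n a m)} {f h : JetCoord n a m → V}
    (hf : SmoothOfOrder q D f) (hh : SmoothOfOrder q D h) : SmoothOfOrder q D fun p => f p - h p :=
  (hf.prodMk hh).comp (h := fun x : V × V => x.1 - x.2) fun _ _ => by fun_prop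

lemma SmoothOfOrder.smul {q : ℕ} {D : Set (JetCoord n a m)} {f : JetCoord n a m → ℝ}
    {h : JetCoord n a m → V}
    (hf : SmoothOfOrder q D f) (hh : SmoothOfOrder q D h) : SmoothOfOrder q D fun p => f p • h p :=
  (hf.prodMk hh).comp (h := fun x : ℝ × V => x.1 • x.2) fun _ _ => by fun_prop

lemma SmoothOfOrder.mul {q : ℕ} {D : Set (JetCoord n a m)} {f h : JetCoord n a m → ℝ}
    (hf : SmoothOfOrder q D f) (hh : SmoothOfOrder q D h) : SmoothOfOrder q D fun p => f p * h p :=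
  hf.smul hh

lemma SmoothOfOrder.sum {q : ℕ} {D : Set (JetCoord n a m)} {ι : Type*} (s : Finset ι)
    {f : ι → JetCoord n a m → V} (hf : ∀ i ∈ s, SmoothOfOrder q D (f i)) :
    SmoothOfOrder q D fun p => ∑ i ∈ s, f i p := by
  classical
  induction s using Finset.induction_on with
  | empty => simpa using smoothOfOrder_const 0
  | insert i s hi ih =>
    simp only [Finset.sum_insert hi]
    exact (hf i (by simp)).add (ih fun j hj => hf j (by simp [hj]))

lemma smoothOfOrder_base0 {q : ℕ} {D : Set (JetCoord n a m)} {h : Rn n × Rn a × Rn m → V}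
    (hh : ∀ p ∈ D, ContDiffAt ℝ ∞ h (base0 p)) : SmoothOfOrder q D fun p => h (base0 p) := by
  let R : TruncCoord n a m q → Rn n × Rn a × Rn m := fun t =>
    (t.1, t.2.1 ⟨0, zero_mem_orderLE⟩, t.2.2 ⟨0, zero_mem_orderLE⟩)
  have hR : ContDiff ℝ ∞ R := by fun_prop
  exact ⟨fun t => h (R t), fun p hp => ⟨ContDiffAt.comp (trunc q p) (hh p hp) hR.contDiffAt, rfl⟩⟩

lemma smoothOfOrder_bgCoord {q : ℕ} {D : Set (JetCoord n a m)} {α : Fin n → ℕ}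
    (hα : α ∈ orderLE n q) : SmoothOfOrder q D fun p => p.2.1 α :=
  ⟨fun t => t.2.1 ⟨α, hα⟩, fun p _ => ⟨by fun_prop, rfl⟩⟩

/-- The direction of differentiation has the coordinates y_{α+i} as components, so it is a function
of the jet of one order higher; this alone raises the order. -/
lemma SmoothOfOrder.totalDeriv {q : ℕ} {O : Set (Rn n × Rn a × Rn m)} (hO : IsOpen O)
    {f : JetCoord n a m → ℝ} (hf : SmoothOfOrder q (jetDomain O) f) (i : Fin n) :
    SmoothOfOrder (q + 1) (jetDomain O) (totalDeriv i f) := by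
  obtain ⟨g, hg⟩ := hf
  let R : TruncCoord n a m (q + 1) → TruncCoord n a m q := fun t =>
    (t.1, fun α => t.2.1 ⟨α, orderLE_mono q.le_succ α.2⟩,
      fun α => t.2.2 ⟨α, orderLE_mono q.le_succ α.2⟩)
  have hR : ContDiff ℝ ∞ R := by fun_prop
  let d : TruncCoord n a m (q + 1) → TruncCoord n a m q := fun t =>
    (basisVec i, fun α => t.2.1 ⟨α.1 + Pi.single i 1, add_single_mem_orderLE α.2 i⟩,
      fun α => t.2.2 ⟨α.1 + Pi.single i 1, add_single_mem_orderLE α.2 i⟩)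
  have hd : ContDiff ℝ ∞ d := by fun_prop
  refine ⟨fun t => fderiv ℝ g (R t) (d t), fun p hp => ⟨?_, ?_⟩⟩
  · exact (ContDiffAt.comp (trunc (q + 1) p)
      ((hg p hp).1.fderiv_right (m := ∞) (by simp)) hR.contDiffAt).clm_apply hd.contDiffAt
  · exact (hasLineDerivAt_of_order hO hg hp _).lineDeriv

lemma SmoothOfOrder.bgPartial {q : ℕ} {O : Set (Rn n × Rn a × Rn m)} (hO : IsOpen O)
    {f : JetCoord n a m → ℝ} (hf : SmoothOfOrder q (jetDomain O) f) (A : Fin a) (α : Fin n → ℕ) :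
    SmoothOfOrder q (jetDomain O) (bgPartial A α f) := by
  obtain ⟨g, hg⟩ := hf
  refine ⟨fun t => fderiv ℝ g t (trunc q (0, Pi.single α (basisVec A), 0)), fun p hp => ⟨?_, ?_⟩⟩
  · exact ((hg p hp).1.fderiv_right (m := ∞) (by simp)).clm_apply contDiffAt_const
  · exact (hasLineDerivAt_of_order hO hg hp _).lineDeriv

lemma SmoothOfOrder.multiIter {q : ℕ} {O : Set (Rn n × Rn a × Rn m)} (hO : IsOpen O)
    {f : JetCoord n a m → ℝ} (hf : SmoothOfOrder q (jetDomain O) f) (α : Fin n → ℕ) :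
    SmoothOfOrder (q + ∑ i, α i) (jetDomain O) (multiIter EMTensor.totalDeriv α f) :=
  multiIter_rel (R := fun k f (_ : JetCoord n a m → ℝ) => SmoothOfOrder k (jetDomain O) f)
    (D' := EMTensor.totalDeriv) (g := f) (fun _ i _ _ h => h.totalDeriv hO i) hf α

/-- The partial derivatives of L keep the order r, and d_α adds |α| ≤ r. -/
lemma SmoothOfOrder.eulerLagrange {r : ℕ} {O : Set (Rn n × Rn a × Rn m)} (hO : IsOpen O)
    {L : JetCoord n a m → ℝ} (hL : SmoothOfOrder r (jetDomain O) L) (A : Fin a) :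
    SmoothOfOrder (2 * r) (jetDomain O) (eulerLagrange r L A) := by
  refine SmoothOfOrder.sum _ fun α hα => (smoothOfOrder_const _).mul ?_
  refine ((hL.bgPartial hO A α).multiIter hO α).mono ?_
  have := mem_orderLE.1 hα
  omega

/-! #### Jets of functions -/

/-- The jet coordinates at `u` of the section with background components `Y` and matter
components `Z`. -/
def jetMap (Y : Rn n → Rn a) (Z : Rn n → Rn m) (u : Rn n) : JetCoord n a m :=
  (u, fun α => multiIter pderiv α Y u, fun α => multiIter pderiv α Z u)

lemma base0_jetMap (Y : Rn n → Rn a) (Z : Rn n → Rn m) (u : Rn n) :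
    base0 (jetMap Y Z u) = (u, Y u, Z u) := by simp [base0, jetMap]

lemma jetMap_mem_jetDomain {O : Set (Rn n × Rn a × Rn m)} {Y : Rn n → Rn a} {Z : Rn n → Rn m}
    {u : Rn n} : jetMap Y Z u ∈ jetDomain O ↔ (u, Y u, Z u) ∈ O := by
  rw [← base0_jetMap]; rfl

lemma jetMap_congr {Y Y' : Rn n → Rn a} {Z Z' : Rn n → Rn m} {u : Rn n}
    (hY : Y =ᶠ[𝓝 u] Y') (hZ : Z =ᶠ[𝓝 u] Z') : jetMap Y Z u = jetMap Y' Z' u := by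
  simp only [jetMap, (multiIter_pderiv_congr hY _).eq_of_nhds,
    (multiIter_pderiv_congr hZ _).eq_of_nhds]

lemma multiIter_single {A : Type*} (D : Fin n → A → A) (i : Fin n) (f : A) :
    multiIter D (Pi.single i 1) f = D i f := by
  have key : ∀ l : List (Fin n), l.Nodup →
      l.foldr (fun j g => (D j)^[(Pi.single i 1 : Fin n → ℕ) j] g) f =
        if i ∈ l then D i f else f := by
    intro l
    induction l with
    | nil => intro _; rfl
    | cons j l ih =>
      intro hl
      rw [List.nodup_cons] at hl
      simp only [List.foldr_cons, ih hl.2]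
      by_cases hj : j = i
      · subst hj
        simp [hl.1]
      · simp [hj, Ne.symm hj]
  have := key _ (List.nodup_finRange n)
  rwa [if_pos (List.mem_finRange i)] at this

lemma smoothNear_trunc_jetMap {Y : Rn n → Rn a} {Z : Rn n → Rn m} {u : Rn n}
    (hY : SmoothNear Y u) (hZ : SmoothNear Z u) (q : ℕ) :
    SmoothNear (fun u => trunc q (jetMap Y Z u)) u := by
  have h1 : ∀ᶠ u' in 𝓝 u, ∀ α : orderLE n q, ContDiffAt ℝ ∞ (multiIter pderiv α.1 Y) u' :=
    eventually_all.2 fun α => hY.multiIter_dirD _ α.1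
  have h2 : ∀ᶠ u' in 𝓝 u, ∀ α : orderLE n q, ContDiffAt ℝ ∞ (multiIter pderiv α.1 Z) u' :=
    eventually_all.2 fun α => hZ.multiIter_dirD _ α.1
  filter_upwards [h1, h2] with u' h1 h2
  exact contDiffAt_id.prodMk ((contDiffAt_pi.2 h1).prodMk (contDiffAt_pi.2 h2))

/-- The velocity of the jet prolongation is the total-derivative direction: differentiating the
coordinate y_α along a section gives y_{α+i}, by symmetry of partial derivatives. -/
lemma fderiv_trunc_jetMap {Y : Rn n → Rn a} {Z : Rn n → Rn m} {u : Rn n}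
    (hY : SmoothNear Y u) (hZ : SmoothNear Z u) (q : ℕ) (i : Fin n) :
    fderiv ℝ (fun u => trunc q (jetMap Y Z u)) u (basisVec i) =
      trunc q (totalDir i (jetMap Y Z u)) := by
  have h1 : ∀ α : orderLE n q, DifferentiableAt ℝ (multiIter pderiv α.1 Y) u :=
    fun α => (hY.multiIter_dirD _ α.1).contDiffAt.differentiableAt (by simp)
  have h2 : ∀ α : orderLE n q, DifferentiableAt ℝ (multiIter pderiv α.1 Z) u :=
    fun α => (hZ.multiIter_dirD _ α.1).contDiffAt.differentiableAt (by simp)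
  have h := (hasFDerivAt_id u).prodMk ((hasFDerivAt_pi.2 fun α => (h1 α).hasFDerivAt).prodMk
    (hasFDerivAt_pi.2 fun α => (h2 α).hasFDerivAt))
  have e : fderiv ℝ (fun u => trunc q (jetMap Y Z u)) u = _ := h.fderiv
  rw [e]
  refine Prod.ext rfl (Prod.ext (funext fun α => ?_) (funext fun α => ?_))
  · exact ((hY.multiIter_dirD_add_single _ α.1 i).eq_of_nhds).symm
  · exact ((hZ.multiIter_dirD_add_single _ α.1 i).eq_of_nhds).symm

lemma eventually_jetMap_mem {O : Set (Rn n × Rn a × Rn m)} (hO : IsOpen O)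
    {Y : Rn n → Rn a} {Z : Rn n → Rn m} {u : Rn n} (hY : SmoothNear Y u) (hZ : SmoothNear Z u)
    (hp : jetMap Y Z u ∈ jetDomain O) : ∀ᶠ u' in 𝓝 u, jetMap Y Z u' ∈ jetDomain O := by
  have hc : ContinuousAt (fun u => (u, Y u, Z u)) u :=
    continuousAt_id.prodMk (hY.contDiffAt.continuousAt.prodMk hZ.contDiffAt.continuousAt)
  filter_upwards [hc.eventually (hO.mem_nhds (jetMap_mem_jetDomain.1 hp))] with u' h
  exact jetMap_mem_jetDomain.2 h

lemma SmoothOfOrder.smoothNear_comp_jetMap {q : ℕ} {O : Set (Rn n × Rn a × Rn m)} (hO : IsOpen O)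
    {f : JetCoord n a m → V} (hf : SmoothOfOrder q (jetDomain O) f)
    {Y : Rn n → Rn a} {Z : Rn n → Rn m} {u : Rn n} (hY : SmoothNear Y u) (hZ : SmoothNear Z u)
    (hp : jetMap Y Z u ∈ jetDomain O) : SmoothNear (fun u => f (jetMap Y Z u)) u := by
  obtain ⟨g, hg⟩ := hf
  have h1 : SmoothNear (fun u => g (trunc q (jetMap Y Z u))) u := by
    filter_upwards [eventually_jetMap_mem hO hY hZ hp, smoothNear_trunc_jetMap hY hZ q]
      with u' h1 h2
    exact (hg _ h1).1.comp u' h2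
  refine h1.congr ?_
  filter_upwards [eventually_jetMap_mem hO hY hZ hp] with u' h
  exact (hg _ h).2.symm

/-- This is the chain rule, with the velocity of the prolongation supplied by `fderiv_trunc_jetMap`.
It turns the formal calculus into ordinary calculus along sections. -/
lemma totalDeriv_jetMap {q : ℕ} {O : Set (Rn n × Rn a × Rn m)} (hO : IsOpen O)
    {f : JetCoord n a m → ℝ} (hf : SmoothOfOrder q (jetDomain O) f)
    {Y : Rn n → Rn a} {Z : Rn n → Rn m} {u : Rn n} (hY : SmoothNear Y u) (hZ : SmoothNear Z u)
    (hp : jetMap Y Z u ∈ jetDomain O) (i : Fin n) :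
    totalDeriv i f (jetMap Y Z u) = pderiv i (fun u => f (jetMap Y Z u)) u := by
  obtain ⟨g, hg⟩ := hf
  rw [totalDeriv, (hasLineDerivAt_of_order hO hg hp _).lineDeriv]
  have e : (fun u => f (jetMap Y Z u)) =ᶠ[𝓝 u] fun u => g (trunc q (jetMap Y Z u)) := by
    filter_upwards [eventually_jetMap_mem hO hY hZ hp] with u' h
    exact (hg _ h).2
  rw [pderiv, e.fderiv_eq, ← fderiv_trunc_jetMap hY hZ]
  have := fderiv_comp u (f := fun u => trunc q (jetMap Y Z u))
    ((hg _ hp).1.differentiableAt (by simp))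
    ((smoothNear_trunc_jetMap hY hZ q).contDiffAt.differentiableAt (by simp))
  exact (congrArg (fun T => T (basisVec i)) this).symm

lemma multiIter_totalDeriv_jetMap {q : ℕ} {O : Set (Rn n × Rn a × Rn m)} (hO : IsOpen O)
    {f : JetCoord n a m → ℝ} (hf : SmoothOfOrder q (jetDomain O) f)
    {Y : Rn n → Rn a} {Z : Rn n → Rn m} {u : Rn n} (hY : SmoothNear Y u) (hZ : SmoothNear Z u)
    (hp : jetMap Y Z u ∈ jetDomain O) (α : Fin n → ℕ) :
    multiIter totalDeriv α f (jetMap Y Z u) =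
      multiIter pderiv α (fun u => f (jetMap Y Z u)) u := by
  -- The relation carried along has to hold on a neighbourhood, since the next derivative is taken
  -- of it, and it has to record the order, which grows by one at each step.
  refine ((multiIter_rel (D := totalDeriv) (D' := pderiv)
    (R := fun k f h => SmoothOfOrder k (jetDomain O) f ∧
      (fun u => f (jetMap Y Z u)) =ᶠ[𝓝 u] h) ?_ ⟨hf, EventuallyEq.rfl⟩ α).2).eq_of_nhds
  rintro k i f h ⟨hf, hfh⟩
  refine ⟨hf.totalDeriv hO i, ?_⟩
  filter_upwards [hY.eventually, hZ.eventually, eventually_jetMap_mem hO hY hZ hp,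
    dirD_congr hfh (basisVec i)] with u' h1 h2 h3 h4
  rw [totalDeriv_jetMap hO hf h1 h2 h3]
  exact h4

lemma eulerLagrange_jetMap {r : ℕ} {O : Set (Rn n × Rn a × Rn m)} (hO : IsOpen O)
    {L : JetCoord n a m → ℝ} (hL : SmoothOfOrder r (jetDomain O) L)
    {Y : Rn n → Rn a} {Z : Rn n → Rn m} {u : Rn n} (hY : SmoothNear Y u) (hZ : SmoothNear Z u)
    (hp : jetMap Y Z u ∈ jetDomain O) (A : Fin a) :
    eulerLagrange r L A (jetMap Y Z u) = ∑ α ∈ orderLE n r, (-1 : ℝ) ^ (∑ i, α i) *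
      multiIter pderiv α (fun u => bgPartial A α L (jetMap Y Z u)) u := by
  refine Finset.sum_congr rfl fun α _ => ?_
  rw [multiIter_totalDeriv_jetMap hO (hL.bgPartial hO A α) hY hZ hp]

/-- The first variation of a Lagrangian function along a family of sections. -/
lemma hasDerivAt_lagrangian {r : ℕ} {O : Set (Rn n × Rn a × Rn m)} (hO : IsOpen O)
    {L : JetCoord n a m → ℝ} (hL : SmoothOfOrder r (jetDomain O) L)
    {K : ℝ × Rn n → Rn a} {Z : Rn n → Rn m} {u : Rn n} (hK : SmoothNear K (0, u))
    (hp : jetMap (fun u => K (0, u)) Z u ∈ jetDomain O) :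
    HasDerivAt (fun ε => L (jetMap (fun u => K (ε, u)) Z u))
      (∑ α ∈ orderLE n r, ∑ A, bgPartial A α L (jetMap (fun u => K (0, u)) Z u) *
        multiIter pderiv α (fun u => dirD (1, 0) K (0, u)) u A) 0 := by
  obtain ⟨g, hg⟩ := hL
  set p := jetMap (fun u => K (0, u)) Z u with hpdef
  set δ : (Fin n → ℕ) → Rn a := fun α => multiIter pderiv α (fun u => dirD (1, 0) K (0, u)) u
  have hT : HasDerivAt (fun ε => trunc r (jetMap (fun u => K (ε, u)) Z u))
      (trunc r (0, δ, 0)) 0 := by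
    refine (hasDerivAt_const _ _).prodMk (HasDerivAt.prodMk ?_
      (hasDerivAt_const (0 : ℝ) fun α : orderLE n r => multiIter pderiv α.1 Z u))
    exact hasDerivAt_pi.2 fun α => hasDerivAt_multiIter_pderiv hK α.1
  have h1 := ((hg p hp).1.differentiableAt (by simp)).hasFDerivAt.comp_hasDerivAt (0 : ℝ) hT
  -- Only background coordinates move along the family, so its velocity is a combination of the
  -- directions that define `bgPartial`.
  have hδ : trunc r ((0, δ, 0) : JetCoord n a m) = ∑ α ∈ orderLE n r, ∑ A : Fin a,
      δ α A • trunc r ((0, Pi.single α (basisVec A), 0) : JetCoord n a m) := by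
    have hb : ∀ v : Rn a, v = ∑ A, v A • basisVec A := by
      intro v
      simpa [basisVec] using ((EuclideanSpace.basisFun (Fin a) ℝ).sum_repr v).symm
    refine Prod.ext ?_ (Prod.ext (funext fun β => ?_) ?_)
    · simp [trunc, Prod.fst_sum]
    · simp only [trunc, Prod.snd_sum, Prod.fst_sum, Finset.sum_apply, Prod.smul_snd, Prod.smul_fst,
        Pi.smul_apply]
      rw [Finset.sum_eq_single_of_mem β.1 β.2]
      · simpa using hb (δ β.1)
      · intro α _ hα
        simp [Pi.single_eq_of_ne (Ne.symm hα)]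
    · ext β
      simp [trunc, Prod.snd_sum]
  have h2 : fderiv ℝ g (trunc r p) (trunc r (0, δ, 0)) =
      ∑ α ∈ orderLE n r, ∑ A, bgPartial A α L p * δ α A := by
    rw [hδ, map_sum]
    refine Finset.sum_congr rfl fun α _ => ?_
    rw [map_sum]
    refine Finset.sum_congr rfl fun A _ => ?_
    rw [map_smul, bgPartial, (hasLineDerivAt_of_order hO hg hp _).lineDeriv, smul_eq_mul, mul_comm]
  rw [h2] at h1
  refine h1.congr_of_eventuallyEq ?_
  have hc : ContinuousAt (fun ε : ℝ => (u, K (ε, u), Z u)) 0 := by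
    have : ContinuousAt (fun ε : ℝ => K (ε, u)) 0 :=
      ContinuousAt.comp (f := fun ε : ℝ => (ε, u)) hK.contDiffAt.continuousAt (by fun_prop)
    exact continuousAt_const.prodMk (this.prodMk continuousAt_const)
  filter_upwards [hc.eventually (hO.mem_nhds (jetMap_mem_jetDomain.1 hp))] with ε hε
  exact (hg _ (jetMap_mem_jetDomain (Y := fun u => K (ε, u)).2 hε)).2

end Jet

end

section

open Filter MeasureTheory

/-! ### Integration by parts -/

section Parts

variable {n a m : ℕ} {V W : Type*} [NormedAddCommGroup V] [NormedSpace ℝ V]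
  [NormedAddCommGroup W] [NormedSpace ℝ W]

lemma contDiff_multiIter_pderiv {f : Rn n → V} (hf : ContDiff ℝ ∞ f) (α : Fin n → ℕ) :
    ContDiff ℝ ∞ (multiIter pderiv α f) := contDiff_multiIter_dirD _ hf α

lemma multiIter_pderiv_clm {f : Rn n → V} (hf : ContDiff ℝ ∞ f) (T : V →L[ℝ] W)
    (α : Fin n → ℕ) :
    multiIter pderiv α (fun u => T (f u)) = fun u => T (multiIter pderiv α f u) := by
  refine (multiIter_rel' (D := pderiv) (D' := pderiv)
    (R := fun h g => ContDiff ℝ ∞ g ∧ h = fun u => T (g u)) ?_ ⟨hf, rfl⟩ α).2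
  rintro i h g ⟨hg, rfl⟩
  refine ⟨contDiff_dirD hg _, funext fun u => ?_⟩
  have := T.hasFDerivAt.comp u ((hg.differentiable (by simp)) u).hasFDerivAt
  exact congrArg (fun S => S (basisVec i)) this.fderiv

lemma tsupport_multiIter_pderiv (f : Rn n → V) (α : Fin n → ℕ) :
    tsupport (multiIter pderiv α f) ⊆ tsupport f :=
  multiIter_rel' (R := fun g (_ : Rn n → V) => tsupport g ⊆ tsupport f) (D' := pderiv)
    (fun i _ _ h => (tsupport_fderiv_apply_subset ℝ (basisVec i)).trans h) (g := f) subset_rfl α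

lemma hasCompactSupport_multiIter_pderiv {f : Rn n → V} (hf : HasCompactSupport f)
    (α : Fin n → ℕ) : HasCompactSupport (multiIter pderiv α f) :=
  hf.of_isClosed_subset (isClosed_tsupport _) (tsupport_multiIter_pderiv f α)

lemma exists_add_single {α : Fin n → ℕ} {k : ℕ} (h : ∑ i, α i = k + 1) :
    ∃ (i : Fin n) (β : Fin n → ℕ), α = β + Pi.single i 1 ∧ ∑ j, β j = k := by
  obtain ⟨i, hi⟩ : ∃ i, α i ≠ 0 := by
    by_contra! h'
    simp [h'] at h
  have e : α = (α - Pi.single i 1) + Pi.single i 1 := by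
    funext j
    by_cases hj : j = i
    · subst hj
      simp only [Pi.add_apply, Pi.sub_apply, Pi.single_eq_same]
      omega
    · simp [Pi.single_eq_of_ne hj]
  refine ⟨i, α - Pi.single i 1, e, ?_⟩
  rw [e] at h
  simp only [Pi.add_apply, Finset.sum_add_distrib, Finset.sum_pi_single', Finset.mem_univ,
    if_true] at h
  omega

/-- One derivative is moved at a time, the function `f` being general in the induction so that it
can absorb it. Compact support of φ suffices: every integrand contains φ or a derivative of it,
hence there are no boundary terms. -/
lemma integral_mul_multiIter_pderiv {f φ : Rn n → ℝ} (hf : ContDiff ℝ ∞ f) (hφ : ContDiff ℝ ∞ φ)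
    (hc : HasCompactSupport φ) (α : Fin n → ℕ) :
    ∫ u, f u * multiIter pderiv α φ u =
      ∫ u, ((-1 : ℝ) ^ (∑ i, α i) * multiIter pderiv α f u) * φ u := by
  induction hk : ∑ i, α i generalizing α f with
  | zero =>
    have : α = 0 := by
      funext i
      exact (Finset.sum_eq_zero_iff.1 hk) i (Finset.mem_univ i)
    subst this
    simp
  | succ k ih =>
    obtain ⟨i, β, rfl, hβ⟩ := exists_add_single hk
    have e1 : multiIter pderiv (β + Pi.single i 1) φ = pderiv i (multiIter pderiv β φ) :=
      multiIter_dirD_add_single hφ _ β i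
    have e2 : multiIter pderiv (β + Pi.single i 1) f = multiIter pderiv β (pderiv i f) :=
      (multiIter_dirD_add_single hf _ β i).trans (multiIter_dirD_comm hf _ β _).symm
    have hsφ := contDiff_multiIter_pderiv hφ β
    have hcφ := hasCompactSupport_multiIter_pderiv hc β
    have hdf : ContDiff ℝ ∞ (pderiv i f) := contDiff_dirD hf _
    have hdφ : ContDiff ℝ ∞ (pderiv i (multiIter pderiv β φ)) := contDiff_dirD hsφ _
    rw [e1, e2]
    have ibp := integral_mul_fderiv_eq_neg_fderiv_mul_of_integrable (μ := volume) (f := f)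
      (g := multiIter pderiv β φ) (v := basisVec i)
      ((hdf.continuous.mul hsφ.continuous).integrable_of_hasCompactSupport hcφ.mul_left)
      ((hf.continuous.mul hdφ.continuous).integrable_of_hasCompactSupport
        (HasCompactSupport.mul_left (hcφ.fderiv_apply ℝ (basisVec i))))
      ((hf.continuous.mul hsφ.continuous).integrable_of_hasCompactSupport hcφ.mul_left)
      (fun x _ => hf.differentiable (by simp) x) (fun x _ => hsφ.differentiable (by simp) x)
    refine ibp.trans ?_
    have := ih hdf β hβ
    rw [show (∫ u, fderiv ℝ f u (basisVec i) * multiIter pderiv β φ u) = _ from this,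
      ← integral_neg]
    refine integral_congr_ae (Eventually.of_forall fun u => ?_)
    simp only [pow_succ]
    ring

/-- Near a point, the Euler-Lagrange expressions along a section are given by the formal adjoint
of the first variation. -/
lemma exists_adjoint {r : ℕ} {O : Set (Rn n × Rn a × Rn m)} (hO : IsOpen O)
    {L : JetCoord n a m → ℝ} (hL : SmoothOfOrder r (jetDomain O) L)
    {Y : Rn n → Rn a} {Z : Rn n → Rn m} {u₀ : Rn n} (hY : SmoothNear Y u₀) (hZ : SmoothNear Z u₀)
    (hp : jetMap Y Z u₀ ∈ jetDomain O) :
    ∃ (f : (Fin n → ℕ) → Fin a → Rn n → ℝ) (E : Fin a → Rn n → ℝ),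
      (∀ α A, ContDiff ℝ ∞ (f α A)) ∧ (∀ A, ContDiff ℝ ∞ (E A)) ∧
      (∀ᶠ u in 𝓝 u₀, ∀ α ∈ orderLE n r, ∀ A, f α A u = bgPartial A α L (jetMap Y Z u)) ∧
      (∀ᶠ u in 𝓝 u₀, ∀ A, E A u = eulerLagrange r L A (jetMap Y Z u)) ∧
      ∀ φ : Rn n → Rn a, ContDiff ℝ ∞ φ → HasCompactSupport φ →
        ∫ u, ∑ α ∈ orderLE n r, ∑ A, f α A u * multiIter pderiv α φ u A =
          ∫ u, ∑ A, E A u * φ u A := by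
  have hs : ∀ (α : Fin n → ℕ) (A : Fin a), SmoothNear
      (fun u => bgPartial A α L (jetMap Y Z u)) u₀ := fun α A =>
    (hL.bgPartial hO A α).smoothNear_comp_jetMap hO hY hZ hp
  -- The coefficients are smooth near u₀ only. They are replaced by global smooth functions with the
  -- same germ at u₀; integration by parts then holds on all of ℝⁿ, while the identification with L
  -- is kept near u₀.
  choose f hf hfe using fun α A => (hs α A).exists_contDiff
  have hE : ∀ A, ContDiff ℝ ∞ fun u => ∑ α ∈ orderLE n r,
      (-1 : ℝ) ^ (∑ i, α i) * multiIter pderiv α (f α A) u := fun A =>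
    ContDiff.sum fun α _ => contDiff_const.mul (contDiff_multiIter_pderiv (hf α A) α)
  refine ⟨f, fun A u => ∑ α ∈ orderLE n r, (-1 : ℝ) ^ (∑ i, α i) *
    multiIter pderiv α (f α A) u, hf, hE, ?_, ?_, ?_⟩
  · refine (Filter.eventually_all_finset _).2 fun α _ => eventually_all.2 fun A => hfe α A
  · have h1 : ∀ᶠ u in 𝓝 u₀, ∀ α ∈ orderLE n r, ∀ A, multiIter pderiv α (f α A) u =
        multiIter pderiv α (fun u => bgPartial A α L (jetMap Y Z u)) u :=
      (Filter.eventually_all_finset _).2 fun α _ => eventually_all.2 fun A =>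
        multiIter_pderiv_congr (hfe α A) α
    filter_upwards [h1, hY.eventually, hZ.eventually, eventually_jetMap_mem hO hY hZ hp]
      with u h1 h2 h3 h4 A
    rw [eulerLagrange_jetMap hO hL h2 h3 h4]
    exact Finset.sum_congr rfl fun α hα => by rw [h1 α hα A]
  · intro φ hφ hc
    have hφA : ∀ A, ContDiff ℝ ∞ fun u => φ u A := fun A =>
      (EuclideanSpace.proj A : Rn a →L[ℝ] ℝ).contDiff.comp hφ
    have hcA : ∀ A, HasCompactSupport fun u => φ u A := fun A =>
      hc.comp_left (g := fun v : Rn a => v A) rfl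
    have hcomp : ∀ α A u, multiIter pderiv α φ u A = multiIter pderiv α (fun u => φ u A) u := by
      intro α A u
      exact (congrFun (multiIter_pderiv_clm hφ (EuclideanSpace.proj A : Rn a →L[ℝ] ℝ) α) u).symm
    simp only [hcomp, Finset.sum_mul]
    have int1 : ∀ α A, Integrable fun u => f α A u * multiIter pderiv α (fun u => φ u A) u :=
      fun α A => ((hf α A).continuous.mul
        (contDiff_multiIter_pderiv (hφA A) α).continuous).integrable_of_hasCompactSupport
        (hasCompactSupport_multiIter_pderiv (hcA A) α).mul_left
    have int2 : ∀ α A, Integrable fun u => (-1 : ℝ) ^ (∑ i, α i) *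
        multiIter pderiv α (f α A) u * φ u A :=
      fun α A => ((continuous_const.mul
        (contDiff_multiIter_pderiv (hf α A) α).continuous).mul
        (hφA A).continuous).integrable_of_hasCompactSupport (hcA A).mul_left
    rw [integral_finsetSum _ fun α _ => integrable_finsetSum _ fun A _ => int1 α A,
      integral_finsetSum _ fun A _ => integrable_finsetSum _ fun α _ => int2 α A]
    simp_rw [integral_finsetSum _ fun A _ => int1 _ A, integral_finsetSum _ fun α _ => int2 α _,
      integral_mul_multiIter_pderiv (hf _ _) (hφA _) (hcA _)]
    exact Finset.sum_comm

end Parts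

/-! ### Covariance of the Euler-Lagrange expressions -/

section Covariance

variable {n a m : ℕ} {r : ℕ} {O O' : Set (Rn n × Rn a × Rn m)} {L L' : JetCoord n a m → ℝ}
  {Y Y' : Rn n → Rn a} {Z Z' : Rn n → Rn m} {u₀ : Rn n}
  {Φ : OpenPartialHomeomorph (Rn n) (Rn n)} {F : Rn n × Rn a → Rn a}

/-- A variation φ of the background components becomes ∂F/∂y · φ in the new fibre coordinates; the
base point is fixed, so only the fibre part of the derivative of F enters. -/
lemma hasFDerivAt_family {φ : Rn n → Rn a} {u : Rn n} (hF : ContDiffAt ℝ ∞ F (u, Y u)) :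
    HasDerivAt (fun ε : ℝ => F (u, Y u + ε • φ u)) (fderiv ℝ F (u, Y u) (0, φ u)) 0 := by
  have h1 : HasDerivAt (fun ε : ℝ => (u, Y u + ε • φ u)) (0, φ u) 0 := by
    refine (hasDerivAt_const _ _).prodMk ?_
    simpa using ((hasDerivAt_id (0 : ℝ)).smul_const (φ u)).const_add (Y u)
  have h2 : HasFDerivAt F (fderiv ℝ F (u, Y u)) (u, Y u + (0 : ℝ) • φ u) := by
    simpa using (hF.differentiableAt (by simp)).hasFDerivAt
  exact h2.comp_hasDerivAt (0 : ℝ) h1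

lemma smoothNear_family {φ : Rn n → Rn a} {u : Rn n} (hF : SmoothNear F (u, Y u))
    (hY : SmoothNear Y u) (hφ : ContDiff ℝ ∞ φ) :
    SmoothNear (fun x : ℝ × Rn n => F (x.2, Y x.2 + x.1 • φ x.2)) (0, u) := by
  have h1 : SmoothNear (fun x : ℝ × Rn n => (x.2, Y x.2 + x.1 • φ x.2)) (0, u) := by
    have : ∀ᶠ x : ℝ × Rn n in 𝓝 (0, u), ContDiffAt ℝ ∞ Y x.2 :=
      (continuous_snd.tendsto ((0, u) : ℝ × Rn n)).eventually hY
    filter_upwards [this] with x hx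
    have h2 : ContDiffAt ℝ ∞ (fun x : ℝ × Rn n => Y x.2) x := hx.comp x contDiffAt_snd
    have h3 : ContDiffAt ℝ ∞ (fun x : ℝ × Rn n => φ x.2) x := hφ.contDiffAt.comp x contDiffAt_snd
    fun_prop
  exact SmoothNear.comp (f := fun x : ℝ × Rn n => (x.2, Y x.2 + x.1 • φ x.2)) (by simpa using hF) h1

/-- Covariance of the first variation. -/
lemma first_variation_covariance (hO : IsOpen O) (hO' : IsOpen O')
    (hL : SmoothOfOrder r (jetDomain O) L) (hL' : SmoothOfOrder r (jetDomain O') L')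
    {u : Rn n} (hu : u ∈ Φ.source) (hΦ' : SmoothNear Φ.symm (Φ u))
    (hY : SmoothNear Y u)
    (hp : jetMap Y Z u ∈ jetDomain O) (hp' : jetMap Y' Z' (Φ u) ∈ jetDomain O')
    (hF : SmoothNear F (u, Y u)) (hY' : ∀ᶠ u in 𝓝 u, Y' (Φ u) = F (u, Y u))
    {φ φ' : Rn n → Rn a} (hφ : ContDiff ℝ ∞ φ)
    (hφ' : ∀ᶠ u in 𝓝 u, φ' (Φ u) = fderiv ℝ F (u, Y u) (0, φ u)) {d : ℝ}
    (hcov : ∀ᶠ ε in 𝓝 (0 : ℝ), L (jetMap (fun u => Y u + ε • φ u) Z u) =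
      d * L' (jetMap (fun u' => F (Φ.symm u', Y (Φ.symm u') + ε • φ (Φ.symm u'))) Z' (Φ u))) :
    ∑ α ∈ orderLE n r, ∑ A, bgPartial A α L (jetMap Y Z u) * multiIter pderiv α φ u A =
      d * ∑ α ∈ orderLE n r, ∑ A, bgPartial A α L' (jetMap Y' Z' (Φ u)) *
        multiIter pderiv α φ' (Φ u) A := by
  have hsymm : Φ.symm (Φ u) = u := Φ.left_inv hu
  have hnear : ∀ {p : Rn n → Prop}, (∀ᶠ u in 𝓝 u, p u) → ∀ᶠ u' in 𝓝 (Φ u), p (Φ.symm u') := by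
    intro p h
    have := hΦ'.contDiffAt.continuousAt.tendsto
    rw [hsymm] at this
    exact this.eventually h
  have htarget : ∀ᶠ u' in 𝓝 (Φ u), u' ∈ Φ.target :=
    Φ.open_target.mem_nhds (Φ.map_source hu)
  -- the family in the first chart
  have hK : SmoothNear (fun x : ℝ × Rn n => Y x.2 + x.1 • φ x.2) (0, u) :=
    smoothNear_family (F := Prod.snd) (Eventually.of_forall fun _ => contDiffAt_snd) hY hφ
  have d1 := hasDerivAt_lagrangian (Z := Z) hO hL hK (by simpa using hp)
  have e1 : (fun u => dirD (1, 0) (fun x : ℝ × Rn n => Y x.2 + x.1 • φ x.2) (0, u)) =ᶠ[𝓝 u] φ := by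
    filter_upwards [(Continuous.prodMk_right (0 : ℝ)).continuousAt.eventually hK] with u hK
    have h1 : HasDerivAt (fun ε : ℝ => (ε, u)) ((1, 0) : ℝ × Rn n) 0 :=
      (hasDerivAt_id _).prodMk (hasDerivAt_const _ _)
    have h2 := (hK.differentiableAt (by simp)).hasFDerivAt.comp_hasDerivAt (0 : ℝ) h1
    have h3 : HasDerivAt (fun ε : ℝ => Y u + ε • φ u) (φ u) 0 := by
      simpa using ((hasDerivAt_id (0 : ℝ)).smul_const (φ u)).const_add (Y u)
    exact h2.unique h3
  -- the family in the second chart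
  have hK₀ : SmoothNear (fun x : ℝ × Rn n => F (x.2, Y x.2 + x.1 • φ x.2)) (0, u) :=
    smoothNear_family hF hY hφ
  have hK' : SmoothNear (fun x : ℝ × Rn n =>
      F (Φ.symm x.2, Y (Φ.symm x.2) + x.1 • φ (Φ.symm x.2))) (0, Φ u) := by
    have h1 : SmoothNear (fun x : ℝ × Rn n => (x.1, Φ.symm x.2)) (0, Φ u) := by
      have : ∀ᶠ x : ℝ × Rn n in 𝓝 (0, Φ u), ContDiffAt ℝ ∞ Φ.symm x.2 :=
        (continuous_snd.tendsto ((0, Φ u) : ℝ × Rn n)).eventually hΦ'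
      filter_upwards [this] with x hx
      have h2 : ContDiffAt ℝ ∞ (fun x : ℝ × Rn n => Φ.symm x.2) x := hx.comp x contDiffAt_snd
      fun_prop
    exact SmoothNear.comp (f := fun x : ℝ × Rn n => (x.1, Φ.symm x.2)) (by simpa [hsymm] using hK₀) h1
  -- At ε = 0 the transformed family is Y' only near Φ u; this is enough, because a jet depends only
  -- on the germ.
  have e0 : (fun u' => F (Φ.symm u', Y (Φ.symm u') + (0 : ℝ) • φ (Φ.symm u'))) =ᶠ[𝓝 (Φ u)] Y' := by
    filter_upwards [hnear hY', htarget] with u' h1 h2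
    rw [zero_smul, add_zero, ← h1, Φ.right_inv h2]
  have j0 : jetMap (fun u' => F (Φ.symm u', Y (Φ.symm u') + (0 : ℝ) • φ (Φ.symm u'))) Z' (Φ u) =
      jetMap Y' Z' (Φ u) := jetMap_congr e0 EventuallyEq.rfl
  have d2 := hasDerivAt_lagrangian (Z := Z') hO' hL' hK' (by rw [j0]; exact hp')
  have e2 : (fun u' => dirD (1, 0) (fun x : ℝ × Rn n =>
      F (Φ.symm x.2, Y (Φ.symm x.2) + x.1 • φ (Φ.symm x.2))) (0, u')) =ᶠ[𝓝 (Φ u)] φ' := by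
    have hF' : ∀ᶠ u in 𝓝 u, ContDiffAt ℝ ∞ F (u, Y u) :=
      (continuousAt_id.prodMk hY.contDiffAt.continuousAt).eventually hF
    filter_upwards [(Continuous.prodMk_right (0 : ℝ)).continuousAt.eventually hK',
      hnear hφ', htarget, hnear hF'] with u' hK' h1 h2 hF'
    have h3 : HasDerivAt (fun ε : ℝ => (ε, u')) ((1, 0) : ℝ × Rn n) 0 :=
      (hasDerivAt_id _).prodMk (hasDerivAt_const _ _)
    have h4 := (hK'.differentiableAt (by simp)).hasFDerivAt.comp_hasDerivAt (0 : ℝ) h3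
    rw [Φ.right_inv h2] at h1
    rw [h1]
    exact h4.unique (hasFDerivAt_family hF')
  simp only [fun α => (multiIter_pderiv_congr e1 α).eq_of_nhds, zero_smul, add_zero] at d1
  simp only [fun α => (multiIter_pderiv_congr e2 α).eq_of_nhds, j0] at d2
  -- By `hcov` both sides are derivatives at ε = 0 of one and the same function of ε.
  exact d1.unique ((d2.const_mul d).congr_of_eventuallyEq hcov)

/-- Covariance of the Euler-Lagrange expressions under changes of fibered coordinates. -/
theorem eulerLagrange_covariance (hO : IsOpen O) (hO' : IsOpen O')
    (hL : SmoothOfOrder r (jetDomain O) L) (hL' : SmoothOfOrder r (jetDomain O') L')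
    (hu₀ : u₀ ∈ Φ.source) (hΦ : ContDiffOn ℝ ∞ Φ Φ.source) (hΦ' : ContDiffOn ℝ ∞ Φ.symm Φ.target)
    (hdet : ∀ u ∈ Φ.source, (fderiv ℝ Φ u).det ≠ 0)
    (hY : SmoothNear Y u₀) (hZ : SmoothNear Z u₀)
    (hYs : SmoothNear Y' (Φ u₀)) (hZs : SmoothNear Z' (Φ u₀))
    (hp : jetMap Y Z u₀ ∈ jetDomain O) (hp' : jetMap Y' Z' (Φ u₀) ∈ jetDomain O')
    (hF : SmoothNear F (u₀, Y u₀)) (hY' : ∀ᶠ u in 𝓝 u₀, Y' (Φ u) = F (u, Y u))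
    (hcov : ∀ᶠ u in 𝓝 u₀, ∀ φ : Rn n → Rn a, ContDiff ℝ ∞ φ → ∀ᶠ ε in 𝓝 (0 : ℝ),
      L (jetMap (fun u => Y u + ε • φ u) Z u) = (fderiv ℝ Φ u).det *
        L' (jetMap (fun u' => F (Φ.symm u', Y (Φ.symm u') + ε • φ (Φ.symm u'))) Z' (Φ u)))
    (A : Fin a) :
    eulerLagrange r L A (jetMap Y Z u₀) = (fderiv ℝ Φ u₀).det *
      ∑ B, eulerLagrange r L' B (jetMap Y' Z' (Φ u₀)) *
        (fderiv ℝ F (u₀, Y u₀) (0, basisVec A)) B := by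
  obtain ⟨f, E, hf, hE, hfe, hEe, hint⟩ := exists_adjoint hO hL hY hZ hp
  obtain ⟨f', E', hf', hE', hfe', hEe', hint'⟩ := exists_adjoint hO' hL' hYs hZs hp'
  have hM : SmoothNear (fun u => fderiv ℝ F (u, Y u) (0, basisVec A)) u₀ :=
    SmoothNear.comp (g := fun x => fderiv ℝ F x (0, basisVec A)) (f := fun u => (u, Y u))
      (hF.mono fun _ h => contDiffAt_dirD h _)
      (SmoothNear.prodMk (Eventually.of_forall fun _ => contDiffAt_id) hY)
  -- M is the column ∂F/∂y^A of the fibre Jacobian along the section, extended to a global smooth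
  -- function.
  obtain ⟨M, hMs, hMe⟩ := hM.exists_contDiff
  have hΦs : ∀ u ∈ Φ.source, ContDiffAt ℝ ∞ Φ u := fun u hu =>
    hΦ.contDiffAt (Φ.open_source.mem_nhds hu)
  have hΦcont : ContinuousAt Φ u₀ := (hΦs u₀ hu₀).continuousAt
  have hdetc : ContinuousOn (fun u => (fderiv ℝ Φ u).det) Φ.source := fun u hu =>
    (ContinuousLinearMap.continuous_det.continuousAt.comp
      (((hΦs u hu).fderiv_right (m := ∞) (by simp)).continuousAt)).continuousWithinAt
  -- The Lagrangians are related by the determinant, the change of variables in the integral by its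
  -- absolute value. The sign is constant near u₀ and can be taken out of the integrals.
  set s : ℝ := ((SignType.sign (fderiv ℝ Φ u₀).det : SignType) : ℝ) with hsdef
  have hsign : ∀ᶠ u in 𝓝 u₀, s * |(fderiv ℝ Φ u).det| = (fderiv ℝ Φ u).det := by
    have hc : ContinuousAt (fun u => (fderiv ℝ Φ u).det) u₀ :=
      hdetc.continuousAt (Φ.open_source.mem_nhds hu₀)
    rcases lt_or_gt_of_ne (hdet u₀ hu₀) with h | h
    · filter_upwards [hc.eventually (gt_mem_nhds h)] with u hu
      simp [hsdef, sign_neg h, abs_of_neg hu]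
    · filter_upwards [hc.eventually (lt_mem_nhds h)] with u hu
      simp [hsdef, sign_pos h, abs_of_pos hu]
  have hsrc : ∀ᶠ u in 𝓝 u₀, u ∈ Φ.source := Φ.open_source.mem_nhds hu₀
  -- All local identities are made to hold on one open set W, which will contain the supports of the
  -- test functions.
  have hall := hsrc.and
    (hfe.and (hEe.and (hMe.and ((hΦcont.eventually hfe').and ((hΦcont.eventually hEe').and
    (hsign.and (hcov.and (hY.eventually.and ((eventually_jetMap_mem hO hY hZ hp).and
    ((hΦcont.eventually (eventually_jetMap_mem hO' hYs hZs hp')).and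
    (((continuousAt_id.prodMk hY.contDiffAt.continuousAt).eventually hF.eventually).and
    (eventually_eventually_nhds.2 hY'))))))))))))
  obtain ⟨W, hWall, hWo, hu₀W⟩ := eventually_nhds_iff.1 hall
  have hWs : W ⊆ Φ.source := fun u hu => (hWall u hu).1
  -- the pointwise identity tested against functions supported in `W`
  have key : ∀ χ : Rn n → ℝ, ContDiff ℝ ∞ χ → HasCompactSupport χ → tsupport χ ⊆ W →
      ∫ u, χ u • (E A u - (fderiv ℝ Φ u).det * ∑ B, E' B (Φ u) * M u B) = 0 := by
    intro χ hχ hχc hχW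
    set φ : Rn n → Rn a := fun u => χ u • basisVec A with hφdef
    have hφ : ContDiff ℝ ∞ φ := hχ.smul contDiff_const
    have hφc : HasCompactSupport φ := hχc.smul_right
    have hφsupp : tsupport φ ⊆ tsupport χ := closure_mono fun u hu => by
      simp only [hφdef, Function.mem_support, ne_eq, smul_eq_zero, not_or] at hu
      exact hu.1
    have hχ0 : ∀ u, u ∉ W → χ u = 0 := fun u hu => image_eq_zero_of_notMem_tsupport fun h => hu (hχW h)
    set ψ : Rn n → Rn a := fun u => χ u • M u with hψdef
    have hψ : ContDiff ℝ ∞ ψ := hχ.smul hMs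
    have hψsupp : tsupport ψ ⊆ tsupport χ := closure_mono fun u hu => by
      simp only [hψdef, Function.mem_support, ne_eq, smul_eq_zero, not_or] at hu
      exact hu.1
    classical
    -- This is the test variation χ e_A transported to the second chart and extended by zero. The
    -- extension is smooth because ψ has compact support inside the domain of Φ.
    set φ' : Rn n → Rn a := fun u' => if u' ∈ Φ.target then ψ (Φ.symm u') else 0 with hφ'def
    have hφ'Φ : ∀ u ∈ Φ.source, φ' (Φ u) = ψ u := fun u hu => by
      simp [hφ'def, Φ.map_source hu, Φ.left_inv hu]
    set S : Set (Rn n) := Φ '' tsupport ψ with hSdef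
    have hψsource : tsupport ψ ⊆ Φ.source := (hψsupp.trans hχW).trans hWs
    have hSc : IsCompact S :=
      (hχc.of_isClosed_subset (isClosed_tsupport _) hψsupp).image_of_continuousOn
        (Φ.continuousOn.mono hψsource)
    have hφ'0 : ∀ u', u' ∉ S → φ' u' = 0 := by
      intro u' hu'
      simp only [hφ'def]
      split_ifs with h
      · refine image_eq_zero_of_notMem_tsupport fun h' => hu' ⟨_, h', Φ.right_inv h⟩
      · rfl
    have hφ's : ContDiff ℝ ∞ φ' := contDiff_iff_contDiffAt.2 fun u' => by
      by_cases hu' : u' ∈ Φ.target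
      · have : φ' =ᶠ[𝓝 u'] fun u' => ψ (Φ.symm u') := by
          filter_upwards [Φ.open_target.mem_nhds hu'] with v hv
          simp [hφ'def, hv]
        refine ContDiffAt.congr_of_eventuallyEq ?_ this
        exact hψ.contDiffAt.comp u' (hΦ'.contDiffAt (Φ.open_target.mem_nhds hu'))
      · have hu'S : u' ∉ S := fun ⟨v, hv, e⟩ => hu' (e ▸ Φ.map_source (hψsource hv))
        have : φ' =ᶠ[𝓝 u'] fun _ => 0 := by
          filter_upwards [hSc.isClosed.isOpen_compl.mem_nhds hu'S] with v hv
          exact hφ'0 v hv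
        exact contDiffAt_const.congr_of_eventuallyEq this
    have hφ'c : HasCompactSupport φ' := HasCompactSupport.intro hSc hφ'0
    have hφ'supp : tsupport φ' ⊆ S := closure_minimal (fun u' h => by
      by_contra h'
      exact h (hφ'0 u' h')) hSc.isClosed
    have hSW : S ⊆ Φ '' W := Set.image_mono (hψsupp.trans hχW)
    have pointwise : ∀ u ∈ W, ∑ α ∈ orderLE n r, ∑ A, f α A u * multiIter pderiv α φ u A =
        (fderiv ℝ Φ u).det * ∑ α ∈ orderLE n r, ∑ A, f' α A (Φ u) *
          multiIter pderiv α φ' (Φ u) A := by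
      intro u hu
      obtain ⟨h1, h2, -, h4, h5, -, -, h8, h9, h10, h11, h12, h13⟩ := hWall u hu
      have := first_variation_covariance (φ' := φ') hO hO' hL hL' h1
        (by filter_upwards [Φ.open_target.mem_nhds (Φ.map_source h1)] with v hv using
          hΦ'.contDiffAt (Φ.open_target.mem_nhds hv)) h9 h10 h11 h12 h13 hφ ?_ (h8 φ hφ)
      · refine Eq.trans ?_ (this.trans ?_)
        · exact Finset.sum_congr rfl fun α hα => Finset.sum_congr rfl fun B _ => by rw [h2 α hα B]
        · congr 1
          exact Finset.sum_congr rfl fun α hα => Finset.sum_congr rfl fun B _ => by rw [h5 α hα B]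
      · filter_upwards [hWo.mem_nhds hu] with v hv
        rw [hφ'Φ v (hWs hv), hψdef, hφdef]
        simp only
        rw [(hWall v hv).2.2.2.1, ← map_smul]
        simp
    -- The adjoint identity holds for integrals over ℝⁿ. Both integrands vanish outside W, so it may
    -- be read on W, where the coefficients are those of the Lagrangian; `i2` is its counterpart on
    -- Φ(W).
    have i1 : ∫ u in W, ∑ α ∈ orderLE n r, ∑ A, f α A u * multiIter pderiv α φ u A =
        ∫ u in W, E A u * χ u := by
      rw [setIntegral_eq_integral_of_forall_compl_eq_zero, hint φ hφ hφc,
        setIntegral_eq_integral_of_forall_compl_eq_zero]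
      · refine integral_congr_ae (Eventually.of_forall fun u => ?_)
        simp [hφdef, basisVec, PiLp.single_apply]
      · intro u hu
        rw [hχ0 u hu, mul_zero]
      · intro u hu
        refine Finset.sum_eq_zero fun α _ => Finset.sum_eq_zero fun B _ => ?_
        rw [image_eq_zero_of_notMem_tsupport (f := multiIter pderiv α φ) fun h =>
          hu (hχW (hφsupp (tsupport_multiIter_pderiv φ α h)))]
        simp
    have i2 : ∫ u' in Φ '' W, ∑ α ∈ orderLE n r, ∑ A, f' α A u' * multiIter pderiv α φ' u' A =
        ∫ u' in Φ '' W, ∑ B, E' B u' * φ' u' B := by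
      rw [setIntegral_eq_integral_of_forall_compl_eq_zero, hint' φ' hφ's hφ'c,
        setIntegral_eq_integral_of_forall_compl_eq_zero]
      · intro u' hu'
        rw [hφ'0 u' fun h => hu' (hSW h)]
        simp
      · intro u' hu'
        refine Finset.sum_eq_zero fun α _ => Finset.sum_eq_zero fun B _ => ?_
        rw [image_eq_zero_of_notMem_tsupport (f := multiIter pderiv α φ') fun h =>
          hu' (hSW (hφ'supp (tsupport_multiIter_pderiv φ' α h)))]
        simp
    have hder : ∀ u ∈ W, HasFDerivWithinAt Φ (fderiv ℝ Φ u) W u := fun u hu =>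
      ((hΦs u (hWs hu)).differentiableAt (by simp)).hasFDerivAt.hasFDerivWithinAt
    rw [integral_image_eq_integral_abs_det_fderiv_smul volume hWo.measurableSet hder
      (Φ.injOn.mono hWs), integral_image_eq_integral_abs_det_fderiv_smul volume hWo.measurableSet
      hder (Φ.injOn.mono hWs)] at i2
    -- After the change of variables in `i2`, multiplication by the sign s replaces |det| by det,
    -- and the covariance of the first variation identifies the left-hand sides.
    have i3 : ∫ u in W, E A u * χ u =
        ∫ u in W, (fderiv ℝ Φ u).det * (∑ B, E' B (Φ u) * M u B) * χ u := by
      have i4 := congrArg (fun x => s * x) i2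
      simp only [← integral_const_mul] at i4
      rw [← i1]
      refine Eq.trans ?_ (i4.trans ?_)
      · refine setIntegral_congr_fun hWo.measurableSet fun u hu => ?_
        simp only [pointwise u hu, smul_eq_mul, ← mul_assoc, (hWall u hu).2.2.2.2.2.2.1]
      · refine setIntegral_congr_fun hWo.measurableSet fun u hu => ?_
        simp only [smul_eq_mul, ← mul_assoc, (hWall u hu).2.2.2.2.2.2.1, hφ'Φ u (hWs hu), hψdef]
        rw [mul_assoc, Finset.sum_mul]
        congr 1
        refine Finset.sum_congr rfl fun B _ => ?_
        simp only [PiLp.smul_apply, smul_eq_mul]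
        ring
    have cont1 : ContinuousOn (fun u => E A u * χ u) W :=
      ((hE A).continuous.mul hχ.continuous).continuousOn
    have hset : ∀ u, u ∉ W → χ u • (E A u - (fderiv ℝ Φ u).det * ∑ B, E' B (Φ u) * M u B) = 0 :=
      fun u hu => by rw [hχ0 u hu, zero_smul]
    have hEW : ContinuousOn (fun u => (fderiv ℝ Φ u).det * ∑ B, E' B (Φ u) * M u B) W := by
      refine (hdetc.mono hWs).mul (continuousOn_finsetSum _ fun B _ => ?_)
      exact ((hE' B).continuous.comp_continuousOn (Φ.continuousOn.mono hWs)).mul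
        ((EuclideanSpace.proj B : Rn a →L[ℝ] ℝ).continuous.comp hMs.continuous).continuousOn
    have int1 : IntegrableOn (fun u => E A u * χ u) W :=
      (((hE A).continuous.mul hχ.continuous).integrable_of_hasCompactSupport
        hχc.mul_left).integrableOn
    have int2 : IntegrableOn
        (fun u => (fderiv ℝ Φ u).det * (∑ B, E' B (Φ u) * M u B) * χ u) W := by
      have : IntegrableOn
          (fun u => (fderiv ℝ Φ u).det * (∑ B, E' B (Φ u) * M u B) * χ u) (tsupport χ) :=
        ((hEW.mono hχW).mul hχ.continuous.continuousOn).integrableOn_compact hχc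
      refine this.of_forall_sdiff_eq_zero hWo.measurableSet fun u hu => ?_
      rw [image_eq_zero_of_notMem_tsupport hu.2, mul_zero]
    rw [← setIntegral_eq_integral_of_forall_compl_eq_zero hset, ← sub_eq_zero.2 i3,
      ← integral_sub int1 int2]
    refine integral_congr_ae (Eventually.of_forall fun u => ?_)
    simp only [smul_eq_mul]
    ring
  have hEW : ContinuousOn (fun u => E A u - (fderiv ℝ Φ u).det * ∑ B, E' B (Φ u) * M u B) W := by
    refine (hE A).continuous.continuousOn.sub
      ((hdetc.mono hWs).mul (continuousOn_finsetSum _ fun B _ => ?_))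
    exact ((hE' B).continuous.comp_continuousOn (Φ.continuousOn.mono hWs)).mul
      ((EuclideanSpace.proj B : Rn a →L[ℝ] ℝ).continuous.comp hMs.continuous).continuousOn
  -- The fundamental lemma gives vanishing almost everywhere on W, and continuity improves this to
  -- every point of W, in particular u₀.
  have hae := hWo.ae_eq_zero_of_integral_contDiff_smul_eq_zero
    (hEW.locallyIntegrableOn (μ := volume) hWo.measurableSet) key
  have hz := Measure.eqOn_open_of_ae_eq (μ := volume)
    (g := fun _ => (0 : ℝ)) ((ae_restrict_iff' hWo.measurableSet).2 hae) hWo hEW continuousOn_const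
    hu₀W
  obtain ⟨-, -, h3, h4, -, h6, -⟩ := hWall u₀ hu₀W
  rw [← h3 A, sub_eq_zero.1 hz]
  simp only [h6, h4]

end Covariance

end

section

open Filter

/-! ### Charts of a manifold modelled on a normed space -/

section Charts

variable {E : Type*} [NormedAddCommGroup E] [NormedSpace ℝ E]
  {M : Type*} [TopologicalSpace M] [ChartedSpace E M]

lemma contDiffOn_chart_change {e e' : OpenPartialHomeomorph M E}
    (he : e ∈ IsManifold.maximalAtlas 𝓘(ℝ, E) ∞ M)
    (he' : e' ∈ IsManifold.maximalAtlas 𝓘(ℝ, E) ∞ M) :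
    ContDiffOn ℝ ∞ (e.symm.trans e') (e.symm.trans e').source := by
  intro u hu
  rw [OpenPartialHomeomorph.trans_source, Set.mem_inter_iff] at hu
  have h1 := contMDiffAt_symm_of_mem_maximalAtlas he hu.1
  have h2 : ContMDiffAt 𝓘(ℝ, E) 𝓘(ℝ, E) ∞ e' (e.symm u) :=
    contMDiffAt_of_mem_maximalAtlas he' hu.2
  exact (h2.comp u h1).contDiffAt.contDiffWithinAt

lemma det_fderiv_chart_change {e e' : OpenPartialHomeomorph M E}
    (he : e ∈ IsManifold.maximalAtlas 𝓘(ℝ, E) ∞ M)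
    (he' : e' ∈ IsManifold.maximalAtlas 𝓘(ℝ, E) ∞ M) {u : E} (hu : u ∈ (e.symm.trans e').source) :
    (fderiv ℝ (e.symm.trans e') u).det ≠ 0 := by
  set Φ := e.symm.trans e' with hΦ
  have h1 : DifferentiableAt ℝ Φ u :=
    ((contDiffOn_chart_change he he').contDiffAt (Φ.open_source.mem_nhds hu)).differentiableAt
      (by simp)
  have hs : Φ.symm = e'.symm.trans e := by
    rw [hΦ, OpenPartialHomeomorph.trans_symm_eq_symm_trans_symm, OpenPartialHomeomorph.symm_symm]
  have hc : ContDiffOn ℝ ∞ Φ.symm Φ.symm.source := by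
    rw [hs]; exact contDiffOn_chart_change he' he
  have h2 : DifferentiableAt ℝ Φ.symm (Φ u) :=
    (hc.contDiffAt (Φ.symm.open_source.mem_nhds (Φ.map_source hu))).differentiableAt (by simp)
  have h3 : (fun v => Φ.symm (Φ v)) =ᶠ[𝓝 u] id := by
    filter_upwards [Φ.open_source.mem_nhds hu] with v hv using Φ.left_inv hv
  have h4 : (fderiv ℝ Φ.symm (Φ u)).comp (fderiv ℝ Φ u) = ContinuousLinearMap.id ℝ E := by
    rw [← fderiv_comp u h2 h1]
    exact h3.fderiv_eq.trans fderiv_id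
  have h5 := congrArg (fun T : E →L[ℝ] E => LinearMap.det (T : E →ₗ[ℝ] E)) h4
  intro h0
  change LinearMap.det ((fderiv ℝ Φ.symm (Φ u) : E →ₗ[ℝ] E) ∘ₗ (fderiv ℝ Φ u : E →ₗ[ℝ] E)) =
    LinearMap.det LinearMap.id at h5
  rw [LinearMap.det_comp, LinearMap.det_id] at h5
  rw [show LinearMap.det (fderiv ℝ Φ u : E →ₗ[ℝ] E) = 0 from h0, mul_zero] at h5
  exact zero_ne_one h5

end Charts

/-! ### Fibered charts of one fibered manifold -/

section OneFactor

variable {n m : ℕ} {X Y : Type*} [TopologicalSpace X] [ChartedSpace (Rn n) X]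
  [TopologicalSpace Y] [ChartedSpace (Rn n × Rn m) Y]

/-- `ψ` is a fibered chart of `π` over the chart `φ` of the base. -/
structure IsFiberedOver (π : Y → X) (φ : OpenPartialHomeomorph X (Rn n))
    (ψ : OpenPartialHomeomorph Y (Rn n × Rn m)) : Prop where
  base_mem : φ ∈ IsManifold.maximalAtlas 𝓘(ℝ, Rn n) ∞ X
  mem : ψ ∈ IsManifold.maximalAtlas 𝓘(ℝ, Rn n × Rn m) ∞ Y
  base : ∀ y ∈ ψ.source, π y ∈ φ.source ∧ (ψ y).1 = φ (π y)

/-- The fibre components in a fibered chart of a section. -/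
def sectionRep (φ : OpenPartialHomeomorph X (Rn n)) (ψ : OpenPartialHomeomorph Y (Rn n × Rn m))
    (σ : X → Y) (u : Rn n) : Rn m := (ψ (σ (φ.symm u))).2

/-- The section with given fibre components in a fibered chart. -/
def chartSection (φ : OpenPartialHomeomorph X (Rn n)) (ψ : OpenPartialHomeomorph Y (Rn n × Rn m))
    (f : Rn n → Rn m) (x : X) : Y := ψ.symm (φ x, f (φ x))

variable {π : Y → X} {φ φ' : OpenPartialHomeomorph X (Rn n)}
  {ψ ψ' : OpenPartialHomeomorph Y (Rn n × Rn m)}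
  {σ : X → Y} {x : X} {f : Rn n → Rn m} {u : Rn n}

lemma IsSectionNear.proj_eq (h : IsSectionNear n m π σ x) : π (σ x) = x := h.self_of_nhds.1

lemma IsSectionNear.contMDiffAt (h : IsSectionNear n m π σ x) :
    ContMDiffAt 𝓘(ℝ, Rn n) 𝓘(ℝ, Rn n × Rn m) ∞ σ x := h.self_of_nhds.2

lemma IsSectionNear.eventually (h : IsSectionNear n m π σ x) :
    ∀ᶠ x' in 𝓝 x, IsSectionNear n m π σ x' := eventually_eventually_nhds.2 h

lemma IsFiberedOver.mem_base (h : IsFiberedOver π φ ψ) (hσ : IsSectionNear n m π σ x)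
    (hx : σ x ∈ ψ.source) : x ∈ φ.source := by
  have := (h.base _ hx).1
  rwa [hσ.proj_eq] at this

lemma IsFiberedOver.chart_section (h : IsFiberedOver π φ ψ) (hσ : IsSectionNear n m π σ x)
    (hx : σ x ∈ ψ.source) : ψ (σ x) = (φ x, sectionRep φ ψ σ (φ x)) := by
  refine Prod.ext ?_ ?_
  · rw [(h.base _ hx).2, hσ.proj_eq]
  · rw [sectionRep, φ.left_inv (h.mem_base hσ hx)]

lemma IsSectionNear.eventually_mem (hσ : IsSectionNear n m π σ x) (hx : σ x ∈ ψ.source) :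
    ∀ᶠ x' in 𝓝 x, IsSectionNear n m π σ x' ∧ σ x' ∈ ψ.source :=
  hσ.eventually.and (hσ.contMDiffAt.continuousAt.eventually (ψ.open_source.mem_nhds hx))

lemma tendsto_symm (hx : x ∈ φ.source) : Tendsto φ.symm (𝓝 (φ x)) (𝓝 x) := by
  have := φ.continuousAt_symm (φ.map_source hx)
  rwa [ContinuousAt, φ.left_inv hx] at this

lemma IsFiberedOver.smoothNear_sectionRep [IsManifold 𝓘(ℝ, Rn n) ∞ X]
    [IsManifold 𝓘(ℝ, Rn n × Rn m) ∞ Y] (h : IsFiberedOver π φ ψ)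
    (hσ : IsSectionNear n m π σ x) (hx : σ x ∈ ψ.source) :
    SmoothNear (sectionRep φ ψ σ) (φ x) := by
  have hxs := h.mem_base hσ hx
  filter_upwards [(tendsto_symm hxs).eventually (hσ.eventually_mem hx),
    φ.open_target.mem_nhds (φ.map_source hxs)] with u h1 h2
  have e1 := contMDiffAt_symm_of_mem_maximalAtlas h.base_mem h2
  have e2 : ContMDiffAt 𝓘(ℝ, Rn n × Rn m) 𝓘(ℝ, Rn n × Rn m) ∞ ψ (σ (φ.symm u)) :=
    contMDiffAt_of_mem_maximalAtlas h.mem h1.2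
  have e3 := (e2.comp u (h1.1.contMDiffAt.comp u e1)).contDiffAt
  exact contDiffAt_snd.comp u e3

lemma IsFiberedOver.proj_symm (h : IsFiberedOver π φ ψ) {w : Rn n × Rn m} (hw : w ∈ ψ.target) :
    w.1 ∈ φ.target ∧ π (ψ.symm w) = φ.symm w.1 := by
  have h1 := h.base _ (ψ.map_target hw)
  rw [ψ.right_inv hw] at h1
  rw [h1.2]
  exact ⟨φ.map_source h1.1, (φ.left_inv h1.1).symm⟩

lemma IsFiberedOver.eventually_target (hf : SmoothNear f u) (hu : (u, f u) ∈ ψ.target) :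
    ∀ᶠ u' in 𝓝 u, (u', f u') ∈ ψ.target :=
  (continuousAt_id.prodMk hf.contDiffAt.continuousAt).eventually (ψ.open_target.mem_nhds hu)

lemma IsFiberedOver.isSectionNear_chartSection [IsManifold 𝓘(ℝ, Rn n) ∞ X]
    [IsManifold 𝓘(ℝ, Rn n × Rn m) ∞ Y] (h : IsFiberedOver π φ ψ) (hx : x ∈ φ.source)
    (hf : SmoothNear f (φ x)) (hu : (φ x, f (φ x)) ∈ ψ.target) :
    IsSectionNear n m π (chartSection φ ψ f) x := by
  filter_upwards [φ.open_source.mem_nhds hx, (φ.continuousAt hx).eventually hf,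
    (φ.continuousAt hx).eventually (eventually_target hf hu)] with x' h1 h2 h3
  refine ⟨?_, ?_⟩
  · rw [chartSection, (h.proj_symm h3).2, φ.left_inv h1]
  · have e1 : ContMDiffAt 𝓘(ℝ, Rn n) 𝓘(ℝ, Rn n) ∞ φ x' :=
      contMDiffAt_of_mem_maximalAtlas h.base_mem h1
    have e2 : ContMDiffAt 𝓘(ℝ, Rn n) 𝓘(ℝ, Rn n × Rn m) ∞ (fun u => (u, f u)) (φ x') :=
      (contDiffAt_id.prodMk h2).contMDiffAt
    have e3 := contMDiffAt_symm_of_mem_maximalAtlas h.mem h3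
    exact ContMDiffAt.comp x' (g := fun u => ψ.symm (u, f u)) (ContMDiffAt.comp (φ x') e3 e2) e1

lemma chartSection_mem (hu : (φ x, f (φ x)) ∈ ψ.target) : chartSection φ ψ f x ∈ ψ.source :=
  ψ.map_target hu

lemma IsFiberedOver.sectionRep_chartSection (h : IsFiberedOver π φ' ψ) (hf : SmoothNear f u)
    (hu : (u, f u) ∈ ψ.target) (hφ : φ = φ') :
    sectionRep φ ψ (chartSection φ ψ f) =ᶠ[𝓝 u] f := by
  subst hφ
  filter_upwards [eventually_target hf hu] with u' hu'
  rw [sectionRep, chartSection, φ.right_inv (h.proj_symm hu').1, ψ.right_inv hu']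

/-- The fibre components of the change of fibered charts. -/
def fiberChange (ψ ψ' : OpenPartialHomeomorph Y (Rn n × Rn m)) (w : Rn n × Rn m) : Rn m :=
  (ψ' (ψ.symm w)).2

lemma smoothNear_fiberChange [IsManifold 𝓘(ℝ, Rn n × Rn m) ∞ Y]
    (h : IsFiberedOver π φ ψ) (h' : IsFiberedOver π φ' ψ') {y : Y}
    (hy : y ∈ ψ.source) (hy' : y ∈ ψ'.source) : SmoothNear (fiberChange ψ ψ') (ψ y) := by
  have hs : ψ y ∈ (ψ.symm.trans ψ').source := by
    rw [OpenPartialHomeomorph.trans_source]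
    exact ⟨ψ.map_source hy, by simpa [ψ.left_inv hy] using hy'⟩
  filter_upwards [(ψ.symm.trans ψ').open_source.mem_nhds hs] with w hw
  exact contDiffAt_snd.comp w ((contDiffOn_chart_change h.mem h'.mem).contDiffAt
    ((ψ.symm.trans ψ').open_source.mem_nhds hw))

lemma IsFiberedOver.sectionRep_change (h : IsFiberedOver π φ ψ) (h' : IsFiberedOver π φ' ψ')
    (hσ : IsSectionNear n m π σ x) (hx : σ x ∈ ψ.source) (hx' : σ x ∈ ψ'.source) :
    sectionRep φ' ψ' σ (φ' x) = fiberChange ψ ψ' (φ x, sectionRep φ ψ σ (φ x)) := by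
  rw [← h.chart_section hσ hx, fiberChange, ψ.left_inv hx, sectionRep,
    φ'.left_inv (h'.mem_base hσ hx')]

/-- A fibered manifold has fibered charts over any chart of the base. -/
lemma IsFiberedManifold.exists_fiberedOver [IsManifold 𝓘(ℝ, Rn n) ∞ X]
    [IsManifold 𝓘(ℝ, Rn n × Rn m) ∞ Y] (hπ : IsFiberedManifold n m π)
    (hφ : φ ∈ IsManifold.maximalAtlas 𝓘(ℝ, Rn n) ∞ X) {y : Y} (hy : π y ∈ φ.source) :
    ∃ ψ : OpenPartialHomeomorph Y (Rn n × Rn m), IsFiberedOver π φ ψ ∧ y ∈ ψ.source := by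
  obtain ⟨F, _, _, hF⟩ := hπ.submersion
  have h := hF y
  let e := h.equiv
  -- The normal form of a submersion is the projection along some complement F; counting dimensions
  -- identifies F with ℝᵐ.
  have : FiniteDimensional ℝ F :=
    FiniteDimensional.of_injective ((e.symm : (Rn n × F) →ₗ[ℝ] (Rn n × Rn m)) ∘ₗ
      LinearMap.inr ℝ (Rn n) F) (e.symm.injective.comp LinearMap.inr_injective)
  have hfr : Module.finrank ℝ F = Module.finrank ℝ (Rn m) := by
    have := e.toLinearEquiv.finrank_eq
    simpa using this.symm
  let e₂ : (Rn n × Rn m) ≃L[ℝ] (Rn n × Rn m) :=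
    e.trans ((ContinuousLinearEquiv.refl ℝ (Rn n)).prodCongr
      (ContinuousLinearEquiv.ofFinrankEq hfr))
  -- The normal form comes with a chart of the base of its own; κ leads from it to the prescribed
  -- chart φ, and ψ applies κ to the base components.
  let κ := h.codChart.symm.trans φ
  let ψ : OpenPartialHomeomorph Y (Rn n × Rn m) :=
    (h.domChart.trans e₂.toHomeomorph.toOpenPartialHomeomorph).trans
      (κ.prod (OpenPartialHomeomorph.refl (Rn m)))
  have hkey : ∀ y' ∈ h.domChart.source, (e₂ (h.domChart y')).1 = h.codChart (π y') := by
    intro y' hy'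
    have h0 := h.writtenInCharts
    have h1 := h0 (show h.domChart y' ∈ _ by simp [hy'])
    refine (show (e₂ (h.domChart y')).1 = (h.equiv (h.domChart y')).1 from rfl).trans ?_
    simpa [h.domChart.left_inv hy'] using h1.symm
  have hsrc : ∀ y', y' ∈ ψ.source ↔ y' ∈ h.domChart.source ∧ π y' ∈ φ.source := by
    intro y'
    simp only [ψ, κ, mfld_simps]
    constructor
    · rintro ⟨h1, h2, h3⟩
      refine ⟨h1, ?_⟩
      change h.codChart.symm (e₂ (h.domChart y')).1 ∈ φ.source at h3
      rwa [hkey y' h1, h.codChart.left_inv (h.source_subset_preimage_source h1)] at h3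
    · rintro ⟨h1, h2⟩
      have h4 := h.source_subset_preimage_source h1
      refine ⟨h1, ?_, ?_⟩
      · change (e₂ (h.domChart y')).1 ∈ _
        rw [hkey y' h1]
        exact h.codChart.map_source h4
      · change h.codChart.symm (e₂ (h.domChart y')).1 ∈ φ.source
        rwa [hkey y' h1, h.codChart.left_inv h4]
  have hκ : ContDiffOn ℝ ∞ κ κ.source := contDiffOn_chart_change h.codChart_mem_maximalAtlas hφ
  have hκ' : ContDiffOn ℝ ∞ κ.symm κ.target := by
    have e : κ.symm = φ.symm.trans h.codChart := by
      simp only [κ]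
      rw [OpenPartialHomeomorph.trans_symm_eq_symm_trans_symm, OpenPartialHomeomorph.symm_symm]
    rw [← κ.symm_source, e]
    exact contDiffOn_chart_change hφ h.codChart_mem_maximalAtlas
  refine ⟨ψ, ⟨hφ, ?_, ?_⟩, (hsrc y).2 ⟨h.mem_domChart_source, hy⟩⟩
  · refine ψ.mem_maximalAtlas_of_contMDiffOn ?_ ?_
    · intro y' hy'
      have h1 : ContMDiffAt 𝓘(ℝ, Rn n × Rn m) 𝓘(ℝ, Rn n × Rn m) ∞ h.domChart y' :=
        contMDiffAt_of_mem_maximalAtlas h.domChart_mem_maximalAtlas ((hsrc y').1 hy').1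
      have hm : (e₂ (h.domChart y')).1 ∈ κ.source := by
        have : y' ∈ ψ.source := hy'
        simp only [ψ, OpenPartialHomeomorph.trans_source, Set.mem_inter_iff, Set.mem_preimage] at this
        exact this.2.1
      have h2 : ContDiffAt ℝ ∞ (fun w : Rn n × Rn m => (κ (e₂ w).1, (e₂ w).2)) (h.domChart y') := by
        have h3 := hκ.contDiffAt (κ.open_source.mem_nhds hm)
        have h4 : ContDiffAt ℝ ∞ (fun w : Rn n × Rn m => e₂ w) (h.domChart y') :=
          e₂.contDiff.contDiffAt
        exact (h3.comp (h.domChart y') (contDiffAt_fst.comp _ h4)).prodMk (contDiffAt_snd.comp _ h4)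
      exact (ContMDiffAt.comp y' h2.contMDiffAt h1).contMDiffWithinAt
    · intro w hw
      have hw' : w ∈ ψ.target := hw
      have hm : w.1 ∈ κ.target := by
        simp only [ψ, OpenPartialHomeomorph.trans_target, Set.mem_inter_iff] at hw'
        exact hw'.1.1
      have hm2 : e₂.symm (κ.symm w.1, w.2) ∈ h.domChart.target := by
        simp only [ψ, OpenPartialHomeomorph.trans_target, Set.mem_inter_iff, Set.mem_preimage] at hw'
        exact hw'.2.2
      have h1 := contMDiffAt_symm_of_mem_maximalAtlas h.domChart_mem_maximalAtlas hm2
      have h2 : ContDiffAt ℝ ∞ (fun w : Rn n × Rn m => e₂.symm (κ.symm w.1, w.2)) w := by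
        have h3 := hκ'.contDiffAt (κ.open_target.mem_nhds hm)
        exact e₂.symm.contDiff.contDiffAt.comp w ((h3.comp w contDiffAt_fst).prodMk contDiffAt_snd)
      exact (ContMDiffAt.comp w h1 h2.contMDiffAt).contMDiffWithinAt
  · intro y' hy'
    have h1 := (hsrc y').1 hy'
    refine ⟨h1.2, ?_⟩
    change φ (h.codChart.symm (e₂ (h.domChart y')).1) = _
    rw [hkey y' h1.1, h.codChart.left_inv (h.source_subset_preimage_source h1.1)]

end OneFactor

end

section

open Filter

/-! ### Functions with prescribed derivatives at a point -/

section Realization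

variable {n m : ℕ}

/-- The normalized power `(t - c)ᵇ / b!`. -/
def divPow (c : ℝ) (b : ℕ) (t : ℝ) : ℝ := (t - c) ^ b / b.factorial

lemma contDiff_divPow (c : ℝ) (b : ℕ) : ContDiff ℝ ∞ (divPow c b) := by
  unfold divPow; fun_prop

lemma deriv_divPow_succ (c : ℝ) (b : ℕ) : deriv (divPow c (b + 1)) = divPow c b := by
  funext t
  have h : HasDerivAt (divPow c (b + 1))
      ((((b + 1 : ℕ) : ℝ) * (t - c) ^ b * 1) / (b + 1).factorial) t := by
    have := (((hasDerivAt_id t).sub_const c).pow (b + 1)).div_const ((b + 1).factorial : ℝ)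
    change HasDerivAt (fun x => (x - c) ^ (b + 1) / ((b + 1).factorial : ℝ)) _ t
    simpa using this
  rw [h.deriv, divPow, Nat.factorial_succ]
  have h1 : ((b + 1 : ℕ) : ℝ) ≠ 0 := Nat.cast_ne_zero.2 (Nat.succ_ne_zero b)
  have h2 : (b.factorial : ℝ) ≠ 0 := Nat.cast_ne_zero.2 b.factorial_ne_zero
  rw [Nat.cast_mul]
  field_simp

/-- The divided powers are dual to the iterated derivatives at `c`, hence the factor 1/b!. -/
lemma iterate_deriv_divPow (c : ℝ) (k b : ℕ) :
    (deriv^[k] (divPow c b)) c = if k = b then 1 else 0 := by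
  induction k generalizing b with
  | zero =>
    cases b with
    | zero => simp [divPow]
    | succ b => simp [divPow]
  | succ k ih =>
    rw [Function.iterate_succ_apply]
    cases b with
    | zero =>
      have h0 : deriv (divPow c 0) = fun _ => 0 := by
        have : divPow c 0 = fun _ => 1 := by funext t; simp [divPow]
        rw [this]
        simp
      have h1 : ∀ k, deriv^[k] (fun _ : ℝ => (0 : ℝ)) = fun _ => 0 := by
        intro k
        induction k with
        | zero => rfl
        | succ k ih => rw [Function.iterate_succ_apply]; simpa using ih
      rw [h0, h1]
      simp
    | succ b =>
      rw [deriv_divPow_succ, ih]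
      simp

/-- In a product of functions of separate variables only one factor is differentiated. The result is
again such a product, so the formula can be iterated. -/
lemma pderiv_prod {h : Fin n → ℝ → ℝ} (hh : ∀ i, ContDiff ℝ ∞ (h i)) (i : Fin n) :
    pderiv i (fun u => ∏ j, h j (u j)) =
      fun u => ∏ j, (Function.update h i (deriv (h i))) j (u j) := by
  funext u
  have h1 : ∀ j ∈ Finset.univ, HasFDerivAt (fun u : Rn n => h j (u j))
      (deriv (h j) (u j) • (EuclideanSpace.proj j : Rn n →L[ℝ] ℝ)) u := fun j _ =>
    (((hh j).differentiable (by simp)) (u j)).hasDerivAt.comp_hasFDerivAt u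
      (EuclideanSpace.proj j : Rn n →L[ℝ] ℝ).hasFDerivAt
  have h2 := HasFDerivAt.finsetProd h1
  rw [pderiv, h2.fderiv]
  have hp : ∀ j, (EuclideanSpace.proj j : Rn n →L[ℝ] ℝ) (basisVec i) = if j = i then 1 else 0 := by
    intro j
    simp [basisVec, PiLp.single_apply]
  simp only [sum_apply, smul_apply, hp, smul_eq_mul]
  rw [Finset.sum_eq_single i]
  · rw [← Finset.mul_prod_erase Finset.univ _ (Finset.mem_univ i)]
    simp only [Function.update_self, if_true, mul_one]
    rw [mul_comm]
    congr 1
    refine Finset.prod_congr rfl fun j hj => ?_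
    rw [Function.update_of_ne (Finset.ne_of_mem_erase hj)]
  · intro j _ hj
    simp [hj]
  · simp

lemma contDiff_prod_coord {h : Fin n → ℝ → ℝ} (hh : ∀ i, ContDiff ℝ ∞ (h i)) :
    ContDiff ℝ ∞ fun u : Rn n => ∏ j, h j (u j) :=
  contDiff_prod fun j _ => (hh j).comp (EuclideanSpace.proj j : Rn n →L[ℝ] ℝ).contDiff

lemma contDiff_iterate_deriv {h : ℝ → ℝ} (hh : ContDiff ℝ ∞ h) (k : ℕ) :
    ContDiff ℝ ∞ (deriv^[k] h) := by
  induction k with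
  | zero => exact hh
  | succ k ih =>
    rw [Function.iterate_succ_apply']
    exact (contDiff_infty_iff_deriv.1 ih).2

lemma multiIter_pderiv_prod {h : Fin n → ℝ → ℝ} (hh : ∀ i, ContDiff ℝ ∞ (h i)) (α : Fin n → ℕ) :
    multiIter pderiv α (fun u => ∏ j, h j (u j)) = fun u => ∏ j, (deriv^[α j] (h j)) (u j) := by
  induction hk : ∑ i, α i generalizing α with
  | zero =>
    have : α = 0 := funext fun i => (Finset.sum_eq_zero_iff.1 hk) i (Finset.mem_univ i)
    subst this
    simp
  | succ k ih =>
    obtain ⟨i, β, rfl, hβ⟩ := exists_add_single hk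
    have e : multiIter pderiv (β + Pi.single i 1) (fun u : Rn n => ∏ j, h j (u j)) =
        pderiv i (multiIter pderiv β fun u : Rn n => ∏ j, h j (u j)) :=
      multiIter_dirD_add_single (contDiff_prod_coord hh) _ β i
    rw [e, ih β hβ, pderiv_prod fun j => contDiff_iterate_deriv (hh j) (β j)]
    funext u
    refine Finset.prod_congr rfl fun j _ => ?_
    by_cases hj : j = i
    · subst hj
      rw [Function.update_self, Pi.add_apply, Pi.single_eq_same, Function.iterate_succ_apply']
    · rw [Function.update_of_ne hj, Pi.add_apply, Pi.single_eq_of_ne hj, add_zero]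

/-- There is a smooth function with prescribed derivatives up to order `k` at a point. -/
lemma exists_multiIter_pderiv_eq (k : ℕ) (v : (Fin n → ℕ) → Rn m) (u₀ : Rn n) :
    ∃ f : Rn n → Rn m, ContDiff ℝ ∞ f ∧ ∀ α ∈ orderLE n k, multiIter pderiv α f u₀ = v α := by
  -- The function sought is the Taylor polynomial Σ v_β ∏ (u_j - u₀_j)^{β_j} / β_j!. It is written
  -- as a linear map of the vector of monomials, because derivatives pass through linear maps.
  let w : Rn n → (orderLE n k → ℝ) := fun u β => ∏ j, divPow (u₀ j) (β.1 j) (u j)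
  have hwβ : ∀ β : orderLE n k, ContDiff ℝ ∞ fun u => w u β := fun β =>
    contDiff_prod_coord fun j => contDiff_divPow _ _
  have hw : ContDiff ℝ ∞ w := contDiff_pi.2 hwβ
  let T : (orderLE n k → ℝ) →L[ℝ] Rn m :=
    ∑ β : orderLE n k, (ContinuousLinearMap.proj β).smulRight (v β.1)
  refine ⟨fun u => T (w u), T.contDiff.comp hw, fun α hα => ?_⟩
  rw [multiIter_pderiv_clm hw T]
  have h1 : ∀ β : orderLE n k, multiIter pderiv α w u₀ β = if α = β.1 then 1 else 0 := by
    intro β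
    have h2 := congrFun (multiIter_pderiv_clm hw
      (ContinuousLinearMap.proj β : (orderLE n k → ℝ) →L[ℝ] ℝ) α) u₀
    refine (h2.symm.trans (congrFun (multiIter_pderiv_prod
      (fun j => contDiff_divPow (u₀ j) (β.1 j)) α) u₀)).trans ?_
    simp only [iterate_deriv_divPow]
    split_ifs with h
    · subst h; simp
    · obtain ⟨i, hi⟩ := Function.ne_iff.1 h
      exact Finset.prod_eq_zero (Finset.mem_univ i) (by simp [hi])
  simp only [T, sum_apply, ContinuousLinearMap.smulRight_apply,
    ContinuousLinearMap.proj_apply, h1]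
  rw [Finset.sum_eq_single (⟨α, hα⟩ : orderLE n k)]
  · simp
  · intro β _ hβ
    rw [if_neg, zero_smul]
    exact fun h => hβ (Subtype.ext h.symm)
  · simp

/-- The jet of a function in new coordinates depends on its jet in the old ones only. -/
lemma multiIter_pderiv_eq_of_change {Φ : OpenPartialHomeomorph (Rn n) (Rn n)} {u₀ : Rn n}
    (hu₀ : u₀ ∈ Φ.source) (hΦ : ContDiffOn ℝ ∞ Φ Φ.source)
    (hΦ' : ContDiffOn ℝ ∞ Φ.symm Φ.target)
    {F : Rn n × Rn m → Rn m} {f g f' g' : Rn n → Rn m}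
    (hf : SmoothNear f u₀) (hg : SmoothNear g u₀) (hF : SmoothNear F (u₀, f u₀))
    (hf' : ∀ᶠ u in 𝓝 u₀, f' (Φ u) = F (u, f u)) (hg' : ∀ᶠ u in 𝓝 u₀, g' (Φ u) = F (u, g u))
    (hfs' : SmoothNear f' (Φ u₀)) (hgs' : SmoothNear g' (Φ u₀))
    {q : ℕ} (h : ∀ α ∈ orderLE n q, multiIter pderiv α f u₀ = multiIter pderiv α g u₀) :
    ∀ α ∈ orderLE n q, multiIter pderiv α f' (Φ u₀) = multiIter pderiv α g' (Φ u₀) := by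
  have hfg : f u₀ = g u₀ := by simpa using h 0 zero_mem_orderLE
  obtain ⟨O₁, hO₁, hO₁o, hmem⟩ := eventually_nhds_iff.1 hF
  -- The calculus of total derivatives is reused for a single fibered manifold, with matter fibres
  -- of dimension zero.
  let O : Set (Rn n × Rn m × Rn 0) := {w | (w.1, w.2.1) ∈ O₁ ∧ w.1 ∈ Φ.source}
  have hO : IsOpen O := by
    refine IsOpen.inter (hO₁o.preimage ?_) (Φ.open_source.preimage continuous_fst)
    fun_prop
  let z : Rn n → Rn 0 := fun _ => 0
  have hz : ∀ u, SmoothNear z u := fun u => contDiff_const.smoothNear u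
  let b : Fin n → Fin n → Rn n → ℝ := fun i k u => (fderiv ℝ Φ.symm (Φ u) (basisVec i)) k
  have hb : ∀ i k, ∀ u ∈ Φ.source, ContDiffAt ℝ ∞ (b i k) u := by
    intro i k u hu
    have h1 : ContDiffAt ℝ ∞ Φ.symm (Φ u) :=
      hΦ'.contDiffAt (Φ.open_target.mem_nhds (Φ.map_source hu))
    have h2 := (contDiffAt_dirD h1 (basisVec i)).comp u
      (hΦ.contDiffAt (Φ.open_source.mem_nhds hu))
    exact (EuclideanSpace.proj k : Rn n →L[ℝ] ℝ).contDiff.contDiffAt.comp u h2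
  -- By the chain rule, ∂/∂x^{i'} is Σ_k (∂x^k/∂x^{i'}) d_k along sections, the `b i k` being the
  -- entries of the inverse Jacobian. Iterating D expresses the new derivatives by a function of the
  -- old jet, of order |α|.
  let D : Fin n → (JetCoord n m 0 → ℝ) → JetCoord n m 0 → ℝ := fun i f p =>
    ∑ k, b i k p.1 * totalDeriv k f p
  -- derivatives in the new coordinates as functions of the jet in the old coordinates
  have key : ∀ (f f' : Rn n → Rn m), SmoothNear f u₀ → (u₀, f u₀) ∈ O₁ →
      (∀ᶠ u in 𝓝 u₀, f' (Φ u) = F (u, f u)) → ∀ (B : Fin m) (α : Fin n → ℕ),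
      SmoothOfOrder (∑ i, α i) (jetDomain O) (multiIter D α fun p => F (p.1, p.2.1 0) B) ∧
        multiIter pderiv α (fun u' => f' u' B) (Φ u₀) =
          multiIter D α (fun p => F (p.1, p.2.1 0) B) (jetMap f z u₀) := by
    intro f f' hf hm hf' B α
    have hp : jetMap f z u₀ ∈ jetDomain O := jetMap_mem_jetDomain.2 ⟨hm, hu₀⟩
    have hsymm : Tendsto Φ.symm (𝓝 (Φ u₀)) (𝓝 u₀) := by
      have := Φ.continuousAt_symm (Φ.map_source hu₀)
      rwa [ContinuousAt, Φ.left_inv hu₀] at this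
    have hrel := multiIter_rel (D := D) (D' := pderiv)
      (f := fun p => F (p.1, p.2.1 0) B) (g := fun u' => f' u' B) (k := 0)
      (R := fun k f₁ h₁ => SmoothOfOrder k (jetDomain O) f₁ ∧
        h₁ =ᶠ[𝓝 (Φ u₀)] fun u' => f₁ (jetMap f z (Φ.symm u'))) ?_ ⟨?_, ?_⟩ α
    · rw [zero_add] at hrel
      refine ⟨hrel.1, ?_⟩
      rw [hrel.2.eq_of_nhds, Φ.left_inv hu₀]
    · rintro k i f₁ h₁ ⟨hf₁, hh₁⟩
      refine ⟨SmoothOfOrder.sum _ fun j _ => SmoothOfOrder.mul ?_ (hf₁.totalDeriv hO j), ?_⟩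
      · exact smoothOfOrder_base0 (h := fun w => b i j w.1) fun p hp =>
          (hb i j p.1 hp.2).comp (base0 p) contDiffAt_fst
      · filter_upwards [dirD_congr hh₁ (basisVec i), hsymm.eventually hf.eventually,
          hsymm.eventually (eventually_jetMap_mem hO hf (hz u₀) hp),
          Φ.open_target.mem_nhds (Φ.map_source hu₀)] with u' e1 e2 e3 e4
        refine Eq.trans e1 ?_
        have h1 : DifferentiableAt ℝ (fun u => f₁ (jetMap f z u)) (Φ.symm u') :=
          ((hf₁.smoothNear_comp_jetMap hO e2 (hz _) e3).contDiffAt).differentiableAt (by simp)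
        have h2 : DifferentiableAt ℝ Φ.symm u' :=
          (hΦ'.contDiffAt (Φ.open_target.mem_nhds e4)).differentiableAt (by simp)
        have h3 := congrArg (fun T => T (basisVec i)) (fderiv_comp u' h1 h2)
        refine Eq.trans h3 ?_
        have hbv : ∀ v : Rn n, v = ∑ j, v j • basisVec j := fun v => by
          simpa [basisVec] using ((EuclideanSpace.basisFun (Fin n) ℝ).sum_repr v).symm
        rw [ContinuousLinearMap.comp_apply, hbv (fderiv ℝ Φ.symm u' (basisVec i)), map_sum]
        refine Finset.sum_congr rfl fun j _ => ?_
        rw [map_smul, totalDeriv_jetMap hO hf₁ e2 (hz _) e3]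
        simp only [jetMap, b, Φ.right_inv e4, smul_eq_mul]
        rfl
    · refine smoothOfOrder_base0 (h := fun w => F (w.1, w.2.1) B) fun p hp => ?_
      have h1 : ContDiffAt ℝ ∞ F (p.1, p.2.1 0) := hO₁ _ hp.1
      have h2 : ContDiffAt ℝ ∞ (fun w : Rn n × Rn m × Rn 0 => (w.1, w.2.1)) (base0 p) := by fun_prop
      exact (EuclideanSpace.proj B : Rn m →L[ℝ] ℝ).contDiff.contDiffAt.comp (base0 p)
        (ContDiffAt.comp (base0 p) (g := F) h1 h2)
    · filter_upwards [hsymm.eventually hf', Φ.open_target.mem_nhds (Φ.map_source hu₀)]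
        with u' e1 e2
      rw [Φ.right_inv e2] at e1
      rw [e1]
      simp [jetMap]
  intro α hα
  have hcomp : ∀ {f' : Rn n → Rn m}, SmoothNear f' (Φ u₀) → ∀ B,
      multiIter pderiv α (fun u' => f' u' B) (Φ u₀) = multiIter pderiv α f' (Φ u₀) B := by
    intro f' hfs B
    obtain ⟨k, hk, hkf⟩ := hfs.exists_contDiff
    have e : (fun u' => f' u' B) =ᶠ[𝓝 (Φ u₀)] fun u' => k u' B := by
      filter_upwards [hkf] with u hu
      rw [hu]
    rw [(multiIter_pderiv_congr e α).eq_of_nhds,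
      ← (multiIter_pderiv_congr hkf α).eq_of_nhds]
    exact congrFun (multiIter_pderiv_clm hk (EuclideanSpace.proj B : Rn m →L[ℝ] ℝ) α) (Φ u₀)
  ext B
  obtain ⟨⟨G, hG⟩, k1⟩ := key f f' hf hmem hf' B α
  obtain ⟨-, k2⟩ := key g g' hg (hfg ▸ hmem) hg' B α
  rw [← hcomp hfs', ← hcomp hgs', k1, k2,
    (hG _ (jetMap_mem_jetDomain.2 ⟨hmem, hu₀⟩)).2,
    (hG _ (jetMap_mem_jetDomain.2 ⟨hfg ▸ hmem, hu₀⟩)).2]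
  congr 1
  refine Prod.ext rfl (Prod.ext (funext fun β => ?_) rfl)
  -- The expression for the α-th new derivative has order |α| ≤ q, so agreement of the old jets up
  -- to order q is sufficient.
  exact h β.1 (orderLE_mono (mem_orderLE.1 hα) β.2)

end Realization

end

section

open Filter

/-! ### Linear algebra of forms -/

section Forms

variable {U V : Type*} [NormedAddCommGroup V] [NormedSpace ℝ V] [NormedAddCommGroup U]
  [NormedSpace ℝ U] {k n a m : ℕ}

lemma wedgeOne_apply (θ : V →L[ℝ] ℝ) (η : V [⋀^Fin k]→L[ℝ] ℝ) (v : Fin (k + 1) → V) :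
    wedgeOne θ η v = ∑ i : Fin (k + 1), (-1 : ℝ) ^ (i : ℕ) * (θ (v i) * η (i.removeNth v)) := by
  simp [wedgeOne, ContinuousAlternatingMap.alternatizeUncurryFin_apply]

lemma wedgeOne_comp (θ : V →L[ℝ] ℝ) (η : V [⋀^Fin k]→L[ℝ] ℝ) (T : U →L[ℝ] V) :
    (wedgeOne θ η).compContinuousLinearMap T =
      wedgeOne (θ.comp T) (η.compContinuousLinearMap T) := by
  ext v
  simp only [ContinuousAlternatingMap.compContinuousLinearMap_apply, wedgeOne_apply]
  rfl

lemma wedgeOne_sub (θ θ' : V →L[ℝ] ℝ) (η : V [⋀^Fin k]→L[ℝ] ℝ) :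
    wedgeOne (θ - θ') η = wedgeOne θ η - wedgeOne θ' η := by
  ext v
  simp [wedgeOne_apply, sub_mul, mul_sub, Finset.sum_sub_distrib]

lemma wedgeOne_sum {ι : Type*} (s : Finset ι) (c : ι → ℝ) (θ : ι → V →L[ℝ] ℝ)
    (η : V [⋀^Fin k]→L[ℝ] ℝ) :
    wedgeOne (∑ i ∈ s, c i • θ i) η = ∑ i ∈ s, c i • wedgeOne (θ i) η := by
  ext v
  simp only [wedgeOne_apply, sum_apply, smul_apply, ContinuousAlternatingMap.sum_apply,
    ContinuousAlternatingMap.smul_apply, smul_eq_mul, Finset.mul_sum, Finset.sum_mul]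
  rw [Finset.sum_comm]
  refine Finset.sum_congr rfl fun i _ => Finset.sum_congr rfl fun j _ => ?_
  ring

lemma wedgeOne_smul_right (c : ℝ) (θ : V →L[ℝ] ℝ) (η : V [⋀^Fin k]→L[ℝ] ℝ) :
    wedgeOne θ (c • η) = c • wedgeOne θ η := by
  ext v
  simp only [wedgeOne_apply, ContinuousAlternatingMap.smul_apply, smul_eq_mul, Finset.mul_sum]
  refine Finset.sum_congr rfl fun i _ => ?_
  ring

lemma volForm_apply (v : Fin n → Rn n) :
    volForm n v = (EuclideanSpace.basisFun (Fin n) ℝ).toBasis.det v := rfl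

lemma volForm_basis : volForm n (fun i => basisVec i) = 1 := by
  rw [volForm_apply]
  have : (fun i : Fin n => basisVec i) = (EuclideanSpace.basisFun (Fin n) ℝ).toBasis := by
    ext i
    simp [basisVec]
  rw [this, Module.Basis.det_self]

lemma volForm_comp (T : Rn n →L[ℝ] Rn n) :
    (volForm n).compContinuousLinearMap T = T.det • volForm n := by
  ext v
  exact Module.Basis.det_comp (EuclideanSpace.basisFun (Fin n) ℝ).toBasis (T : Rn n →ₗ[ℝ] Rn n) v

/-- Every form of top degree on `ℝⁿ` is a multiple of the volume form. -/
lemma eq_smul_volForm (η : Rn n [⋀^Fin n]→L[ℝ] ℝ) :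
    η = η (fun i => basisVec i) • volForm n := by
  have hb : (fun i : Fin n => basisVec i) = (EuclideanSpace.basisFun (Fin n) ℝ).toBasis := by
    ext i
    simp [basisVec]
  ext v
  have := congrArg (fun f => f v)
    (AlternatingMap.eq_smul_basis_det (EuclideanSpace.basisFun (Fin n) ℝ).toBasis η.toAlternatingMap)
  rw [hb]
  exact this

lemma form_eq_zero_of_lt (η : Rn n [⋀^Fin (n + 1)]→L[ℝ] ℝ) : η = 0 := by
  ext v
  refine η.toAlternatingMap.map_linearDependent v fun h => ?_
  have := h.fintype_card_le_finrank
  simp at this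

/-- The terms y^A_j dx^j of the contact form disappear because dx^j ∧ ω_0 = 0. Thus ω^A ∧ ω_0 does
not involve first derivatives, which matters for source forms of order zero. -/
lemma contactVol_eq (A : Fin a) (p : JetCoord n a m) :
    contactVol A p = wedgeOne ((EuclideanSpace.proj A).comp (ContinuousLinearMap.snd ℝ (Rn n) (Rn a)))
      ((volForm n).compContinuousLinearMap (ContinuousLinearMap.fst ℝ (Rn n) (Rn a))) := by
  rw [contactVol, contactForm, wedgeOne_sub, wedgeOne_sum]
  simp only [← wedgeOne_comp]
  simp only [form_eq_zero_of_lt (wedgeOne _ _)]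
  ext v
  simp

lemma sum_coord_smul_basisVec (v : Rn n) : v = ∑ j, v j • basisVec j := by
  simpa [basisVec] using ((EuclideanSpace.basisFun (Fin n) ℝ).sum_repr v).symm

/-- At a jet of a section, the contact form measures the deviation of a vector from the tangent
space of the section; in particular it kills vectors tangent to the section. -/
lemma contactForm_jetMap (A : Fin a) (Y : Rn n → Rn a) (Z : Rn n → Rn m) (u : Rn n)
    (v : Rn n × Rn a) :
    contactForm A (jetMap Y Z u) v = (v.2 - fderiv ℝ Y u v.1) A := by
  have h : fderiv ℝ Y u v.1 = ∑ j, v.1 j • pderiv j Y u := by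
    conv_lhs => rw [sum_coord_smul_basisVec v.1]
    simp [pderiv]
  simp only [contactForm, jetMap, multiIter_single, h]
  simp [mul_comm]

/-- The transformation of the contact forms under a change of fibered coordinates. -/
lemma contactForm_change {m' : ℕ} {Y Y' : Rn n → Rn a} {Z : Rn n → Rn m} {Z' : Rn n → Rn m'}
    {u : Rn n}
    {Φ : Rn n → Rn n} {F : Rn n × Rn a → Rn a} (hΦ : DifferentiableAt ℝ Φ u)
    (hY : DifferentiableAt ℝ Y u) (hY' : DifferentiableAt ℝ Y' (Φ u))
    (hF : DifferentiableAt ℝ F (u, Y u)) (h : ∀ᶠ u in 𝓝 u, Y' (Φ u) = F (u, Y u)) (B : Fin a) :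
    (contactForm B (jetMap Y' Z' (Φ u))).comp
        (((fderiv ℝ Φ u).comp (ContinuousLinearMap.fst ℝ _ _)).prod (fderiv ℝ F (u, Y u))) =
      ∑ A, (fderiv ℝ F (u, Y u) (0, basisVec A)) B • contactForm A (jetMap Y Z u) := by
  have h1 : (fderiv ℝ Y' (Φ u)).comp (fderiv ℝ Φ u) = (fderiv ℝ F (u, Y u)).comp
      ((ContinuousLinearMap.id ℝ (Rn n)).prod (fderiv ℝ Y u)) := by
    have e1 := (hY'.hasFDerivAt.comp u hΦ.hasFDerivAt).fderiv
    have e2 := (HasFDerivAt.comp u (f := fun u => (u, Y u)) hF.hasFDerivAt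
      ((hasFDerivAt_id u).prodMk hY.hasFDerivAt)).fderiv
    rw [← e1, ← e2]
    exact Filter.EventuallyEq.fderiv_eq h
  refine ContinuousLinearMap.ext fun v => ?_
  have h2 := congrArg (fun T => T v.1) h1
  simp only [ContinuousLinearMap.comp_apply, ContinuousLinearMap.prod_apply,
    ContinuousLinearMap.id_apply] at h2
  rw [ContinuousLinearMap.comp_apply, contactForm_jetMap]
  simp only [ContinuousLinearMap.prod_apply, ContinuousLinearMap.comp_apply,
    ContinuousLinearMap.coe_fst', sum_apply, smul_apply, contactForm_jetMap, h2, ← map_sub]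
  -- Subtracting the tangent vector of the section with the same base part leaves a vertical vector,
  -- so only the fibre derivatives of F contribute.
  have h3 : v - (v.1, fderiv ℝ Y u v.1) = ∑ A, (v.2 - fderiv ℝ Y u v.1) A •
      ((0, basisVec A) : Rn n × Rn a) := by
    refine Prod.ext ?_ ?_
    · simp [Prod.fst_sum]
    · simpa [Prod.snd_sum] using sum_coord_smul_basisVec (v.2 - fderiv ℝ Y u v.1)
  rw [h3, map_sum]
  simp [mul_comm, -Prod.smul_mk]

end Forms

/-! ### Differentials of charts -/

section Differentials

variable {E : Type*} [NormedAddCommGroup E] [NormedSpace ℝ E]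
  {M : Type*} [TopologicalSpace M] [ChartedSpace E M] [IsManifold 𝓘(ℝ, E) ∞ M]

lemma mfderiv_chart_change {e e' : OpenPartialHomeomorph M E}
    (he : e ∈ IsManifold.maximalAtlas 𝓘(ℝ, E) ∞ M)
    (he' : e' ∈ IsManifold.maximalAtlas 𝓘(ℝ, E) ∞ M) {x : M} (hx : x ∈ e.source)
    (hx' : x ∈ e'.source) (v : TangentSpace 𝓘(ℝ, E) x) :
    (mfderiv 𝓘(ℝ, E) 𝓘(ℝ, E) e' x v : E) =
      fderiv ℝ (e.symm.trans e') (e x) (mfderiv 𝓘(ℝ, E) 𝓘(ℝ, E) e x v : E) := by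
  have hs : e x ∈ (e.symm.trans e').source := by
    rw [OpenPartialHomeomorph.trans_source]
    exact ⟨e.map_source hx, by simpa [e.left_inv hx] using hx'⟩
  have h1 : DifferentiableAt ℝ (e.symm.trans e') (e x) :=
    ((contDiffOn_chart_change he he').contDiffAt
      ((e.symm.trans e').open_source.mem_nhds hs)).differentiableAt (by simp)
  have h2 : MDifferentiableAt 𝓘(ℝ, E) 𝓘(ℝ, E) e x :=
    (contMDiffAt_of_mem_maximalAtlas he hx).mdifferentiableAt (by simp)
  have h3 : e' =ᶠ[𝓝 x] (e.symm.trans e') ∘ e := by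
    filter_upwards [e.open_source.mem_nhds hx] with y hy
    simp [e.left_inv hy]
  rw [h3.mfderiv_eq, mfderiv_comp x h1.mdifferentiableAt h2, mfderiv_eq_fderiv]
  rfl

lemma mfderiv_chart_bijective {e : OpenPartialHomeomorph M E}
    (he : e ∈ IsManifold.maximalAtlas 𝓘(ℝ, E) ∞ M) {x : M} (hx : x ∈ e.source) :
    Function.Bijective (mfderiv 𝓘(ℝ, E) 𝓘(ℝ, E) e x) :=
  OpenPartialHomeomorph.MDifferentiable.mfderiv_bijective
    ⟨fun _ hy => ((contMDiffAt_of_mem_maximalAtlas he hy).mdifferentiableAt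
      (by simp)).mdifferentiableWithinAt,
    fun _ hy => ((contMDiffAt_symm_of_mem_maximalAtlas he hy).mdifferentiableAt
      (by simp)).mdifferentiableWithinAt⟩ hx

end Differentials

end

section

open Filter

/-! ### Fibered charts of the configuration manifold and local sections -/

section ChartsOfConfiguration

variable {n a m : ℕ} {X Yb Ym : Type*}
  [TopologicalSpace X] [ChartedSpace (Rn n) X]
  [TopologicalSpace Yb] [ChartedSpace (Rn n × Rn a) Yb]
  [TopologicalSpace Ym] [ChartedSpace (Rn n × Rn m) Ym]
  {P : Configuration n a m X Yb Ym} {x : X}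

lemma FiberedChart.fib_bg (c : FiberedChart P) : IsFiberedOver P.πb c.base c.bg :=
  ⟨c.base_mem, c.bg_mem, c.bg_base⟩

lemma FiberedChart.fib_mat (c : FiberedChart P) : IsFiberedOver P.πm c.base c.mat :=
  ⟨c.base_mem, c.mat_mem, c.mat_base⟩

/-- The values of the coordinates of order zero in a fibered chart. -/
def FiberedChart.zeroDomain (c : FiberedChart P) : Set (Rn n × Rn a × Rn m) :=
  {w | (w.1, w.2.1) ∈ c.bg.target ∧ (w.1, w.2.2) ∈ c.mat.target}

lemma FiberedChart.isOpen_zeroDomain (c : FiberedChart P) : IsOpen c.zeroDomain := by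
  refine IsOpen.inter (c.bg.open_target.preimage ?_) (c.mat.open_target.preimage ?_) <;> fun_prop

/-- The background fibre components of a local section. -/
abbrev FiberedChart.bgRep (c : FiberedChart P) (γ : LocalSection P x) : Rn n → Rn a :=
  sectionRep c.base c.bg γ.bg

/-- The matter fibre components of a local section. -/
abbrev FiberedChart.matRep (c : FiberedChart P) (γ : LocalSection P x) : Rn n → Rn m :=
  sectionRep c.base c.mat γ.mat

lemma FiberedChart.coords_eq (c : FiberedChart P) (γ : LocalSection P x) :
    c.coords γ = jetMap (c.bgRep γ) (c.matRep γ) (c.base x) := rfl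

variable [IsManifold 𝓘(ℝ, Rn n) ∞ X] [IsManifold 𝓘(ℝ, Rn n × Rn a) ∞ Yb]
  [IsManifold 𝓘(ℝ, Rn n × Rn m) ∞ Ym]

lemma FiberedChart.Mem.mem_base {c : FiberedChart P} {γ : LocalSection P x} (h : c.Mem γ) :
    x ∈ c.base.source := c.fib_bg.mem_base γ.isSection_bg h.1

lemma FiberedChart.Mem.smoothNear_bg {c : FiberedChart P} {γ : LocalSection P x} (h : c.Mem γ) :
    SmoothNear (c.bgRep γ) (c.base x) := c.fib_bg.smoothNear_sectionRep γ.isSection_bg h.1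

lemma FiberedChart.Mem.smoothNear_mat {c : FiberedChart P} {γ : LocalSection P x} (h : c.Mem γ) :
    SmoothNear (c.matRep γ) (c.base x) := c.fib_mat.smoothNear_sectionRep γ.isSection_mat h.2

lemma FiberedChart.Mem.chart_bg {c : FiberedChart P} {γ : LocalSection P x} (h : c.Mem γ) :
    c.bg (γ.bg x) = (c.base x, c.bgRep γ (c.base x)) := c.fib_bg.chart_section γ.isSection_bg h.1

lemma FiberedChart.Mem.chart_mat {c : FiberedChart P} {γ : LocalSection P x} (h : c.Mem γ) :
    c.mat (γ.mat x) = (c.base x, c.matRep γ (c.base x)) :=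
  c.fib_mat.chart_section γ.isSection_mat h.2

lemma FiberedChart.Mem.coords_mem {c : FiberedChart P} {γ : LocalSection P x} (h : c.Mem γ) :
    jetMap (c.bgRep γ) (c.matRep γ) (c.base x) ∈ jetDomain c.zeroDomain :=
  jetMap_mem_jetDomain.2 ⟨h.chart_bg ▸ c.bg.map_source h.1, h.chart_mat ▸ c.mat.map_source h.2⟩

/-- The section with given components in a fibered chart. -/
def FiberedChart.mkSection (c : FiberedChart P) (hx : x ∈ c.base.source) {f : Rn n → Rn a}
    {g : Rn n → Rn m} (hf : SmoothNear f (c.base x)) (hg : SmoothNear g (c.base x))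
    (h : jetMap f g (c.base x) ∈ jetDomain c.zeroDomain) : LocalSection P x :=
  ⟨chartSection c.base c.bg f, chartSection c.base c.mat g,
    c.fib_bg.isSectionNear_chartSection hx hf (jetMap_mem_jetDomain.1 h).1,
    c.fib_mat.isSectionNear_chartSection hx hg (jetMap_mem_jetDomain.1 h).2⟩

lemma FiberedChart.mem_mkSection (c : FiberedChart P) (hx : x ∈ c.base.source) {f : Rn n → Rn a}
    {g : Rn n → Rn m} (hf : SmoothNear f (c.base x)) (hg : SmoothNear g (c.base x))
    (h : jetMap f g (c.base x) ∈ jetDomain c.zeroDomain) : c.Mem (c.mkSection hx hf hg h) :=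
  ⟨chartSection_mem (jetMap_mem_jetDomain.1 h).1, chartSection_mem (jetMap_mem_jetDomain.1 h).2⟩

lemma FiberedChart.coords_mkSection (c : FiberedChart P) (hx : x ∈ c.base.source)
    {f : Rn n → Rn a} {g : Rn n → Rn m} (hf : SmoothNear f (c.base x))
    (hg : SmoothNear g (c.base x)) (h : jetMap f g (c.base x) ∈ jetDomain c.zeroDomain) :
    c.coords (c.mkSection hx hf hg h) = jetMap f g (c.base x) :=
  jetMap_congr (c.fib_bg.sectionRep_chartSection hf (jetMap_mem_jetDomain.1 h).1 rfl)
    (c.fib_mat.sectionRep_chartSection hg (jetMap_mem_jetDomain.1 h).2 rfl)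

/-- Every value of the jet coordinates is attained, up to any finite order. -/
lemma FiberedChart.exists_section (c : FiberedChart P) {p : JetCoord n a m} (hp : p ∈ c.domain)
    (k : ℕ) : ∃ γ : LocalSection P (c.base.symm p.1), c.Mem γ ∧ trunc k (c.coords γ) = trunc k p := by
  obtain ⟨f, hf, hfp⟩ := exists_multiIter_pderiv_eq k p.2.1 p.1
  obtain ⟨g, hg, hgp⟩ := exists_multiIter_pderiv_eq k p.2.2 p.1
  have ht : p.1 ∈ c.base.target := (c.fib_bg.proj_symm hp.1).1
  have hx := c.base.map_target ht
  have hu := c.base.right_inv ht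
  have h : jetMap f g (c.base (c.base.symm p.1)) ∈ jetDomain c.zeroDomain := by
    have h1 : f p.1 = p.2.1 0 := by simpa using hfp 0 zero_mem_orderLE
    have h2 : g p.1 = p.2.2 0 := by simpa using hgp 0 zero_mem_orderLE
    rw [hu, jetMap_mem_jetDomain, h1, h2]
    exact hp
  refine ⟨c.mkSection hx (hf.smoothNear _) (hg.smoothNear _) h, c.mem_mkSection _ _ _ _, ?_⟩
  rw [c.coords_mkSection, hu]
  exact Prod.ext rfl (Prod.ext (funext fun α => hfp α.1 α.2) (funext fun α => hgp α.1 α.2))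

/-- The charts of the two factors must lie over the same base chart, which is why fibered charts
were constructed over a prescribed one. -/
lemma LocalSection.exists_fiberedChart (γ : LocalSection P x)
    {φ : OpenPartialHomeomorph X (Rn n)} (hφ : φ ∈ IsManifold.maximalAtlas 𝓘(ℝ, Rn n) ∞ X)
    (hx : x ∈ φ.source) : ∃ c : FiberedChart P, c.base = φ ∧ c.Mem γ := by
  obtain ⟨ψ, h1, h2⟩ := P.fibered_bg.exists_fiberedOver hφ (y := γ.bg x)
    (by rwa [γ.isSection_bg.proj_eq])
  obtain ⟨ψ', h3, h4⟩ := P.fibered_mat.exists_fiberedOver hφ (y := γ.mat x)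
    (by rwa [γ.isSection_mat.proj_eq])
  exact ⟨⟨φ, ψ, ψ', hφ, h1.mem, h3.mem, h1.base, h3.base⟩, rfl, h2, h4⟩

lemma LocalSection.exists_mem (γ : LocalSection P x) : ∃ c : FiberedChart P, c.Mem γ := by
  obtain ⟨c, -, hc⟩ := γ.exists_fiberedChart (IsManifold.chart_mem_maximalAtlas x)
    (mem_chart_source (Rn n) x)
  exact ⟨c, hc⟩

lemma eventually_mem_chart (c : FiberedChart P) {γ : LocalSection P x} (h : c.Mem γ) :
    ∀ᶠ x' in 𝓝 x, ∃ (hb : IsSectionNear n a P.πb γ.bg x') (hm : IsSectionNear n m P.πm γ.mat x'),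
      c.Mem (⟨γ.bg, γ.mat, hb, hm⟩ : LocalSection P x') := by
  filter_upwards [γ.isSection_bg.eventually_mem h.1, γ.isSection_mat.eventually_mem h.2]
    with x' h1 h2
  exact ⟨h1.1, h2.1, h1.2, h2.2⟩

/-! #### Changes of charts -/

/-- The change of base coordinates. -/
abbrev FiberedChart.change (c c' : FiberedChart P) : OpenPartialHomeomorph (Rn n) (Rn n) :=
  c.base.symm.trans c'.base

lemma FiberedChart.mem_change {c c' : FiberedChart P} (hx : x ∈ c.base.source)
    (hx' : x ∈ c'.base.source) : c.base x ∈ (c.change c').source := by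
  rw [OpenPartialHomeomorph.trans_source]
  exact ⟨c.base.map_source hx, by simpa [c.base.left_inv hx] using hx'⟩

lemma FiberedChart.change_apply {c c' : FiberedChart P} (hx : x ∈ c.base.source) :
    c.change c' (c.base x) = c'.base x := by
  simp [c.base.left_inv hx]

lemma FiberedChart.contDiffOn_change (c c' : FiberedChart P) :
    ContDiffOn ℝ ∞ (c.change c') (c.change c').source :=
  contDiffOn_chart_change c.base_mem c'.base_mem

lemma FiberedChart.contDiffOn_change_symm (c c' : FiberedChart P) :
    ContDiffOn ℝ ∞ (c.change c').symm (c.change c').target := by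
  have e : (c.change c').symm = c'.change c := by
    rw [FiberedChart.change, OpenPartialHomeomorph.trans_symm_eq_symm_trans_symm,
      OpenPartialHomeomorph.symm_symm]
  rw [← OpenPartialHomeomorph.symm_source, e]
  exact c'.contDiffOn_change c

lemma eventually_nhds_base {c : FiberedChart P} (hx : x ∈ c.base.source) {p : X → Prop}
    (h : ∀ᶠ x' in 𝓝 x, p x') :
    ∀ᶠ u in 𝓝 (c.base x), u ∈ c.base.target ∧ p (c.base.symm u) := by
  have hs : ∀ᶠ u in 𝓝 (c.base x), u ∈ c.base.target :=
    c.base.open_target.mem_nhds (c.base.map_source hx)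
  exact hs.and ((tendsto_symm hx).eventually h)

lemma FiberedChart.eventually_sectionRep_change {k : ℕ} {Y : Type*} [TopologicalSpace Y]
    [ChartedSpace (Rn n × Rn k) Y] {π : Y → X} {ψ ψ' : OpenPartialHomeomorph Y (Rn n × Rn k)}
    {c c' : FiberedChart P} (h : IsFiberedOver π c.base ψ) (h' : IsFiberedOver π c'.base ψ')
    {σ : X → Y} (hσ : IsSectionNear n k π σ x) (hx : σ x ∈ ψ.source) (hx' : σ x ∈ ψ'.source) :
    ∀ᶠ u in 𝓝 (c.base x), sectionRep c'.base ψ' σ (c.change c' u) =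
      fiberChange ψ ψ' (u, sectionRep c.base ψ σ u) := by
  filter_upwards [eventually_nhds_base (h.mem_base hσ hx)
    ((hσ.eventually_mem hx).and (hσ.eventually_mem hx'))] with u hu
  have := h.sectionRep_change h' hu.2.1.1 hu.2.1.2 hu.2.2.2
  rwa [c.base.right_inv hu.1] at this

/-- Local sections with the same jet coordinates in one chart have the same jet. -/
lemma jet_eq_of_trunc_eq {q : ℕ} {γ γ' : LocalSection P x} {c : FiberedChart P} (h : c.Mem γ)
    (h' : c.Mem γ') (ht : trunc q (c.coords γ) = trunc q (c.coords γ')) : γ.jet q = γ'.jet q := by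
  have h0 := base0_eq_of_trunc_eq ht
  rw [c.coords_eq, c.coords_eq, base0_jetMap, base0_jetMap] at h0
  simp only [Prod.mk.injEq, true_and] at h0
  have e1 : γ.bg x = γ'.bg x := c.bg.injOn h.1 h'.1 (by rw [h.chart_bg, h'.chart_bg, h0.1])
  have e2 : γ.mat x = γ'.mat x := c.mat.injOn h.2 h'.2 (by rw [h.chart_mat, h'.chart_mat, h0.2])
  refine Quotient.sound ⟨e1, e2, fun c' hc => ?_⟩
  have hc' : c'.Mem γ' := ⟨e1 ▸ hc.1, e2 ▸ hc.2⟩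
  have hs := FiberedChart.mem_change h.mem_base hc.mem_base
  have hu : c.change c' (c.base x) = c'.base x := FiberedChart.change_apply h.mem_base
  simp only [trunc, FiberedChart.coords_eq, jetMap, Prod.mk.injEq, true_and] at ht ⊢
  constructor
  · funext α
    have := multiIter_pderiv_eq_of_change hs (c.contDiffOn_change c') (c.contDiffOn_change_symm c')
      h.smoothNear_bg h'.smoothNear_bg
      (h.chart_bg ▸ smoothNear_fiberChange c.fib_bg c'.fib_bg h.1 hc.1)
      (FiberedChart.eventually_sectionRep_change c.fib_bg c'.fib_bg γ.isSection_bg h.1 hc.1)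
      (FiberedChart.eventually_sectionRep_change c.fib_bg c'.fib_bg γ'.isSection_bg h'.1 hc'.1)
      (hu ▸ hc.smoothNear_bg) (hu ▸ hc'.smoothNear_bg)
      (fun α hα => congrFun ht.1 ⟨α, hα⟩) α.1 α.2
    rwa [hu] at this
  · funext α
    have := multiIter_pderiv_eq_of_change hs (c.contDiffOn_change c') (c.contDiffOn_change_symm c')
      h.smoothNear_mat h'.smoothNear_mat
      (h.chart_mat ▸ smoothNear_fiberChange c.fib_mat c'.fib_mat h.2 hc.2)
      (FiberedChart.eventually_sectionRep_change c.fib_mat c'.fib_mat γ.isSection_mat h.2 hc.2)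
      (FiberedChart.eventually_sectionRep_change c.fib_mat c'.fib_mat γ'.isSection_mat h'.2 hc'.2)
      (hu ▸ hc.smoothNear_mat) (hu ▸ hc'.smoothNear_mat)
      (fun α hα => congrFun ht.2 ⟨α, hα⟩) α.1 α.2
    rwa [hu] at this

lemma jet_eq_iff {q : ℕ} {γ γ' : LocalSection P x} :
    γ.jet q = γ'.jet q ↔ γ.bg x = γ'.bg x ∧ γ.mat x = γ'.mat x ∧
    ∀ c : FiberedChart P, c.Mem γ → trunc q (c.coords γ) = trunc q (c.coords γ') :=
  Quotient.eq (r := jetSetoid P q x)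

lemma FiberedChart.Mem.congr {q : ℕ} {γ γ' : LocalSection P x} {c : FiberedChart P} (h : c.Mem γ)
    (hj : γ.jet q = γ'.jet q) : c.Mem γ' :=
  ⟨(jet_eq_iff.1 hj).1 ▸ h.1, (jet_eq_iff.1 hj).2.1 ▸ h.2⟩

/-! #### Differentials of charts -/

lemma coframe_change {c c' : FiberedChart P} (hx : x ∈ c.base.source) (hx' : x ∈ c'.base.source)
    (v : TangentSpace 𝓘(ℝ, Rn n) x) :
    coframe c'.base x v = fderiv ℝ (c.change c') (c.base x) (coframe c.base x v) :=
  mfderiv_chart_change c.base_mem c'.base_mem hx hx' v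

lemma coframe_bijective {φ : OpenPartialHomeomorph X (Rn n)}
    (hφ : φ ∈ IsManifold.maximalAtlas 𝓘(ℝ, Rn n) ∞ X) (hx : x ∈ φ.source) :
    Function.Bijective (coframe φ x) := mfderiv_chart_bijective hφ hx

lemma omegaZero_change {c c' : FiberedChart P} (hx : x ∈ c.base.source)
    (hx' : x ∈ c'.base.source) :
    omegaZero c'.base x = (fderiv ℝ (c.change c') (c.base x)).det • omegaZero c.base x := by
  have h := volForm_comp (fderiv ℝ (c.change c') (c.base x))
  ext v
  have h1 := congrArg (fun η => η fun i => coframe c.base x (v i)) h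
  refine Eq.trans ?_ h1
  simp only [omegaZero, ContinuousAlternatingMap.compContinuousLinearMap_apply]
  congr 1
  funext i
  exact coframe_change hx hx' (v i)

lemma omegaZero_ne_zero {φ : OpenPartialHomeomorph X (Rn n)}
    (hφ : φ ∈ IsManifold.maximalAtlas 𝓘(ℝ, Rn n) ∞ X) (hx : x ∈ φ.source) :
    omegaZero φ x ≠ 0 := by
  intro h
  choose v hv using fun i : Fin n => (coframe_bijective hφ hx).2 (basisVec i)
  have h1 := congrArg (fun η => η v) h
  simp only [omegaZero, ContinuousAlternatingMap.compContinuousLinearMap_apply] at h1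
  rw [show (⇑(coframe φ x) ∘ v) = fun i => basisVec i from funext hv, volForm_basis] at h1
  exact one_ne_zero h1

lemma smul_omegaZero_inj {φ : OpenPartialHomeomorph X (Rn n)}
    (hφ : φ ∈ IsManifold.maximalAtlas 𝓘(ℝ, Rn n) ∞ X) (hx : x ∈ φ.source) {s t : ℝ}
    (h : s • omegaZero φ x = t • omegaZero φ x) : s = t :=
  smul_left_injective ℝ (omegaZero_ne_zero hφ hx) h

/-! ### Local Lagrangians and the source form -/

/-- The coefficient of a form of top degree is its value on the standard basis, a continuous linear
function of the form, so it inherits smoothness and order. -/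
lemma FiberedChart.exists_isLocalLagrangian (c : FiberedChart P) {r : ℕ} (lam : Lagrangian P r) :
    ∃ L, c.IsLocalLagrangian lam L := by
  obtain ⟨G, hG, hGe⟩ := lam.smooth c
  refine ⟨fun p => G p fun i => basisVec i, ?_, fun x γ hγ => ?_⟩
  · refine hG.comp (h := fun η : Rn n [⋀^Fin n]→L[ℝ] ℝ => η fun i => basisVec i) fun p _ => ?_
    exact (ContinuousAlternatingMap.apply ℝ (Rn n) ℝ
      (fun i : Fin n => (basisVec i : Rn n))).contDiff.contDiffAt
  · rw [hGe x γ hγ]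
    conv_lhs => rw [eq_smul_volForm (G (c.coords γ))]
    rfl

/-- Covariance of the Euler-Lagrange expressions of a Lagrangian. -/
theorem eulerLagrange_change {r : ℕ} {lam : Lagrangian P r} {c c' : FiberedChart P}
    {L L' : JetCoord n a m → ℝ} (hL : c.IsLocalLagrangian lam L)
    (hL' : c'.IsLocalLagrangian lam L') {γ : LocalSection P x} (h : c.Mem γ) (h' : c'.Mem γ)
    (A : Fin a) :
    eulerLagrange r L A (c.coords γ) = (fderiv ℝ (c.change c') (c.base x)).det *
      ∑ B, eulerLagrange r L' B (c'.coords γ) *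
        (fderiv ℝ (fiberChange c.bg c'.bg) (c.bg (γ.bg x)) (0, basisVec A)) B := by
  have hs := FiberedChart.mem_change h.mem_base h'.mem_base
  have hu : c.change c' (c.base x) = c'.base x := FiberedChart.change_apply h.mem_base
  have hF := smoothNear_fiberChange c.fib_bg c'.fib_bg h.1 h'.1
  rw [h.chart_bg] at hF ⊢
  have := eulerLagrange_covariance c.isOpen_zeroDomain c'.isOpen_zeroDomain hL.1 hL'.1 hs
    (c.contDiffOn_change c') (c.contDiffOn_change_symm c')
    (fun u hu => det_fderiv_chart_change c.base_mem c'.base_mem hu)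
    h.smoothNear_bg h.smoothNear_mat (hu ▸ h'.smoothNear_bg) (hu ▸ h'.smoothNear_mat)
    h.coords_mem (by rw [hu]; exact h'.coords_mem) hF
    (FiberedChart.eventually_sectionRep_change c.fib_bg c'.fib_bg γ.isSection_bg h.1 h'.1) ?_ A
  · rw [hu] at this
    exact this
  -- What remains is the invariance of the Lagrangian along background variations. At each point x'
  -- near x the background components are perturbed in the chart `c` and the matter part is kept;
  -- for small ε the result still passes through both charts.
  filter_upwards [eventually_nhds_base h.mem_base
    ((eventually_mem_chart c h).and (eventually_mem_chart c' h')), h.smoothNear_bg.eventually]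
    with u hall hYs φ hφ
  obtain ⟨hut, ⟨hb, hm, hc⟩, ⟨_, _, hc'⟩⟩ := hall
  set x' := c.base.symm u with hx'def
  set γ' : LocalSection P x' := ⟨γ.bg, γ.mat, hb, hm⟩ with hγ'
  have hcx' : c.base x' = u := c.base.right_inv hut
  have hY0 : c.bg (γ.bg x') = (u, c.bgRep γ u) := by
    have := hc.chart_bg
    rwa [hcx'] at this
  have htarget : (u, c.bgRep γ u) ∈ c.bg.target := hY0 ▸ c.bg.map_source hc.1
  have hcont : Tendsto (fun ε : ℝ => (u, c.bgRep γ u + ε • φ u)) (𝓝 0) (𝓝 (u, c.bgRep γ u)) := by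
    have : Continuous fun ε : ℝ => (u, c.bgRep γ u + ε • φ u) := by fun_prop
    simpa using this.tendsto 0
  have ev1 : ∀ᶠ ε in 𝓝 (0 : ℝ), (u, c.bgRep γ u + ε • φ u) ∈ c.bg.target :=
    hcont (c.bg.open_target.mem_nhds htarget)
  have ev2 : ∀ᶠ ε in 𝓝 (0 : ℝ), c.bg.symm (u, c.bgRep γ u + ε • φ u) ∈ c'.bg.source := by
    refine (Tendsto.comp (c.bg.continuousAt_symm htarget) hcont).eventually
      (c'.bg.open_source.mem_nhds ?_)
    rw [← hY0, c.bg.left_inv hc.1]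
    exact hc'.1
  filter_upwards [ev1, ev2] with ε h1 h2
  have hYε : SmoothNear (fun u => c.bgRep γ u + ε • φ u) (c.base x') := by
    rw [hcx']
    filter_upwards [hYs] with v hv using hv.add (hφ.contDiffAt.const_smul ε)
  have hx's : x' ∈ c.base.source := c.base.map_target hut
  have hε : (c.base x', (fun u => c.bgRep γ u + ε • φ u) (c.base x')) ∈ c.bg.target := by
    rw [hcx']
    exact h1
  let γε : LocalSection P x' := ⟨chartSection c.base c.bg fun u => c.bgRep γ u + ε • φ u, γ.mat,
    c.fib_bg.isSectionNear_chartSection hx's hYε hε, hm⟩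
  have hm1 : chartSection c.base c.bg (fun u => c.bgRep γ u + ε • φ u) x' ∈ c.bg.source :=
    chartSection_mem hε
  have m1 : c.Mem γε := ⟨hm1, hc.2⟩
  have m2 : c'.Mem γε := by
    refine ⟨?_, hc'.2⟩
    change c.bg.symm (c.base x', c.bgRep γ (c.base x') + ε • φ (c.base x')) ∈ _
    rw [hcx']
    exact h2
  -- The two local expressions are values of one form at the same jet, and ω_0 ≠ 0 allows the
  -- coefficients to be compared.
  have l1 := hL.2 x' γε m1
  rw [hL'.2 x' γε m2, omegaZero_change hx's hc'.mem_base, smul_smul] at l1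
  have l2 := smul_omegaZero_inj c.base_mem hx's l1
  have k1 : c.coords γε = jetMap (fun u => c.bgRep γ u + ε • φ u) (c.matRep γ) u := by
    rw [← hcx']
    exact jetMap_congr (c.fib_bg.sectionRep_chartSection hYε hε rfl)
      EventuallyEq.rfl
  rw [← k1, ← l2, mul_comm, hcx']
  rfl

/-- The local expression of the source form. -/
def FiberedChart.sourceExpr (c : FiberedChart P) (r : ℕ) (L : JetCoord n a m → ℝ)
    (γ : LocalSection P x) : (Rn n × Rn a) [⋀^Fin (n + 1)]→L[ℝ] ℝ :=
  (∑ A : Fin a, eulerLagrange r L A (c.coords γ) •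
    contactVol A (c.coords γ)).compContinuousLinearMap
      (mfderiv 𝓘(ℝ, Rn n × Rn a) 𝓘(ℝ, Rn n × Rn a) c.bg (γ.bg x))

lemma isSourceForm_iff {r q : ℕ} {lam : Lagrangian P r} {τ : BackgroundForm P q (n + 1)} :
    IsSourceForm lam τ ↔
      ∀ (c : FiberedChart P) (L : JetCoord n a m → ℝ), c.IsLocalLagrangian lam L →
        ∀ (x : X) (γ : LocalSection P x), c.Mem γ → τ x (γ.jet q) = c.sourceExpr r L γ := Iff.rfl

/-- The change of the background chart has the change of base coordinates and the change of fibre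
coordinates as components. -/
lemma fderiv_bg_change {c c' : FiberedChart P} {γ : LocalSection P x} (h : c.Mem γ)
    (h' : c'.Mem γ) :
    fderiv ℝ (c.bg.symm.trans c'.bg) (c.bg (γ.bg x)) =
      ((fderiv ℝ (c.change c') (c.base x)).comp (ContinuousLinearMap.fst ℝ _ _)).prod
        (fderiv ℝ (fiberChange c.bg c'.bg) (c.bg (γ.bg x))) := by
  have hs : c.bg (γ.bg x) ∈ (c.bg.symm.trans c'.bg).source := by
    rw [OpenPartialHomeomorph.trans_source]
    exact ⟨c.bg.map_source h.1, by simpa [c.bg.left_inv h.1] using h'.1⟩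
  have d1 : DifferentiableAt ℝ (c.change c') (c.bg (γ.bg x)).1 := by
    rw [h.chart_bg]
    exact ((c.contDiffOn_change c').contDiffAt ((c.change c').open_source.mem_nhds
      (FiberedChart.mem_change h.mem_base h'.mem_base))).differentiableAt (by simp)
  have d2 := (smoothNear_fiberChange c.fib_bg c'.fib_bg h.1 h'.1).contDiffAt.differentiableAt
    (by simp)
  have d3 := (d1.hasFDerivAt.comp (c.bg (γ.bg x)) hasFDerivAt_fst).prodMk d2.hasFDerivAt
  have e : c.bg.symm.trans c'.bg =ᶠ[𝓝 (c.bg (γ.bg x))]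
      fun w => (c.change c' w.1, fiberChange c.bg c'.bg w) := by
    filter_upwards [(c.bg.symm.trans c'.bg).open_source.mem_nhds hs] with w hw
    rw [OpenPartialHomeomorph.trans_source] at hw
    have hw1 : w ∈ c.bg.target := hw.1
    refine Prod.ext ?_ rfl
    change (c'.bg (c.bg.symm w)).1 = c'.base (c.base.symm w.1)
    rw [(c'.bg_base _ hw.2).2, (c.fib_bg.proj_symm hw1).2]
  rw [e.fderiv_eq]
  refine d3.fderiv.trans ?_
  rw [h.chart_bg]

/-- The factors match: ω'^B contributes ∂y'^B/∂y^A, ω'_0 contributes the determinant, and their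
product with E'_B is E_A by `eulerLagrange_change`. -/
lemma sourceExpr_change {r : ℕ} {lam : Lagrangian P r} {c c' : FiberedChart P}
    {L L' : JetCoord n a m → ℝ} (hL : c.IsLocalLagrangian lam L)
    (hL' : c'.IsLocalLagrangian lam L') {γ : LocalSection P x} (h : c.Mem γ) (h' : c'.Mem γ) :
    c'.sourceExpr r L' γ = c.sourceExpr r L γ := by
  set K := fderiv ℝ (c.bg.symm.trans c'.bg) (c.bg (γ.bg x)) with hK
  have hu : c.change c' (c.base x) = c'.base x := FiberedChart.change_apply h.mem_base
  have key : (∑ B : Fin a, eulerLagrange r L' B (c'.coords γ) •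
      contactVol B (c'.coords γ)).compContinuousLinearMap K =
      ∑ A : Fin a, eulerLagrange r L A (c.coords γ) • contactVol A (c.coords γ) := by
    have hB : ∀ B, (contactVol B (c'.coords γ)).compContinuousLinearMap K =
        (fderiv ℝ (c.change c') (c.base x)).det • ∑ A,
          (fderiv ℝ (fiberChange c.bg c'.bg) (c.bg (γ.bg x)) (0, basisVec A)) B •
            contactVol A (c.coords γ) := by
      intro B
      have hd1 : DifferentiableAt ℝ (c.change c') (c.base x) :=
        ((c.contDiffOn_change c').contDiffAt ((c.change c').open_source.mem_nhds
          (FiberedChart.mem_change h.mem_base h'.mem_base))).differentiableAt (by simp)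
      have hd2 := (smoothNear_fiberChange c.fib_bg c'.fib_bg h.1 h'.1).contDiffAt.differentiableAt
        (by simp)
      have hcf := contactForm_change (Z := c.matRep γ) (Z' := c'.matRep γ) hd1
        (h.smoothNear_bg.contDiffAt.differentiableAt (by simp))
        (hu ▸ h'.smoothNear_bg.contDiffAt.differentiableAt (by simp))
        (h.chart_bg ▸ hd2)
        (FiberedChart.eventually_sectionRep_change c.fib_bg c'.fib_bg γ.isSection_bg h.1 h'.1) B
      rw [hu, ← h.chart_bg, ← fderiv_bg_change h h'] at hcf
      rw [contactVol, wedgeOne_comp, c'.coords_eq, hcf, wedgeOne_sum, Finset.smul_sum]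
      refine Finset.sum_congr rfl fun A _ => ?_
      rw [smul_comm]
      congr 1
      rw [contactVol, ← wedgeOne_smul_right]
      congr 1
      have hv := volForm_comp (fderiv ℝ (c.change c') (c.base x))
      ext v
      have hv' := congrArg (fun η => η fun i => (v i).1) hv
      refine Eq.trans ?_ hv'
      simp only [ContinuousAlternatingMap.compContinuousLinearMap_apply]
      congr 1
      funext i
      simp only [hK, fderiv_bg_change h h']
      rfl
    ext v
    have hBv := fun B => congrArg (fun η => η v) (hB B)
    simp only [ContinuousAlternatingMap.compContinuousLinearMap_apply,
      ContinuousAlternatingMap.smul_apply, ContinuousAlternatingMap.sum_apply, smul_eq_mul] at hBv ⊢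
    simp only [hBv, eulerLagrange_change hL hL' h h', Finset.mul_sum, Finset.sum_mul]
    rw [Finset.sum_comm]
    refine Finset.sum_congr rfl fun A _ => Finset.sum_congr rfl fun B _ => ?_
    ring
  unfold FiberedChart.sourceExpr
  rw [← key]
  ext v
  refine congrArg (fun w => (∑ B : Fin a, eulerLagrange r L' B (c'.coords γ) •
    contactVol B (c'.coords γ)) w) (funext fun i => ?_)
  exact mfderiv_chart_change c.bg_mem c'.bg_mem h.1 h'.1 (v i)

/-- The Euler-Lagrange expressions depend on the 2r-jet only. The contact forms would require the
1-jet, but `contactVol_eq` removes this dependence, so r = q = 0 is covered. -/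
lemma sourceExpr_congr {r q : ℕ} {lam : Lagrangian P r} {c : FiberedChart P}
    {L : JetCoord n a m → ℝ} (hL : c.IsLocalLagrangian lam L) (hq : 2 * r ≤ q)
    {γ γ' : LocalSection P x} (h : c.Mem γ) (hj : γ.jet q = γ'.jet q) :
    c.sourceExpr r L γ = c.sourceExpr r L γ' := by
  have hj' := jet_eq_iff.1 hj
  have ht := trunc_mono hq (hj'.2.2 c h)
  have hE : ∀ A, eulerLagrange r L A (c.coords γ) = eulerLagrange r L A (c.coords γ') := by
    intro A
    obtain ⟨g, hg⟩ := SmoothOfOrder.eulerLagrange c.isOpen_zeroDomain hL.1 A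
    exact ((hg _ h.coords_mem).2.trans (congrArg g ht)).trans
      (hg _ (h.congr hj).coords_mem).2.symm
  have hc : ∀ A, contactVol A (c.coords γ) = contactVol A (c.coords γ') := fun A => by
    rw [contactVol_eq, contactVol_eq]
  -- The tangent spaces at the two points are different types, although the points are equal; the
  -- differentials are compared as maps of the model space.
  have hd : ∀ y y' : Yb, y = y' →
      (mfderiv 𝓘(ℝ, Rn n × Rn a) 𝓘(ℝ, Rn n × Rn a) c.bg y : Rn n × Rn a →L[ℝ] Rn n × Rn a) =
        mfderiv 𝓘(ℝ, Rn n × Rn a) 𝓘(ℝ, Rn n × Rn a) c.bg y' := by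
    rintro y _ rfl
    rfl
  ext v
  simp only [FiberedChart.sourceExpr, hE, hc]
  refine congrArg (fun w => (∑ A : Fin a, eulerLagrange r L A (c.coords γ') •
    contactVol A (c.coords γ')) w) (funext fun i => ?_)
  exact congrArg (fun D : Rn n × Rn a →L[ℝ] Rn n × Rn a => D (v i)) (hd _ _ hj'.1)

/-- The value at a jet is computed from a chosen representative in a chosen chart.
`sourceExpr_change` removes the choice of chart and `sourceExpr_congr` that of the representative.
Uniqueness holds because every jet has a representative that passes through some chart. -/
theorem existsUnique_isSourceForm {r q : ℕ} (lam : Lagrangian P r) (hq : 2 * r ≤ q) :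
    ∃! τ : BackgroundForm P q (n + 1), IsSourceForm lam τ := by
  choose ch hch using fun (x : X) (γ : LocalSection P x) => γ.exists_mem
  choose Lag hLag using fun c : FiberedChart P => c.exists_isLocalLagrangian lam
  refine ⟨fun x j => (ch x j.out).sourceExpr r (Lag (ch x j.out)) j.out, ?_, ?_⟩
  · refine isSourceForm_iff.2 fun c L hL x γ hγ => ?_
    have hj : LocalSection.jet q (γ.jet q).out = γ.jet q := Quotient.out_eq _
    have hm : c.Mem (γ.jet q).out := hγ.congr hj.symm
    change (ch x (γ.jet q).out).sourceExpr r (Lag (ch x (γ.jet q).out)) (γ.jet q).out = _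
    rw [sourceExpr_change hL (hLag _) hm (hch _ _)]
    exact sourceExpr_congr hL hq hm hj
  · intro τ hτ
    funext x j
    obtain ⟨γ, rfl⟩ := Quotient.exists_rep j
    have hj : LocalSection.jet q (γ.jet q).out = γ.jet q := Quotient.out_eq _
    have h1 := isSourceForm_iff.1 hτ (ch x (γ.jet q).out) _ (hLag _) x (γ.jet q).out (hch _ _)
    rw [hj] at h1
    exact h1

end ChartsOfConfiguration

end

section

open Filter

/-! ### Vector fields in charts -/

section Fields

variable {E : Type*} [NormedAddCommGroup E] [NormedSpace ℝ E]
  {M : Type*} [TopologicalSpace M] [ChartedSpace E M] [IsManifold 𝓘(ℝ, E) ∞ M]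

lemma chart_mdifferentiable {e : OpenPartialHomeomorph M E}
    (he : e ∈ IsManifold.maximalAtlas 𝓘(ℝ, E) ∞ M) : e.MDifferentiable 𝓘(ℝ, E) 𝓘(ℝ, E) :=
  ⟨fun _ hy => ((contMDiffAt_of_mem_maximalAtlas he hy).mdifferentiableAt
      (by simp)).mdifferentiableWithinAt,
    fun _ hy => ((contMDiffAt_symm_of_mem_maximalAtlas he hy).mdifferentiableAt
      (by simp)).mdifferentiableWithinAt⟩

/-- The chart components of a smooth vector field are smooth. -/
lemma contDiffOn_chart_field {e : OpenPartialHomeomorph M E}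
    (he : e ∈ IsManifold.maximalAtlas 𝓘(ℝ, E) ∞ M)
    (V : Cₛ^∞⟮𝓘(ℝ, E); E, (TangentSpace 𝓘(ℝ, E) : M → Type _)⟯) :
    ContDiffOn ℝ ∞ (fun u => (mfderiv 𝓘(ℝ, E) 𝓘(ℝ, E) e (e.symm u) (V (e.symm u)) : E))
      e.target := by
  have h1 := (contMDiffOn_of_mem_maximalAtlas he).contMDiffOn_tangentMapWithin (m := ∞) (by simp)
    e.open_source.uniqueMDiffOn
  have h2 := (contMDiff_snd_tangentBundle_modelSpace E 𝓘(ℝ, E) (n := ∞)).comp_contMDiffOn h1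
  have h3 := V.contMDiff.comp_contMDiffOn (contMDiffOn_symm_of_mem_maximalAtlas he)
  have h4 := h2.comp h3 (fun u hu => e.map_target hu)
  refine (contMDiffOn_iff_contDiffOn.1 h4).congr fun u hu => ?_
  exact congrArg (fun D : E →L[ℝ] E => D (V (e.symm u)))
    (mfderivWithin_of_isOpen e.open_source (e.map_target hu)).symm

/-- Vector fields with prescribed components near a point. -/
lemma exists_field [FiniteDimensional ℝ E] [T2Space M] {e : OpenPartialHomeomorph M E}
    (he : e ∈ IsManifold.maximalAtlas 𝓘(ℝ, E) ∞ M) {x : M} (hx : x ∈ e.source) {g : E → E}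
    (hg : ContDiff ℝ ∞ g) :
    ∃ V : Cₛ^∞⟮𝓘(ℝ, E); E, (TangentSpace 𝓘(ℝ, E) : M → Type _)⟯,
      ∀ᶠ y in 𝓝 x, (mfderiv 𝓘(ℝ, E) 𝓘(ℝ, E) e y (V y) : E) = g (e y) := by
  -- The field with components g in the chart is cut off by a bump function supported in the chart
  -- domain; the Hausdorff property makes the extension by zero smooth.
  obtain ⟨f, -, hf⟩ := (SmoothBumpFunction.nhds_basis_tsupport (I := 𝓘(ℝ, E)) x).mem_iff.1
    (e.open_source.mem_nhds hx)
  have hinv : ∀ y ∈ e.source, (mfderiv 𝓘(ℝ, E) 𝓘(ℝ, E) e y).IsInvertible := fun y hy =>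
    ⟨(chart_mdifferentiable he).mfderiv hy, rfl⟩
  have hg' : ContMDiff 𝓘(ℝ, E) 𝓘(ℝ, E).tangent ∞
      (fun u : E => (⟨u, g u⟩ : TangentBundle 𝓘(ℝ, E) E)) := by
    intro u
    exact contMDiffAt_vectorSpace_iff_contDiffAt.2 hg.contDiffAt
  have hV : ContMDiffOn 𝓘(ℝ, E) 𝓘(ℝ, E).tangent ∞ (fun y : M =>
      (⟨y, VectorField.mpullback 𝓘(ℝ, E) 𝓘(ℝ, E) e (fun u => g u) y⟩ : TangentBundle 𝓘(ℝ, E) M))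
      e.source := fun y hy =>
    (ContMDiffAt.mpullback_vectorField_preimage (hg'.contMDiffAt)
      (contMDiffAt_of_mem_maximalAtlas he hy) (hinv y hy) (by simp)).contMDiffWithinAt
  refine ⟨⟨_, ContMDiffOn.smul_section_of_tsupport f.contMDiff.contMDiffOn e.open_source hf hV⟩, ?_⟩
  filter_upwards [f.eventuallyEq_one, e.open_source.mem_nhds hx] with y hy hys
  change mfderiv 𝓘(ℝ, E) 𝓘(ℝ, E) e y (f y • VectorField.mpullback 𝓘(ℝ, E) 𝓘(ℝ, E) e g y) = g (e y)
  rw [hy, Pi.one_apply, one_smul]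
  exact (hinv y hys).self_apply_inverse (g (e y))

/-- Smooth functions with prescribed coordinate expression near a point. -/
lemma exists_smooth_function [FiniteDimensional ℝ E] [T2Space M] {e : OpenPartialHomeomorph M E}
    (he : e ∈ IsManifold.maximalAtlas 𝓘(ℝ, E) ∞ M) {x : M} (hx : x ∈ e.source) {g : E → ℝ}
    (hg : ContDiff ℝ ∞ g) :
    ∃ f : C^∞⟮𝓘(ℝ, E), M; ℝ⟯, ∀ᶠ y in 𝓝 x, f y = g (e y) := by
  obtain ⟨f, -, hf⟩ := (SmoothBumpFunction.nhds_basis_tsupport (I := 𝓘(ℝ, E)) x).mem_iff.1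
    (e.open_source.mem_nhds hx)
  refine ⟨⟨fun y => f y • g (e y), contMDiff_of_tsupport fun y hy => ?_⟩, ?_⟩
  · have hys : y ∈ e.source := hf (closure_mono (Function.support_smul_subset_left _ _) hy)
    exact f.contMDiffAt.smul (hg.contMDiff.contMDiffAt.comp y (contMDiffAt_of_mem_maximalAtlas he hys))
  · filter_upwards [f.eventuallyEq_one] with y hy
    simp [hy]

/-- The product of a function and a vector field. -/
lemma exists_smul_field (f : C^∞⟮𝓘(ℝ, E), M; ℝ⟯)
    (V : Cₛ^∞⟮𝓘(ℝ, E); E, (TangentSpace 𝓘(ℝ, E) : M → Type _)⟯) :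
    ∃ W : Cₛ^∞⟮𝓘(ℝ, E); E, (TangentSpace 𝓘(ℝ, E) : M → Type _)⟯, ∀ y, W y = f y • V y :=
  ⟨⟨fun y => f y • V y, f.contMDiff.smul_section V.contMDiff⟩, fun _ => rfl⟩

end Fields

/-! ### Components of lifts and their contraction with the source form -/

section Lifts

variable {n a m : ℕ} {X Yb Ym : Type*}
  [TopologicalSpace X] [ChartedSpace (Rn n) X]
  [TopologicalSpace Yb] [ChartedSpace (Rn n × Rn a) Yb]
  [TopologicalSpace Ym] [ChartedSpace (Rn n × Rn m) Ym]
  {P : Configuration n a m X Yb Ym} {x : X}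
  [IsManifold 𝓘(ℝ, Rn n) ∞ X] [IsManifold 𝓘(ℝ, Rn n × Rn a) ∞ Yb]
  [IsManifold 𝓘(ℝ, Rn n × Rn m) ∞ Ym]

/-! #### Components of vector fields -/

lemma contDiffOn_comp {φ : OpenPartialHomeomorph X (Rn n)}
    (hφ : φ ∈ IsManifold.maximalAtlas 𝓘(ℝ, Rn n) ∞ X) (ξ : BaseField n X) (i : Fin n) :
    ContDiffOn ℝ ∞ (fun u => comp φ ξ i (φ.symm u)) φ.target :=
  (EuclideanSpace.proj (𝕜 := ℝ) i).contDiff.comp_contDiffOn (contDiffOn_chart_field hφ ξ)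

lemma FiberedChart.contDiffOn_vertComp (c : FiberedChart P) (Ξ : TotalField n a Yb) (A : Fin a) :
    ContDiffOn ℝ ∞ (fun w => c.vertComp Ξ A (c.bg.symm w)) c.bg.target :=
  ((EuclideanSpace.proj (𝕜 := ℝ) A).contDiff.comp contDiff_snd).comp_contDiffOn
    (contDiffOn_chart_field c.bg_mem Ξ)

lemma comp_smul {φ : OpenPartialHomeomorph X (Rn n)} {f : C^∞⟮𝓘(ℝ, Rn n), X; ℝ⟯}
    {ξ η : BaseField n X} (h : ∀ x, η x = f x • ξ x) (i : Fin n) (x : X) :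
    comp φ η i x = f x * comp φ ξ i x := by
  rw [comp, h, map_smul]
  rfl

lemma comp_add {φ : OpenPartialHomeomorph X (Rn n)} (ξ η : BaseField n X) (i : Fin n) (x : X) :
    comp φ (ξ + η) i x = comp φ ξ i x + comp φ η i x := by
  rw [comp, ContMDiffSection.coe_add, Pi.add_apply, map_add]
  rfl

lemma contDiffOn_function {φ : OpenPartialHomeomorph X (Rn n)}
    (hφ : φ ∈ IsManifold.maximalAtlas 𝓘(ℝ, Rn n) ∞ X) (f : C^∞⟮𝓘(ℝ, Rn n), X; ℝ⟯) :
    ContDiffOn ℝ ∞ (fun u => f (φ.symm u)) φ.target :=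
  contMDiffOn_iff_contDiffOn.1 (f.contMDiff.comp_contMDiffOn (contMDiffOn_symm_of_mem_maximalAtlas hφ))

lemma compDeriv_smul {φ : OpenPartialHomeomorph X (Rn n)}
    (hφ : φ ∈ IsManifold.maximalAtlas 𝓘(ℝ, Rn n) ∞ X) {f : C^∞⟮𝓘(ℝ, Rn n), X; ℝ⟯}
    {ξ η : BaseField n X} (h : ∀ x, η x = f x • ξ x) (i j : Fin n) (hx : x ∈ φ.source) :
    compDeriv φ η i j x = f x * compDeriv φ ξ i j x +
      comp φ ξ i x * pderiv j (fun u => f (φ.symm u)) (φ x) := by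
  have ht := φ.open_target.mem_nhds (φ.map_source hx)
  have h1 := (((contDiffOn_function hφ f).contDiffAt ht).differentiableAt (by simp)).hasFDerivAt
  have h2 := (((contDiffOn_comp hφ ξ i).contDiffAt ht).differentiableAt (by simp)).hasFDerivAt
  have e : (fun u => comp φ η i (φ.symm u)) =
      fun u => f (φ.symm u) * comp φ ξ i (φ.symm u) := funext fun u => comp_smul h i _
  rw [compDeriv, e]
  refine (congrArg (fun D : Rn n →L[ℝ] ℝ => D (basisVec j)) (h1.mul h2).fderiv).trans ?_
  simp [compDeriv, pderiv, φ.left_inv hx]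

lemma exists_baseField [T2Space X] {φ : OpenPartialHomeomorph X (Rn n)}
    (hφ : φ ∈ IsManifold.maximalAtlas 𝓘(ℝ, Rn n) ∞ X) (hx : x ∈ φ.source) {g : Rn n → Rn n}
    (hg : ContDiff ℝ ∞ g) :
    ∃ ξ : BaseField n X, ∀ᶠ y in 𝓝 x, ∀ i, comp φ ξ i y = g (φ y) i ∧
      ∀ j, compDeriv φ ξ i j y = pderiv j g (φ y) i := by
  obtain ⟨ξ, hξ⟩ := exists_field hφ hx hg
  refine ⟨ξ, ?_⟩
  filter_upwards [hξ.eventually_nhds, φ.open_source.mem_nhds hx] with y hy hys i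
  refine ⟨congrArg (fun v : Rn n => v i) hy.self_of_nhds, fun j => ?_⟩
  have e : (fun u => comp φ ξ i (φ.symm u)) =ᶠ[𝓝 (φ y)] fun u => g u i := by
    filter_upwards [(tendsto_symm hys).eventually hy,
      φ.open_target.mem_nhds (φ.map_source hys)] with u hu hut
    have := congrArg (fun v : Rn n => v i) hu
    rw [φ.right_inv hut] at this
    exact this
  rw [compDeriv, pderiv, e.fderiv_eq]
  have := ((EuclideanSpace.proj (𝕜 := ℝ) i).hasFDerivAt (x := g (φ y))).comp (φ y)
    (hg.differentiable (by simp) (φ y)).hasFDerivAt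
  exact congrArg (fun D : Rn n →L[ℝ] ℝ => D (basisVec j)) this.fderiv

/-- The coefficients of the derivatives in a lift of index one are smooth. -/
lemma FiberedChart.IsLiftCoeff.contDiffOn [T2Space X] {c : FiberedChart P} {l : VectorLift P}
    {C₀ : Fin a → Fin n → Yb → ℝ} {C₁ : Fin a → Fin n → Fin n → Yb → ℝ}
    (h : c.IsLiftCoeff l C₀ C₁) (A : Fin a) (j i : Fin n) :
    ContDiffOn ℝ ∞ (fun w => C₁ A j i (c.bg.symm w)) c.bg.target := by
  intro w hw
  have hy := c.bg_base _ (c.bg.map_target hw)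
  -- The coefficients are arbitrary functions a priori. Testing on fields equal to ∂_i and x^j ∂_i
  -- near the point recovers C^{Aj}_i as the lift component of the second minus x^j times that of
  -- the first, and both components are smooth.
  obtain ⟨ξ, hξ⟩ := exists_baseField (x := P.πb (c.bg.symm w)) c.base_mem hy.1
    (g := fun _ => basisVec i) contDiff_const
  obtain ⟨ζ, hζ⟩ := exists_baseField (x := P.πb (c.bg.symm w)) c.base_mem hy.1
    (g := fun u => u j • basisVec i) (by fun_prop)
  have hev : ∀ᶠ w' in 𝓝 w, w' ∈ c.bg.target := c.bg.open_target.mem_nhds hw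
  have ht : Tendsto (fun w' => c.base.symm w'.1) (𝓝 w) (𝓝 (P.πb (c.bg.symm w))) := by
    rw [(c.fib_bg.proj_symm hw).2]
    exact (c.base.continuousAt_symm (c.fib_bg.proj_symm hw).1).tendsto.comp continuous_fst.continuousAt
  have e : (fun w => C₁ A j i (c.bg.symm w)) =ᶠ[𝓝 w] fun w =>
      c.vertComp (l.bg ζ) A (c.bg.symm w) - w.1 j * c.vertComp (l.bg ξ) A (c.bg.symm w) := by
    filter_upwards [hev, ht.eventually hξ, ht.eventually hζ] with w' hw' h1 h2
    have hp := c.fib_bg.proj_symm hw'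
    rw [h ξ A _ (c.bg.map_target hw'), h ζ A _ (c.bg.map_target hw'), hp.2]
    have h1a := fun i => (h1 i).1
    have h1b := fun i => (h1 i).2
    have h2a := fun i => (h2 i).1
    have h2b := fun i => (h2 i).2
    have d1 : ∀ k, pderiv k (fun _ : Rn n => (basisVec i : Rn n)) w'.1 = 0 :=
      fun k => by simp [pderiv]
    have d2 : ∀ k i', pderiv k (fun u : Rn n => u j • (basisVec i : Rn n)) w'.1 i' =
        if j = k then (if i' = i then 1 else 0) else 0 := fun k i' => by
      have := ((EuclideanSpace.proj (𝕜 := ℝ) j).hasFDerivAt (x := w'.1)).smul_const (basisVec i : Rn n)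
      refine (congrArg (fun D : Rn n →L[ℝ] Rn n => D (basisVec k) i') this.fderiv).trans ?_
      by_cases hjk : j = k <;> simp [basisVec, hjk]
    simp only [h1a, h1b, h2a, h2b, c.base.right_inv hp.1, d1, d2]
    simp [basisVec]
    ring
  have hs := (((c.contDiffOn_vertComp (l.bg ζ) A).contDiffAt hev).sub
    ((((EuclideanSpace.proj (𝕜 := ℝ) j).contDiff.comp contDiff_fst).contDiffAt).mul
    ((c.contDiffOn_vertComp (l.bg ξ) A).contDiffAt hev)))
  exact (hs.congr_of_eventuallyEq e).contDiffWithinAt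

/-- The component of a lift along the base. -/
lemma FiberedChart.fst_lift (c : FiberedChart P) (l : VectorLift P) (ξ : BaseField n X) {y : Yb}
    (hy : y ∈ c.bg.source) :
    (mfderiv 𝓘(ℝ, Rn n × Rn a) 𝓘(ℝ, Rn n × Rn a) c.bg y (l.bg ξ y) : Rn n × Rn a).1 =
      coframe c.base (P.πb y) (ξ (P.πb y)) := by
  have hcs : ∀ᶠ y' in 𝓝 y, y' ∈ c.bg.source := c.bg.open_source.mem_nhds hy
  have hb := c.bg_base y hy
  have hbg : MDifferentiableAt 𝓘(ℝ, Rn n × Rn a) 𝓘(ℝ, Rn n × Rn a) c.bg y :=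
    (contMDiffAt_of_mem_maximalAtlas c.bg_mem hy).mdifferentiableAt (by simp)
  have hfst : HasMFDerivAt 𝓘(ℝ, Rn n × Rn a) 𝓘(ℝ, Rn n) (fun w : Rn n × Rn a => w.1) (c.bg y)
      (ContinuousLinearMap.fst ℝ (Rn n) (Rn a)) := hasFDerivAt_fst.hasMFDerivAt
  have h1 := hfst.comp y hbg.hasMFDerivAt
  have hsymm : MDifferentiableAt 𝓘(ℝ, Rn n) 𝓘(ℝ, Rn n) c.base.symm (c.bg y).1 :=
    (contMDiffAt_symm_of_mem_maximalAtlas c.base_mem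
      (by rw [hb.2]; exact c.base.map_source hb.1)).mdifferentiableAt (by simp)
  -- The condition that Ξ projects to ξ is stated with `mfderiv`, so differentiability of the
  -- projection is needed to use it; in fibered charts the projection is the first component.
  have hπ : MDifferentiableAt 𝓘(ℝ, Rn n × Rn a) 𝓘(ℝ, Rn n) P.πb y := by
    refine (hsymm.comp y h1.mdifferentiableAt).congr_of_eventuallyEq ?_
    filter_upwards [hcs] with y' hy'
    have := c.bg_base y' hy'
    simp [this.2, c.base.left_inv this.1]
  have hbase : MDifferentiableAt 𝓘(ℝ, Rn n) 𝓘(ℝ, Rn n) c.base (P.πb y) :=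
    (contMDiffAt_of_mem_maximalAtlas c.base_mem hb.1).mdifferentiableAt (by simp)
  have h2 := hbase.hasMFDerivAt.comp y hπ.hasMFDerivAt
  have h3 := hasMFDerivAt_unique h1 (h2.congr_of_eventuallyEq (hcs.mono fun y' hy' =>
    (c.bg_base y' hy').2))
  have h4 := congrArg (fun D : Rn n × Rn a →L[ℝ] Rn n => D (l.bg ξ y)) h3
  refine h4.trans ?_
  exact congrArg (fun v => coframe c.base (P.πb y) v) (l.bg_project ξ y)

/-- The differential of a section in a fibered chart. -/
lemma FiberedChart.Mem.mfderiv_section {c : FiberedChart P} {γ : LocalSection P x} (h : c.Mem γ)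
    (v : TangentSpace 𝓘(ℝ, Rn n) x) :
    (mfderiv 𝓘(ℝ, Rn n × Rn a) 𝓘(ℝ, Rn n × Rn a) c.bg (γ.bg x)
      (mfderiv 𝓘(ℝ, Rn n) 𝓘(ℝ, Rn n × Rn a) γ.bg x v) : Rn n × Rn a) =
      (coframe c.base x v, fderiv ℝ (c.bgRep γ) (c.base x) (coframe c.base x v)) := by
  have hbg : MDifferentiableAt 𝓘(ℝ, Rn n × Rn a) 𝓘(ℝ, Rn n × Rn a) c.bg (γ.bg x) :=
    (contMDiffAt_of_mem_maximalAtlas c.bg_mem h.1).mdifferentiableAt (by simp)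
  have hγ := γ.isSection_bg.contMDiffAt.mdifferentiableAt (by simp)
  have h1 := hbg.hasMFDerivAt.comp x hγ.hasMFDerivAt
  have hbase : MDifferentiableAt 𝓘(ℝ, Rn n) 𝓘(ℝ, Rn n) c.base x :=
    (contMDiffAt_of_mem_maximalAtlas c.base_mem h.mem_base).mdifferentiableAt (by simp)
  have hG : HasMFDerivAt 𝓘(ℝ, Rn n) 𝓘(ℝ, Rn n × Rn a) (fun u => (u, c.bgRep γ u)) (c.base x)
      ((ContinuousLinearMap.id ℝ (Rn n)).prod (fderiv ℝ (c.bgRep γ) (c.base x))) :=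
    ((hasFDerivAt_id (c.base x)).prodMk
      (h.smoothNear_bg.contDiffAt.differentiableAt (by simp)).hasFDerivAt).hasMFDerivAt
  have h2 := hG.comp x hbase.hasMFDerivAt
  have e : c.bg ∘ γ.bg =ᶠ[𝓝 x] (fun u => (u, c.bgRep γ u)) ∘ c.base := by
    filter_upwards [γ.isSection_bg.eventually_mem h.1] with x' hx'
    exact c.fib_bg.chart_section hx'.1 hx'.2
  have h3 := hasMFDerivAt_unique h1 (h2.congr_of_eventuallyEq e)
  exact congrArg (fun D : Rn n →L[ℝ] Rn n × Rn a => D v) h3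

/-- The contraction of the source form with a lift in a fibered chart. -/
lemma hContract_eq {r q : ℕ} {lam : Lagrangian P r} {τ : BackgroundForm P q (n + 1)}
    (hτ : IsSourceForm lam τ) {c : FiberedChart P} {L : JetCoord n a m → ℝ}
    (hL : c.IsLocalLagrangian lam L) (l : VectorLift P) (ξ : BaseField n X)
    {γ : LocalSection P x} (h : c.Mem γ) :
    hContract τ (l.bg ξ) γ = (∑ A, eulerLagrange r L A (c.coords γ) *
      (c.vertComp (l.bg ξ) A (γ.bg x) - ∑ j, (c.coords γ).2.1 (Pi.single j 1) A *
        comp c.base ξ j x)) • omegaZero c.base x := by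
  have hτ' := hτ c L hL x γ h
  ext v
  have hfst := c.fst_lift l ξ h.1
  rw [γ.isSection_bg.proj_eq] at hfst
  set w : Rn n × Rn a := mfderiv 𝓘(ℝ, Rn n × Rn a) 𝓘(ℝ, Rn n × Rn a) c.bg (γ.bg x)
    (l.bg ξ (γ.bg x)) with hw
  let W : Fin n → Rn n × Rn a := fun i =>
    (coframe c.base x (v i), fderiv ℝ (c.bgRep γ) (c.base x) (coframe c.base x (v i)))
  have h1 : hContract τ (l.bg ξ) γ v = (∑ A : Fin a, eulerLagrange r L A (c.coords γ) •
      contactVol A (c.coords γ)) (Fin.cons w W) := by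
    have : hContract τ (l.bg ξ) γ v = (τ x (γ.jet q) : (Rn n × Rn a) [⋀^Fin (n + 1)]→L[ℝ] ℝ)
      (Fin.cons (l.bg ξ (γ.bg x) : Rn n × Rn a)
        fun i => (mfderiv 𝓘(ℝ, Rn n) 𝓘(ℝ, Rn n × Rn a) γ.bg x (v i) : Rn n × Rn a)) := rfl
    rw [this]
    refine (congrArg (fun η : (Rn n × Rn a) [⋀^Fin (n + 1)]→L[ℝ] ℝ => η
      (Fin.cons (l.bg ξ (γ.bg x) : Rn n × Rn a)
        fun i => (mfderiv 𝓘(ℝ, Rn n) 𝓘(ℝ, Rn n × Rn a) γ.bg x (v i) : Rn n × Rn a))) hτ').trans ?_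
    refine congrArg (fun W => (∑ A : Fin a, eulerLagrange r L A (c.coords γ) •
      contactVol A (c.coords γ)) W) (funext fun i => ?_)
    refine Fin.cases ?_ (fun i => ?_) i
    · rfl
    · exact h.mfderiv_section (v i)
  rw [h1]
  simp only [ContinuousAlternatingMap.sum_apply, ContinuousAlternatingMap.smul_apply, smul_eq_mul,
    Finset.sum_mul]
  refine Finset.sum_congr rfl fun A _ => ?_
  rw [mul_assoc]
  congr 1
  -- Contact forms vanish on the tangent vectors of the section, so in the expansion of ω^A ∧ ω_0
  -- only the term with ω^A evaluated on the lift survives.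
  have hz : ∀ i, contactForm A (c.coords γ) (W i) = 0 := fun i => by
    rw [c.coords_eq, contactForm_jetMap]
    simp [W]
  have hwA : contactForm A (c.coords γ) w = c.vertComp (l.bg ξ) A (γ.bg x) -
      ∑ j, (c.coords γ).2.1 (Pi.single j 1) A * comp c.base ξ j x := by
    simp only [contactForm, sub_apply, sum_apply, smul_apply, smul_eq_mul,
      ContinuousLinearMap.comp_apply, ContinuousLinearMap.coe_fst', ContinuousLinearMap.coe_snd',
      hfst]
    rfl
  rw [contactVol, wedgeOne_apply, Fin.sum_univ_succ]
  simp only [Fin.cons_succ, hz, zero_mul, mul_zero, Finset.sum_const_zero, add_zero, Fin.cons_zero,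
    hwA, Fin.val_zero, pow_zero, one_mul]
  rfl

/-- The deviation of the contraction with the lift from linearity over functions. -/
lemma hContract_smul {r q : ℕ} {lam : Lagrangian P r} {τ : BackgroundForm P q (n + 1)}
    (hτ : IsSourceForm lam τ) {c : FiberedChart P} {L : JetCoord n a m → ℝ}
    (hL : c.IsLocalLagrangian lam L) {l : VectorLift P}
    {C₀ : Fin a → Fin n → Yb → ℝ} {C₁ : Fin a → Fin n → Fin n → Yb → ℝ}
    (hC : c.IsLiftCoeff l C₀ C₁) {f : C^∞⟮𝓘(ℝ, Rn n), X; ℝ⟯} {ξ η : BaseField n X}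
    (hη : ∀ x, η x = f x • ξ x) {γ : LocalSection P x} (h : c.Mem γ) :
    hContract τ (l.bg η) γ = f x • hContract τ (l.bg ξ) γ +
      (∑ j, (∑ i, c.emComponent r C₁ L j i γ * comp c.base ξ i x) *
        pderiv j (fun u => f (c.base.symm u)) (c.base x)) • omegaZero c.base x := by
  rw [hContract_eq hτ hL l η h, hContract_eq hτ hL l ξ h, smul_smul, ← add_smul]
  congr 1
  -- The terms with ξ^i and y^A_j ξ^j are just multiplied by f. The product rule for ξ^i_{,j} leaves
  -- the additional term with ∂_j f.
  simp only [hC _ _ _ h.1, γ.isSection_bg.proj_eq, comp_smul hη,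
    compDeriv_smul c.base_mem hη _ _ h.mem_base, FiberedChart.emComponent, Finset.sum_mul]
  have hswap : ∑ j, ∑ i, ∑ A, C₁ A j i (γ.bg x) * eulerLagrange r L A (c.coords γ) *
      comp c.base ξ i x * pderiv j (fun u => f (c.base.symm u)) (c.base x) =
      ∑ A, ∑ i, ∑ j, C₁ A j i (γ.bg x) * eulerLagrange r L A (c.coords γ) *
      comp c.base ξ i x * pderiv j (fun u => f (c.base.symm u)) (c.base x) := by
    rw [Finset.sum_comm, Finset.sum_comm (s := (Finset.univ : Finset (Fin a)))]
    exact Finset.sum_congr rfl fun i _ => Finset.sum_comm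
  rw [hswap, Finset.mul_sum, ← Finset.sum_add_distrib]
  refine Finset.sum_congr rfl fun A _ => ?_
  have e1 : ∀ i, C₀ A i (γ.bg x) * (f x * comp c.base ξ i x) =
      f x * (C₀ A i (γ.bg x) * comp c.base ξ i x) := fun i => by ring
  have e2 : ∀ i j, C₁ A j i (γ.bg x) * (f x * compDeriv c.base ξ i j x) =
      f x * (C₁ A j i (γ.bg x) * compDeriv c.base ξ i j x) := fun i j => by ring
  have e3 : ∀ j, (c.coords γ).2.1 (Pi.single j 1) A * (f x * comp c.base ξ j x) =
      f x * ((c.coords γ).2.1 (Pi.single j 1) A * comp c.base ξ j x) := fun i => by ring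
  have e4 : ∑ i, ∑ j, C₁ A j i (γ.bg x) * eulerLagrange r L A (c.coords γ) *
      comp c.base ξ i x * pderiv j (fun u => f (c.base.symm u)) (c.base x) =
      eulerLagrange r L A (c.coords γ) * ∑ i, ∑ j, C₁ A j i (γ.bg x) *
        (comp c.base ξ i x * pderiv j (fun u => f (c.base.symm u)) (c.base x)) := by
    simp only [Finset.mul_sum]
    exact Finset.sum_congr rfl fun i _ => Finset.sum_congr rfl fun j _ => by ring
  simp only [mul_add, Finset.sum_add_distrib, e1, e2, e3, e4, ← Finset.mul_sum]
  ring

end Lifts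

end

section

open Filter

/-! ### Forms of degree `dim X - 1` -/

section Codegree

variable {n : ℕ}

/-- The form θ ∧ dx¹ ∧ ... vanishes because its degree exceeds the dimension; contracting it with
`e` gives 0 = θ(e) vol - θ ∧ i_e vol. -/
lemma wedgeOne_curryLeft_volForm (θ : Rn (n + 1) →L[ℝ] ℝ) (e : Rn (n + 1)) :
    wedgeOne θ ((volForm (n + 1)).curryLeft e) = θ e • volForm (n + 1) := by
  ext v
  have h := congrArg (fun η => η (Fin.cons e v : Fin (n + 2) → Rn (n + 1))) (form_eq_zero_of_lt (wedgeOne θ (volForm (n + 1))))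
  simp only [ContinuousAlternatingMap.coe_zero, Pi.zero_apply] at h
  rw [wedgeOne_apply, Fin.sum_univ_succ] at h
  rw [wedgeOne_apply]
  have h2 : ∀ i : Fin (n + 1), volForm (n + 1) (Fin.removeNth i.succ (Fin.cons e v : Fin (n + 2) → Rn (n + 1))) =
      (volForm (n + 1)).curryLeft e (Fin.removeNth i v) := by
    intro i
    refine congrArg (fun w => volForm (n + 1) w) (funext fun k => ?_)
    refine Fin.cases ?_ (fun k => ?_) k
    · rfl
    · simp [Fin.removeNth]
  simp only [Fin.cons_zero, Fin.cons_succ, h2, Fin.val_zero, pow_zero, one_mul, Fin.val_succ,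
    pow_succ, Fin.removeNth_zero, Fin.tail_cons] at h
  rw [ContinuousAlternatingMap.smul_apply, smul_eq_mul]
  simp only [mul_neg, mul_one, neg_mul, Finset.sum_neg_distrib] at h
  linarith

/-- A choice of n basis vectors in dimension n + 1 omits some e_k. Evaluated on e_k followed by
these vectors, dx^k ∧ β reduces to the value of β on them. -/
lemma eq_zero_of_wedgeOne_eq_zero (β : Rn (n + 1) [⋀^Fin n]→L[ℝ] ℝ)
    (h : ∀ k : Fin (n + 1), wedgeOne (EuclideanSpace.proj k) β = 0) : β = 0 := by
  have : β.toAlternatingMap = 0 := by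
    refine Module.Basis.ext_alternating (EuclideanSpace.basisFun (Fin (n + 1)) ℝ).toBasis
      fun v hv => ?_
    obtain ⟨k, hk⟩ : ∃ k, ∀ i, v i ≠ k := by
      by_contra! hc
      have := Fintype.card_le_of_surjective v hc
      simp at this
    have h1 := congrArg (fun η => η (Fin.cons (basisVec k) fun i => basisVec (v i))) (h k)
    simp only [ContinuousAlternatingMap.coe_zero, Pi.zero_apply] at h1
    rw [wedgeOne_apply, Fin.sum_univ_succ] at h1
    have h2 : ∀ i, EuclideanSpace.proj (𝕜 := ℝ) k (basisVec (v i)) = 0 := fun i => by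
      simp [basisVec, (hk i).symm]
    simp only [Fin.cons_zero, Fin.cons_succ, h2, zero_mul, mul_zero,
      Finset.sum_const_zero, add_zero, Fin.val_zero, pow_zero, one_mul, Fin.removeNth_zero,
      Fin.tail_cons] at h1
    rw [show EuclideanSpace.proj (𝕜 := ℝ) k (basisVec k) = 1 by simp [basisVec], one_mul] at h1
    have e : (fun i => (EuclideanSpace.basisFun (Fin (n + 1)) ℝ).toBasis (v i)) =
        fun i => basisVec (v i) := by
      funext i
      simp [basisVec]
    rw [e]
    exact h1
  ext v
  exact congrArg (fun η => η v) this

lemma wedgeOne_sum_curryLeft_volForm (θ : Rn (n + 1) →L[ℝ] ℝ) (S : Fin (n + 1) → ℝ) :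
    wedgeOne θ (∑ j, S j • (volForm (n + 1)).curryLeft (basisVec j)) =
      (∑ j, S j * θ (basisVec j)) • volForm (n + 1) := by
  have : ∀ s : Finset (Fin (n + 1)), wedgeOne θ
      (∑ j ∈ s, S j • (volForm (n + 1)).curryLeft (basisVec j)) =
      ∑ j ∈ s, wedgeOne θ (S j • (volForm (n + 1)).curryLeft (basisVec j)) := fun s => by
    ext v
    simp only [wedgeOne_apply, ContinuousAlternatingMap.sum_apply, Finset.mul_sum]
    exact Finset.sum_comm
  rw [this, Finset.sum_smul]
  refine Finset.sum_congr rfl fun j _ => ?_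
  rw [wedgeOne_smul_right, wedgeOne_curryLeft_volForm, smul_smul]

/-- A form of degree `n` on `ℝⁿ⁺¹` is determined by its products with the `dxᵏ`. -/
lemma eq_sum_curryLeft_volForm {β : Rn (n + 1) [⋀^Fin n]→L[ℝ] ℝ} {S : Fin (n + 1) → ℝ}
    (h : ∀ k, wedgeOne (EuclideanSpace.proj k) β = S k • volForm (n + 1)) :
    β = ∑ j, S j • (volForm (n + 1)).curryLeft (basisVec j) := by
  rw [← sub_eq_zero]
  refine eq_zero_of_wedgeOne_eq_zero _ fun k => ?_
  have e : wedgeOne (EuclideanSpace.proj k)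
      (β - ∑ j, S j • (volForm (n + 1)).curryLeft (basisVec j)) =
      wedgeOne (EuclideanSpace.proj k) β - wedgeOne (EuclideanSpace.proj k)
        (∑ j, S j • (volForm (n + 1)).curryLeft (basisVec j)) := by
    ext v
    simp [wedgeOne_apply, mul_sub, Finset.sum_sub_distrib]
  rw [e, h, wedgeOne_sum_curryLeft_volForm, sub_eq_zero]
  simp [basisVec]

end Codegree

/-! ### The exterior derivative in charts -/

section ExtDeriv

variable {n k : ℕ} {X : Type*} [TopologicalSpace X] [ChartedSpace (Rn n) X]
  [IsManifold 𝓘(ℝ, Rn n) ∞ X] {x : X}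

lemma extDeriv_smul_apply {f : Rn n → ℝ} {W : Rn n → Rn n [⋀^Fin k]→L[ℝ] ℝ} {u : Rn n}
    (hf : DifferentiableAt ℝ f u) (hW : DifferentiableAt ℝ W u) :
    extDeriv (fun u => f u • W u) u = f u • extDeriv W u + wedgeOne (fderiv ℝ f u) (W u) := by
  have h : fderiv ℝ (fun u => f u • W u) u =
      f u • fderiv ℝ W u + (fderiv ℝ f u).smulRight (W u) := fderiv_fun_smul hf hW
  rw [extDeriv, extDeriv]
  refine (congrArg (fun D : Rn n →L[ℝ] Rn n [⋀^Fin k]→L[ℝ] ℝ =>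
    ContinuousAlternatingMap.alternatizeUncurryFin D) h).trans ?_
  rw [ContinuousAlternatingMap.alternatizeUncurryFin_add,
    ContinuousAlternatingMap.alternatizeUncurryFin_smul]
  rfl

lemma coframe_frame {φ ψ : OpenPartialHomeomorph X (Rn n)}
    (hφ : φ ∈ IsManifold.maximalAtlas 𝓘(ℝ, Rn n) ∞ X)
    (hψ : ψ ∈ IsManifold.maximalAtlas 𝓘(ℝ, Rn n) ∞ X) {u : Rn n} (hu : u ∈ ψ.target)
    (hx : ψ.symm u ∈ φ.source) (v : Rn n) :
    coframe φ (ψ.symm u) (frame ψ u v) = fderiv ℝ (ψ.symm.trans φ) u v := by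
  have h1 : MDifferentiableAt 𝓘(ℝ, Rn n) 𝓘(ℝ, Rn n) ψ.symm u :=
    (contMDiffAt_symm_of_mem_maximalAtlas hψ hu).mdifferentiableAt (by simp)
  have h2 : MDifferentiableAt 𝓘(ℝ, Rn n) 𝓘(ℝ, Rn n) φ (ψ.symm u) :=
    (contMDiffAt_of_mem_maximalAtlas hφ hx).mdifferentiableAt (by simp)
  have h3 := (h2.hasMFDerivAt.comp u h1.hasMFDerivAt).mfderiv
  rw [mfderiv_eq_fderiv] at h3
  exact (congrArg (fun D : Rn n →L[ℝ] Rn n => D v) h3).symm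

/-- The exterior derivative can be computed in any chart. -/
lemma extDerivM_eq {η : (x : X) → (TangentSpace 𝓘(ℝ, Rn n) x) [⋀^Fin k]→L[ℝ] ℝ}
    {φ : OpenPartialHomeomorph X (Rn n)} (hφ : φ ∈ IsManifold.maximalAtlas 𝓘(ℝ, Rn n) ∞ X)
    (hx : x ∈ φ.source) {W : Rn n → Rn n [⋀^Fin k]→L[ℝ] ℝ} (hW : DifferentiableAt ℝ W (φ x))
    (h : ∀ᶠ x' in 𝓝 x, η x' = (W (φ x')).compContinuousLinearMap (coframe φ x')) :
    extDerivM η x = (extDeriv W (φ x)).compContinuousLinearMap (coframe φ x) := by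
  set ψ := chartAt (Rn n) x with hψ
  have hψm : ψ ∈ IsManifold.maximalAtlas 𝓘(ℝ, Rn n) ∞ X := IsManifold.chart_mem_maximalAtlas x
  have hψx : x ∈ ψ.source := mem_chart_source (Rn n) x
  set Φ := ψ.symm.trans φ with hΦ
  have hs : ψ x ∈ Φ.source := by
    rw [hΦ, OpenPartialHomeomorph.trans_source]
    exact ⟨ψ.map_source hψx, by simpa [ψ.left_inv hψx] using hx⟩
  have hΦx : Φ (ψ x) = φ x := by simp [hΦ, ψ.left_inv hψx]
  have hΦs : ContDiffAt ℝ ∞ Φ (ψ x) :=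
    (contDiffOn_chart_change hψm hφ).contDiffAt (Φ.open_source.mem_nhds hs)
  have e : (fun u : Rn n => (η (ψ.symm u)).compContinuousLinearMap (frame ψ u)) =ᶠ[𝓝 (ψ x)]
      fun u => (W (Φ u)).compContinuousLinearMap (fderiv ℝ Φ u) := by
    filter_upwards [(tendsto_symm hψx).eventually h, Φ.open_source.mem_nhds hs] with u h1 h2
    rw [hΦ, OpenPartialHomeomorph.trans_source] at h2
    rw [h1]
    ext v
    exact congrArg (fun w => W (Φ u) w) (funext fun i => coframe_frame hφ hψm h2.1 h2.2 (v i))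
  -- In the preferred chart the form is the pullback of W by the coordinate change, and exterior
  -- differentiation commutes with pullback.
  have h1 := e.extDeriv_eq.trans
    (extDeriv_pullback (by rw [hΦx]; exact hW) hΦs (by
      rw [minSmoothness_of_isRCLikeNormedField]
      exact WithTop.coe_le_coe.2 (le_top : (2 : ℕ∞) ≤ ⊤)))
  unfold extDerivM
  rw [← hψ, h1, hΦx]
  ext v
  exact congrArg (fun w => extDeriv W (φ x) w) (funext fun i =>
    (mfderiv_chart_change hψm hφ hψx hx (v i)).symm)

end ExtDeriv

/-! ### The horizontal differential in fibered charts -/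

section HorizontalDifferential

variable {n a m : ℕ} {X Yb Ym : Type*}
  [TopologicalSpace X] [ChartedSpace (Rn n) X]
  [TopologicalSpace Yb] [ChartedSpace (Rn n × Rn a) Yb]
  [TopologicalSpace Ym] [ChartedSpace (Rn n × Rn m) Ym]
  {P : Configuration n a m X Yb Ym} {x : X}
  [IsManifold 𝓘(ℝ, Rn n) ∞ X] [IsManifold 𝓘(ℝ, Rn n × Rn a) ∞ Yb]
  [IsManifold 𝓘(ℝ, Rn n × Rn m) ∞ Ym]

/-- `G` is the local expression of the horizontal form `ρ` in the chart. -/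
def FiberedChart.IsLocalForm {q k : ℕ} (c : FiberedChart P) (ρ : HorizontalForm P q k)
    (G : JetCoord n a m → Rn n [⋀^Fin k]→L[ℝ] ℝ) : Prop :=
  SmoothOfOrder q c.domain G ∧ ∀ (x : X) (γ : LocalSection P x), c.Mem γ →
    ρ.toFun x (γ.jet q) = (G (c.coords γ)).compContinuousLinearMap (coframe c.base x)

variable {q k : ℕ} {c : FiberedChart P} {ρ : HorizontalForm P q k}
  {G : JetCoord n a m → Rn n [⋀^Fin k]→L[ℝ] ℝ} {γ : LocalSection P x}

lemma FiberedChart.IsLocalForm.eventually_pullback (hG : c.IsLocalForm ρ G) (h : c.Mem γ) :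
    ∀ᶠ x' in 𝓝 x, ρ.pullback γ.bg γ.mat x' =
      (G (jetMap (c.bgRep γ) (c.matRep γ) (c.base x'))).compContinuousLinearMap
        (coframe c.base x') := by
  -- At every point near x the maps are still sections through the chart, so the default value 0 of
  -- the pullback is not taken there.
  filter_upwards [eventually_mem_chart c h] with x' hx'
  obtain ⟨hb, hm, hc⟩ := hx'
  rw [HorizontalForm.pullback, dif_pos ⟨hb, hm⟩]
  exact hG.2 x' _ hc

lemma FiberedChart.IsLocalForm.smoothNear (hG : c.IsLocalForm ρ G) (h : c.Mem γ) :
    SmoothNear (fun u => G (jetMap (c.bgRep γ) (c.matRep γ) u)) (c.base x) :=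
  hG.1.smoothNear_comp_jetMap c.isOpen_zeroDomain h.smoothNear_bg h.smoothNear_mat h.coords_mem

/-- The horizontal differential in a chart. -/
lemma FiberedChart.IsLocalForm.hd_eq (hG : c.IsLocalForm ρ G) (h : c.Mem γ) :
    ρ.hd γ = (extDeriv (fun u => G (jetMap (c.bgRep γ) (c.matRep γ) u))
      (c.base x)).compContinuousLinearMap (coframe c.base x) :=
  extDerivM_eq c.base_mem h.mem_base
    ((hG.smoothNear h).contDiffAt.differentiableAt (by simp)) (hG.eventually_pullback h)

/-- The Leibniz rule for the horizontal differential. -/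
lemma FiberedChart.IsLocalForm.hd_smul (hG : c.IsLocalForm ρ G) (h : c.Mem γ)
    {ρ' : HorizontalForm P q k} {f : C^∞⟮𝓘(ℝ, Rn n), X; ℝ⟯}
    (hf : ∀ x j, ρ'.toFun x j = f x • ρ.toFun x j) :
    ρ'.hd γ = f x • ρ.hd γ + (wedgeOne (fderiv ℝ (fun u => f (c.base.symm u)) (c.base x))
      (G (c.coords γ))).compContinuousLinearMap (coframe c.base x) := by
  have hd1 := (hG.smoothNear h).contDiffAt.differentiableAt (by simp)
  have hd2 : DifferentiableAt ℝ (fun u => f (c.base.symm u)) (c.base x) :=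
    ((contDiffOn_function c.base_mem f).contDiffAt (c.base.open_target.mem_nhds
      (c.base.map_source h.mem_base))).differentiableAt (by simp)
  have e : ∀ᶠ x' in 𝓝 x, ρ'.pullback γ.bg γ.mat x' =
      (f (c.base.symm (c.base x')) • G (jetMap (c.bgRep γ) (c.matRep γ)
        (c.base x'))).compContinuousLinearMap (coframe c.base x') := by
    filter_upwards [eventually_mem_chart c h] with x' hx'
    obtain ⟨hb, hm, hc⟩ := hx'
    rw [HorizontalForm.pullback, dif_pos ⟨hb, hm⟩, hf, hG.2 x' _ hc, c.base.left_inv hc.mem_base]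
    rfl
  rw [hG.hd_eq h, HorizontalForm.hd, extDerivM_eq c.base_mem h.mem_base (hd2.fun_smul hd1) e,
    extDeriv_smul_apply hd2 hd1, c.base.left_inv h.mem_base]
  rfl

end HorizontalDifferential

end

section

open Filter

/-! ### The energy-momentum tensor in charts -/

section EnergyMomentum

variable {n a m : ℕ} {X Yb Ym : Type*}
  [TopologicalSpace X] [ChartedSpace (Rn (n + 1)) X]
  [TopologicalSpace Yb] [ChartedSpace (Rn (n + 1) × Rn a) Yb]
  [TopologicalSpace Ym] [ChartedSpace (Rn (n + 1) × Rn m) Ym]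
  {P : Configuration (n + 1) a m X Yb Ym} {x : X}

/-- The local expression `T^j_i ξ^i ω_j` of the energy-momentum tensor. -/
def FiberedChart.emExpr [IsManifold 𝓘(ℝ, Rn (n + 1)) ∞ X] (c : FiberedChart P) (r : ℕ)
    (C₁ : Fin a → Fin (n + 1) → Fin (n + 1) → Yb → ℝ) (L : JetCoord (n + 1) a m → ℝ)
    (ξ : BaseField (n + 1) X) (γ : LocalSection P x) : Rn (n + 1) [⋀^Fin n]→L[ℝ] ℝ :=
  ∑ j, (∑ i, c.emComponent r C₁ L j i γ * comp c.base ξ i x) •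
    (volForm (n + 1)).curryLeft (basisVec j)

variable [IsManifold 𝓘(ℝ, Rn (n + 1)) ∞ X] [IsManifold 𝓘(ℝ, Rn (n + 1) × Rn a) ∞ Yb]
  [IsManifold 𝓘(ℝ, Rn (n + 1) × Rn m) ∞ Ym]

lemma pullback_coframe_injective {k : ℕ} {φ : OpenPartialHomeomorph X (Rn (n + 1))}
    (hφ : φ ∈ IsManifold.maximalAtlas 𝓘(ℝ, Rn (n + 1)) ∞ X) (hx : x ∈ φ.source)
    {α β : Rn (n + 1) [⋀^Fin k]→L[ℝ] ℝ}
    (h : α.compContinuousLinearMap (coframe φ x) = β.compContinuousLinearMap (coframe φ x)) :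
    α = β := by
  ext v
  choose w hw using fun i => (coframe_bijective hφ hx).2 (v i)
  have h1 := congrArg (fun η => η w) h
  have hv : v = fun i => coframe φ x (w i) := funext fun i => (hw i).symm
  rw [hv]
  exact h1

lemma emExpr_comp_coframe (c : FiberedChart P) (r : ℕ)
    (C₁ : Fin a → Fin (n + 1) → Fin (n + 1) → Yb → ℝ) (L : JetCoord (n + 1) a m → ℝ)
    (ξ : BaseField (n + 1) X) (γ : LocalSection P x) :
    (c.emExpr r C₁ L ξ γ).compContinuousLinearMap (coframe c.base x) =
      ∑ j, ∑ i, (c.emComponent r C₁ L j i γ * comp c.base ξ i x) • omega c.base j x := by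
  ext v
  simp only [FiberedChart.emExpr, ContinuousAlternatingMap.compContinuousLinearMap_apply,
    ContinuousAlternatingMap.sum_apply, ContinuousAlternatingMap.smul_apply, ← Finset.sum_smul]
  rfl

variable {r q : ℕ} {lam : Lagrangian P r} {τ : BackgroundForm P q (n + 2)}
  {l : VectorLift P} {c c' : FiberedChart P}
  {C₀ C₀' : Fin a → Fin (n + 1) → Yb → ℝ} {C₁ C₁' : Fin a → Fin (n + 1) → Fin (n + 1) → Yb → ℝ}
  {L L' : JetCoord (n + 1) a m → ℝ} {γ : LocalSection P x}

/-- The deviation has the shape of the Leibniz rule for h d, with `emExpr` in the place of T(ξ). It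
cancels against that rule in B, and in this form it can be compared between charts. -/
lemma hContract_smul_eq_wedge (hτ : IsSourceForm lam τ) (hC : c.IsLiftCoeff l C₀ C₁)
    (hL : c.IsLocalLagrangian lam L) (h : c.Mem γ) {f : C^∞⟮𝓘(ℝ, Rn (n + 1)), X; ℝ⟯}
    {ξ η : BaseField (n + 1) X} (hη : ∀ x, η x = f x • ξ x) :
    hContract τ (l.bg η) γ = f x • hContract τ (l.bg ξ) γ +
      (wedgeOne (fderiv ℝ (fun u => f (c.base.symm u)) (c.base x))
        (c.emExpr r C₁ L ξ γ)).compContinuousLinearMap (coframe c.base x) := by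
  rw [hContract_smul hτ hL hC hη h, FiberedChart.emExpr, wedgeOne_sum_curryLeft_volForm]
  rfl

/-- Cut-off coordinate functions serve as multipliers f: with df = dx^k at x, the deviation from
linearity exhibits the products with the dx^k. -/
lemma exists_coordinate_function [T2Space X] {φ : OpenPartialHomeomorph X (Rn (n + 1))}
    (hφ : φ ∈ IsManifold.maximalAtlas 𝓘(ℝ, Rn (n + 1)) ∞ X) (hx : x ∈ φ.source)
    (k : Fin (n + 1)) : ∃ f : C^∞⟮𝓘(ℝ, Rn (n + 1)), X; ℝ⟯,
      fderiv ℝ (fun u => f (φ.symm u)) (φ x) = EuclideanSpace.proj k := by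
  obtain ⟨f, hf⟩ := exists_smooth_function hφ hx (EuclideanSpace.proj (𝕜 := ℝ) k).contDiff
  refine ⟨f, ?_⟩
  have e : (fun u => f (φ.symm u)) =ᶠ[𝓝 (φ x)] EuclideanSpace.proj (𝕜 := ℝ) k := by
    filter_upwards [(tendsto_symm hx).eventually hf, φ.open_target.mem_nhds (φ.map_source hx)]
      with u h1 h2
    rw [h1, φ.right_inv h2]
  rw [e.fderiv_eq, ContinuousLinearMap.fderiv]

/-- The local expression of the energy-momentum tensor is determined by the deviation of the
contraction of the source form with the lift from linearity over functions. -/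
lemma eq_emExpr [T2Space X] (hτ : IsSourceForm lam τ) (hC : c.IsLiftCoeff l C₀ C₁)
    (hL : c.IsLocalLagrangian lam L) (h : c.Mem γ) {ξ : BaseField (n + 1) X}
    {W : Rn (n + 1) [⋀^Fin n]→L[ℝ] ℝ}
    (hW : ∀ (f : C^∞⟮𝓘(ℝ, Rn (n + 1)), X; ℝ⟯) (η : BaseField (n + 1) X),
      (∀ x, η x = f x • ξ x) → hContract τ (l.bg η) γ = f x • hContract τ (l.bg ξ) γ +
        (wedgeOne (fderiv ℝ (fun u => f (c.base.symm u)) (c.base x)) W).compContinuousLinearMap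
          (coframe c.base x)) :
    W = c.emExpr r C₁ L ξ γ := by
  refine eq_sum_curryLeft_volForm fun k => ?_
  obtain ⟨f, hf⟩ := exists_coordinate_function c.base_mem h.mem_base k
  obtain ⟨η, hη⟩ := exists_smul_field f ξ
  have h1 := hW f η hη
  rw [hContract_smul_eq_wedge hτ hC hL h hη, add_right_inj, hf] at h1
  rw [← pullback_coframe_injective c.base_mem h.mem_base h1, FiberedChart.emExpr,
    wedgeOne_sum_curryLeft_volForm]
  simp [basisVec]

lemma fderiv_function_change {f : C^∞⟮𝓘(ℝ, Rn (n + 1)), X; ℝ⟯} (hx : x ∈ c.base.source)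
    (hx' : x ∈ c'.base.source) :
    fderiv ℝ (fun u => f (c.base.symm u)) (c.base x) =
      (fderiv ℝ (fun u => f (c'.base.symm u)) (c'.base x)).comp
        (fderiv ℝ (c.change c') (c.base x)) := by
  have hs := FiberedChart.mem_change hx hx'
  have hu : c.change c' (c.base x) = c'.base x := FiberedChart.change_apply hx
  have d1 : DifferentiableAt ℝ (fun u => f (c'.base.symm u)) (c.change c' (c.base x)) := by
    rw [hu]
    exact ((contDiffOn_function c'.base_mem f).contDiffAt (c'.base.open_target.mem_nhds
      (c'.base.map_source hx'))).differentiableAt (by simp)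
  have d2 : DifferentiableAt ℝ (c.change c') (c.base x) :=
    ((c.contDiffOn_change c').contDiffAt ((c.change c').open_source.mem_nhds
      hs)).differentiableAt (by simp)
  have e : (fun u => f (c.base.symm u)) =ᶠ[𝓝 (c.base x)]
      (fun u => f (c'.base.symm u)) ∘ c.change c' := by
    filter_upwards [(c.change c').open_source.mem_nhds hs] with u hu
    rw [OpenPartialHomeomorph.trans_source] at hu
    have : c'.base.symm (c.change c' u) = c.base.symm u := c'.base.left_inv hu.2
    rw [Function.comp_apply, this]
  rw [e.fderiv_eq, fderiv_comp _ d1 d2, hu]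

/-- The local expressions of the energy-momentum tensor agree on overlaps of charts. -/
lemma emExpr_change [T2Space X] (hτ : IsSourceForm lam τ) (hC : c.IsLiftCoeff l C₀ C₁)
    (hL : c.IsLocalLagrangian lam L) (hC' : c'.IsLiftCoeff l C₀' C₁')
    (hL' : c'.IsLocalLagrangian lam L') (h : c.Mem γ) (h' : c'.Mem γ) (ξ : BaseField (n + 1) X) :
    (c'.emExpr r C₁' L' ξ γ).compContinuousLinearMap (fderiv ℝ (c.change c') (c.base x)) =
      c.emExpr r C₁ L ξ γ := by
  -- The expression of the second chart, pulled back to the first, describes the same deviation,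
  -- which does not depend on a chart.
  refine eq_emExpr hτ hC hL h fun f η hη => ?_
  rw [hContract_smul_eq_wedge hτ hC' hL' h' hη, fderiv_function_change h.mem_base h'.mem_base,
    ← wedgeOne_comp]
  congr 1
  ext v
  exact congrArg (fun w => wedgeOne (fderiv ℝ (fun u => f (c'.base.symm u)) (c'.base x))
    (c'.emExpr r C₁' L' ξ γ) w) (funext fun i => coframe_change h.mem_base h'.mem_base (v i))

/-- The local expression of an energy-momentum tensor. -/
theorem IsEnergyMomentumTensor.toFun_eq [T2Space X] (hτ : IsSourceForm lam τ)
    {T : BaseField (n + 1) X → HorizontalForm P q n} (hT : IsEnergyMomentumTensor l τ T)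
    (hC : c.IsLiftCoeff l C₀ C₁) (hL : c.IsLocalLagrangian lam L) (h : c.Mem γ)
    (ξ : BaseField (n + 1) X) :
    (T ξ).toFun x (γ.jet q) =
      (c.emExpr r C₁ L ξ γ).compContinuousLinearMap (coframe c.base x) := by
  obtain ⟨B, hTl, hBl, hB⟩ := hT
  obtain ⟨G, hG⟩ := (T ξ).smooth c
  rw [hG.2 x γ h]
  congr 1
  refine eq_emExpr hτ hC hL h fun f η hη => ?_
  have hG' : c.IsLocalForm (T ξ) G := hG
  -- Function-linearity of B makes its contribution to the deviation zero; by the Leibniz rule what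
  -- remains is df ∧ T(ξ).
  rw [hB, hB, hG'.hd_smul h (hTl.2 f ξ η hη), hBl.2 f ξ η hη, smul_add, add_assoc]

lemma jacobian_apply (c c' : FiberedChart P) (x : X) (v : Rn (n + 1)) (i' : Fin (n + 1)) :
    fderiv ℝ (c.change c') (c.base x) v i' = ∑ i, c.jacobian c' x i' i * v i := by
  conv_lhs => rw [sum_coord_smul_basisVec v]
  simp only [map_sum, map_smul, WithLp.ofLp_sum, Finset.sum_apply, PiLp.smul_apply, smul_eq_mul]
  exact Finset.sum_congr rfl fun i _ => mul_comm _ _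

lemma det_jacobian (c c' : FiberedChart P) (x : X) :
    (c.jacobian c' x).det = (fderiv ℝ (c.change c') (c.base x)).det := by
  rw [ContinuousLinearMap.det,
    ← LinearMap.det_toMatrix (EuclideanSpace.basisFun (Fin (n + 1)) ℝ).toBasis]
  congr 1

lemma fderiv_change_comp (hx : x ∈ c.base.source) (hx' : x ∈ c'.base.source) (v : Rn (n + 1)) :
    fderiv ℝ (c.change c') (c.base x) (fderiv ℝ (c'.change c) (c'.base x) v) = v := by
  obtain ⟨w, rfl⟩ := (coframe_bijective c'.base_mem hx').2 v
  rw [← coframe_change hx' hx, ← coframe_change hx hx']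

/-- The transformation rule for the components of the energy-momentum tensor. -/
theorem emComponent_change [T2Space X] (hτ : IsSourceForm lam τ) (hC : c.IsLiftCoeff l C₀ C₁)
    (hL : c.IsLocalLagrangian lam L) (hC' : c'.IsLiftCoeff l C₀' C₁')
    (hL' : c'.IsLocalLagrangian lam L') (h : c.Mem γ) (h' : c'.Mem γ) (j i : Fin (n + 1)) :
    c.emComponent r C₁ L j i γ =
      ∑ j', ∑ i', c'.jacobian c x j j' * c.jacobian c' x i' i *
        (c.jacobian c' x).det * c'.emComponent r C₁' L' j' i' γ := by
  -- With ξ = ∂_i near x, the components in the second chart are the i-th column of the Jacobian.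
  obtain ⟨ξ, hξ⟩ := exists_baseField (x := x) c.base_mem h.mem_base
    (g := fun _ => basisVec i) contDiff_const
  have hξi : ∀ k, comp c.base ξ k x = if k = i then 1 else 0 := fun k => by
    rw [(hξ.self_of_nhds k).1]
    simp [basisVec]
  have hξi' : ∀ k, comp c'.base ξ k x = c.jacobian c' x k i := fun k => by
    have h1 : comp c'.base ξ k x = fderiv ℝ (c.change c') (c.base x) (coframe c.base x (ξ x)) k :=
      congrArg (fun v : Rn (n + 1) => v k) (coframe_change h.mem_base h'.mem_base (ξ x))
    rw [h1, jacobian_apply]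
    have h2 : ∀ k, coframe c.base x (ξ x) k = if k = i then 1 else 0 := hξi
    simp [h2]
  have key := emExpr_change hτ hC hL hC' hL' h h' ξ
  have hw := congrArg (wedgeOne (EuclideanSpace.proj j)) key
  set D := fderiv ℝ (c.change c') (c.base x) with hD
  set D' := fderiv ℝ (c'.change c) (c'.base x) with hD'
  have hDD' : ∀ v, D (D' v) = v := fderiv_change_comp h.mem_base h'.mem_base
  have hD'D : ∀ v, D' (D v) = v := fderiv_change_comp h'.mem_base h.mem_base
  -- Taking the product with dx^j isolates T^j_i on one side. On the other side dx^j is written as a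
  -- pullback by D of a covector in the second chart, so that the whole product is a pullback by D
  -- and yields the determinant.
  have hproj : (EuclideanSpace.proj j : Rn (n + 1) →L[ℝ] ℝ) =
      ((EuclideanSpace.proj j).comp D').comp D := by
    ext v
    simp [hD'D]
  rw [hproj, ← wedgeOne_comp, ← hproj, FiberedChart.emExpr, FiberedChart.emExpr,
    wedgeOne_sum_curryLeft_volForm, wedgeOne_sum_curryLeft_volForm] at hw
  have h3 := congrArg (fun η => η fun i => basisVec i) (volForm_comp D)
  have h4 := congrArg (fun η => η fun i => basisVec i) hw
  simp only [ContinuousAlternatingMap.compContinuousLinearMap_apply,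
    ContinuousAlternatingMap.smul_apply, volForm_basis, smul_eq_mul, mul_one] at h3 h4
  have hJ : ∀ j', ((EuclideanSpace.proj j).comp D' : Rn (n + 1) →L[ℝ] ℝ) (basisVec j') =
      c'.jacobian c x j j' := fun j' => rfl
  have hδ : ∀ k, EuclideanSpace.proj (𝕜 := ℝ) j (basisVec k) = if k = j then 1 else 0 :=
    fun k => by simp [basisVec, eq_comm]
  have h5 : ((volForm (n + 1)) fun i => D (basisVec i)) = D.det := h3
  simp only [hξi, hξi', hJ, hδ, mul_ite, mul_one, mul_zero, Finset.sum_ite_eq', Finset.mem_univ,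
    if_true, Function.comp_def, h5] at h4
  rw [← h4, Finset.sum_mul]
  refine Finset.sum_congr rfl fun j' _ => ?_
  rw [Finset.sum_mul, Finset.sum_mul]
  refine Finset.sum_congr rfl fun i' _ => ?_
  rw [det_jacobian]
  ring

end EnergyMomentum

end

section

open Filter

/-! ### Existence of the energy-momentum tensor -/

section Reduction

variable {n a m : ℕ} {V : Type*} [NormedAddCommGroup V] [NormedSpace ℝ V]

/-- A smooth function of finite order that depends only on the coordinates of order at most `q`
is of order `q`. -/
lemma SmoothOfOrder.of_dependence {k q : ℕ} {O : Set (Rn n × Rn a × Rn m)}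
    {f : JetCoord n a m → V} (hf : SmoothOfOrder k (jetDomain O) f)
    (h : ∀ p ∈ jetDomain O, ∀ p' ∈ jetDomain O, trunc q p = trunc q p' → f p = f p') :
    SmoothOfOrder q (jetDomain O) f := by
  classical
  obtain ⟨g, hg⟩ := hf
  -- The missing coordinates are set to zero. Those of order zero are never missing, so the point
  -- stays in the domain.
  let S : TruncCoord n a m q → JetCoord n a m := fun t =>
    (t.1, fun α => if hα : α ∈ orderLE n q then t.2.1 ⟨α, hα⟩ else 0,
      fun α => if hα : α ∈ orderLE n q then t.2.2 ⟨α, hα⟩ else 0)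
  have hS : ∀ t, trunc q (S t) = t := fun t => by
    simp [S, trunc]
  have hSk : ContDiff ℝ ∞ fun t => trunc k (S t) := by
    refine contDiff_fst.prodMk (ContDiff.prodMk (contDiff_pi.2 fun α => ?_)
      (contDiff_pi.2 fun α => ?_))
    · by_cases hα : α.1 ∈ orderLE n q
      · simp only [S, dif_pos hα]
        fun_prop
      · simp only [S, dif_neg hα]
        exact contDiff_const
    · by_cases hα : α.1 ∈ orderLE n q
      · simp only [S, dif_pos hα]
        fun_prop
      · simp only [S, dif_neg hα]
        exact contDiff_const
  have hmem : ∀ p ∈ jetDomain O, S (trunc q p) ∈ jetDomain O := fun p hp => by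
    have : base0 (S (trunc q p)) = base0 p := base0_eq_of_trunc_eq (hS _)
    change base0 (S (trunc q p)) ∈ O
    rw [this]
    exact hp
  refine ⟨fun t => g (trunc k (S t)), fun p hp => ⟨?_, ?_⟩⟩
  · exact ContDiffAt.comp (trunc q p) (hg _ (hmem p hp)).1 hSk.contDiffAt
  · exact (h p hp _ (hmem p hp) (hS _).symm).trans (hg _ (hmem p hp)).2

end Reduction

/-! ### The order of the Euler-Lagrange expressions and forms given by local expressions -/

section Configuration

variable {n a m : ℕ} {X Yb Ym : Type*}
  [TopologicalSpace X] [ChartedSpace (Rn n) X]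
  [TopologicalSpace Yb] [ChartedSpace (Rn n × Rn a) Yb]
  [TopologicalSpace Ym] [ChartedSpace (Rn n × Rn m) Ym]
  {P : Configuration n a m X Yb Ym} {x : X}
  [IsManifold 𝓘(ℝ, Rn n) ∞ X] [IsManifold 𝓘(ℝ, Rn n × Rn a) ∞ Yb]
  [IsManifold 𝓘(ℝ, Rn n × Rn m) ∞ Ym]

/-- The Euler-Lagrange expressions are coefficients of the source form. -/
lemma sourceExpr_apply {c : FiberedChart P} {r : ℕ} {L : JetCoord n a m → ℝ}
    {γ : LocalSection P x} {A : Fin a} {w : Fin (n + 1) → Rn n × Rn a}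
    (hw : ∀ i, (mfderiv 𝓘(ℝ, Rn n × Rn a) 𝓘(ℝ, Rn n × Rn a) c.bg (γ.bg x) :
      Rn n × Rn a →L[ℝ] Rn n × Rn a) (w i) =
        (Fin.cons (0, basisVec A) (fun i => (basisVec i, 0)) : Fin (n + 1) → Rn n × Rn a) i) :
    c.sourceExpr r L γ w = eulerLagrange r L A (c.coords γ) := by
  have h1 : c.sourceExpr r L γ w = (∑ B : Fin a, eulerLagrange r L B (c.coords γ) •
      contactVol B (c.coords γ))
        (Fin.cons (0, basisVec A) (fun i => (basisVec i, 0)) : Fin (n + 1) → Rn n × Rn a) :=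
    congrArg (fun w => (∑ B : Fin a, eulerLagrange r L B (c.coords γ) •
      contactVol B (c.coords γ)) w) (funext hw)
  have h2 : ∀ B, contactVol B (c.coords γ)
      (Fin.cons (0, basisVec A) (fun i => (basisVec i, 0)) : Fin (n + 1) → Rn n × Rn a) =
        if A = B then 1 else 0 := fun B => by
    rw [contactVol_eq, wedgeOne_apply, Fin.sum_univ_succ]
    have hv : (volForm n) (fun i => basisVec i) = 1 := volForm_basis
    simp [basisVec, Function.comp_def, eq_comm] at hv ⊢
    rw [← hv]
  rw [h1, ContinuousAlternatingMap.sum_apply]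
  simp [h2]

/-- The Euler-Lagrange expressions of a source form of order `q` are of order `q`. -/
lemma smoothOfOrder_eulerLagrange {r q : ℕ} {lam : Lagrangian P r}
    {τ : BackgroundForm P q (n + 1)} (hτ : IsSourceForm lam τ) {c : FiberedChart P}
    {L : JetCoord n a m → ℝ} (hL : c.IsLocalLagrangian lam L) (A : Fin a) :
    SmoothOfOrder q c.domain (eulerLagrange r L A) := by
  -- If q < 2r, the formula for the Euler-Lagrange expressions gives too high an order. Their
  -- dependence on the q-jet alone is read off from τ.
  have h2r := SmoothOfOrder.eulerLagrange c.isOpen_zeroDomain hL.1 A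
  refine h2r.of_dependence fun p hp p' hp' ht => ?_
  have h1 : p.1 = p'.1 := congrArg (fun t : TruncCoord n a m q => t.1) ht
  -- The sections realise the coordinates up to order max q (2r): order q to compare the values of
  -- τ, order 2r to evaluate the Euler-Lagrange expressions.
  obtain ⟨γ, hγ, hγp⟩ := c.exists_section hp (max q (2 * r))
  have hex := c.exists_section hp' (max q (2 * r))
  rw [← h1] at hex
  obtain ⟨γ', hγ', hγp'⟩ := hex
  have hval : ∀ {x : X} {p : JetCoord n a m} {γ : LocalSection P x}, p ∈ c.domain → c.Mem γ →
      trunc (max q (2 * r)) (c.coords γ) = trunc (max q (2 * r)) p →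
      eulerLagrange r L A (c.coords γ) = eulerLagrange r L A p := by
    intro x p γ hp hγ ht
    obtain ⟨g, hg⟩ := h2r
    have e1 := (hg _ hγ.coords_mem).2
    have e2 := (hg _ hp).2
    exact e1.trans ((congrArg g (trunc_mono (le_max_right _ _) ht)).trans e2.symm)
  rw [← hval hp hγ hγp, ← hval hp' hγ' hγp']
  have hj : γ.jet q = γ'.jet q := jet_eq_of_trunc_eq hγ hγ'
    (((trunc_mono (le_max_left _ _) hγp).trans ht).trans (trunc_mono (le_max_left _ _) hγp').symm)
  have hs : c.sourceExpr r L γ = c.sourceExpr r L γ' := by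
    have e1 := isSourceForm_iff.1 hτ c L hL _ γ hγ
    have e2 := isSourceForm_iff.1 hτ c L hL _ γ' hγ'
    have e3 := congrArg (β := (Rn n × Rn a) [⋀^Fin (n + 1)]→L[ℝ] ℝ)
      (fun j : Jet P q _ => τ _ j) hj
    exact e1.symm.trans (e3.trans e2)
  choose w hw using fun i => (mfderiv_chart_bijective c.bg_mem hγ.1).2
    ((Fin.cons (0, basisVec A) (fun i => (basisVec i, 0)) : Fin (n + 1) → Rn n × Rn a) i)
  have hd : ∀ y y' : Yb, y = y' →
      (mfderiv 𝓘(ℝ, Rn n × Rn a) 𝓘(ℝ, Rn n × Rn a) c.bg y : Rn n × Rn a →L[ℝ] Rn n × Rn a) =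
        mfderiv 𝓘(ℝ, Rn n × Rn a) 𝓘(ℝ, Rn n × Rn a) c.bg y' := by
    rintro y _ rfl
    rfl
  rw [← sourceExpr_apply (w := w) hw, ← sourceExpr_apply (γ := γ') (w := w), hs]
  intro i
  rw [← hd _ _ (jet_eq_iff.1 hj).1]
  exact hw i

/-- A horizontal form is given by its values on sections, provided they have smooth local
expressions. -/
lemma HorizontalForm.exists_of_local {q k : ℕ}
    (F : (x : X) → LocalSection P x → (TangentSpace 𝓘(ℝ, Rn n) x) [⋀^Fin k]→L[ℝ] ℝ)
    (hF : ∀ c : FiberedChart P, ∃ G : JetCoord n a m → Rn n [⋀^Fin k]→L[ℝ] ℝ,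
      SmoothOfOrder q c.domain G ∧ ∀ (x : X) (γ : LocalSection P x), c.Mem γ →
        F x γ = (G (c.coords γ)).compContinuousLinearMap (coframe c.base x)) :
    ∃ ρ : HorizontalForm P q k, ∀ (x : X) (γ : LocalSection P x), ρ.toFun x (γ.jet q) = F x γ := by
  -- A local expression of order q shows that F depends only on the q-jet, so evaluating it on a
  -- chosen representative loses nothing.
  have key : ∀ (x : X) (γ : LocalSection P x), F x (γ.jet q).out = F x γ := by
    intro x γ
    have hj : LocalSection.jet q (γ.jet q).out = γ.jet q := Quotient.out_eq _
    obtain ⟨c, hc⟩ := γ.exists_mem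
    have hc' : c.Mem (γ.jet q).out := hc.congr hj.symm
    obtain ⟨G, ⟨g, hg⟩, hG⟩ := hF c
    rw [hG x γ hc, hG x _ hc']
    have e1 := (hg _ hc.coords_mem).2
    have e2 := (hg _ hc'.coords_mem).2
    have e3 : G (c.coords (γ.jet q).out) = G (c.coords γ) :=
      e2.trans ((congrArg g ((jet_eq_iff.1 hj).2.2 c hc')).trans e1.symm)
    rw [e3]
  refine ⟨⟨fun x j => F x j.out, fun c => ?_⟩, key⟩
  obtain ⟨G, hG, hGe⟩ := hF c
  exact ⟨G, hG, fun x γ hγ => (key x γ).trans (hGe x γ hγ)⟩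

/-- Additivity of the horizontal differential. -/
lemma HorizontalForm.hd_add {q k : ℕ} {ρ₁ ρ₂ ρ : HorizontalForm P q k}
    (h : ∀ x j, ρ.toFun x j = ρ₁.toFun x j + ρ₂.toFun x j) (γ : LocalSection P x) :
    ρ.hd γ = ρ₁.hd γ + ρ₂.hd γ := by
  obtain ⟨c, hc⟩ := γ.exists_mem
  obtain ⟨G₁, hG₁⟩ := ρ₁.smooth c
  obtain ⟨G₂, hG₂⟩ := ρ₂.smooth c
  have h₁ : c.IsLocalForm ρ₁ G₁ := hG₁
  have h₂ : c.IsLocalForm ρ₂ G₂ := hG₂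
  have h₃ : c.IsLocalForm ρ (fun p => G₁ p + G₂ p) := by
    refine ⟨h₁.1.add h₂.1, fun x γ hγ => ?_⟩
    rw [h, h₁.2 x γ hγ, h₂.2 x γ hγ]
    rfl
  rw [h₁.hd_eq hc, h₂.hd_eq hc, h₃.hd_eq hc,
    extDeriv_fun_add ((h₁.smoothNear hc).contDiffAt.differentiableAt (by simp))
      ((h₂.smoothNear hc).contDiffAt.differentiableAt (by simp))]
  rfl

lemma FiberedChart.bg_symm_coords {c : FiberedChart P} {γ : LocalSection P x} (h : c.Mem γ) :
    c.bg.symm ((c.coords γ).1, (c.coords γ).2.1 0) = γ.bg x := by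
  have : ((c.coords γ).1, (c.coords γ).2.1 0) = c.bg (γ.bg x) := by
    rw [h.chart_bg]
    simp [FiberedChart.coords, sectionRep]
  rw [this, c.bg.left_inv h.1]

lemma hContract_add {q k : ℕ} (τ : BackgroundForm P q (k + 1)) (Ξ Ξ' : TotalField n a Yb)
    (γ : LocalSection P x) :
    hContract τ (Ξ + Ξ') γ = hContract τ Ξ γ + hContract τ Ξ' γ := by
  have h : ∀ v v' : Rn n × Rn a, (τ x (γ.jet q) : (Rn n × Rn a) [⋀^Fin (k + 1)]→L[ℝ] ℝ).curryLeft
      (v + v') = (τ x (γ.jet q) : (Rn n × Rn a) [⋀^Fin (k + 1)]→L[ℝ] ℝ).curryLeft v +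
        (τ x (γ.jet q) : (Rn n × Rn a) [⋀^Fin (k + 1)]→L[ℝ] ℝ).curryLeft v' :=
    fun v v' => map_add _ v v'
  ext v
  exact congrArg (fun η : (Rn n × Rn a) [⋀^Fin k]→L[ℝ] ℝ => η fun i =>
    (mfderiv 𝓘(ℝ, Rn n) 𝓘(ℝ, Rn n × Rn a) γ.bg x (v i) : Rn n × Rn a))
    (h (Ξ (γ.bg x)) (Ξ' (γ.bg x)))

end Configuration

end

section

open Filter

/-! ### Gluing the tensor and constructing the map B -/

section Existence

variable {n a m : ℕ} {X Yb Ym : Type*}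
  [TopologicalSpace X] [ChartedSpace (Rn (n + 1)) X]
  [TopologicalSpace Yb] [ChartedSpace (Rn (n + 1) × Rn a) Yb]
  [TopologicalSpace Ym] [ChartedSpace (Rn (n + 1) × Rn m) Ym]
  {P : Configuration (n + 1) a m X Yb Ym} {x : X}
  [IsManifold 𝓘(ℝ, Rn (n + 1)) ∞ X] [IsManifold 𝓘(ℝ, Rn (n + 1) × Rn a) ∞ Yb]
  [IsManifold 𝓘(ℝ, Rn (n + 1) × Rn m) ∞ Ym]
  {r q : ℕ} {lam : Lagrangian P r} {τ : BackgroundForm P q (n + 2)}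
  {l : VectorLift P} {c c' : FiberedChart P}
  {C₀ C₀' : Fin a → Fin (n + 1) → Yb → ℝ} {C₁ C₁' : Fin a → Fin (n + 1) → Fin (n + 1) → Yb → ℝ}
  {L L' : JetCoord (n + 1) a m → ℝ} {γ : LocalSection P x} {ξ : BaseField (n + 1) X}

/-- The components `T^j = T^j_i ξ^i` of the energy-momentum tensor, as functions of the jet
coordinates. -/
def FiberedChart.emFlux (c : FiberedChart P) (r : ℕ)
    (C₁ : Fin a → Fin (n + 1) → Fin (n + 1) → Yb → ℝ) (L : JetCoord (n + 1) a m → ℝ)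
    (ξ : BaseField (n + 1) X) (j : Fin (n + 1)) (p : JetCoord (n + 1) a m) : ℝ :=
  ∑ i, (∑ A, C₁ A j i (c.bg.symm (p.1, p.2.1 0)) * eulerLagrange r L A p) *
    comp c.base ξ i (c.base.symm p.1)

lemma FiberedChart.smoothOfOrder_bg {c : FiberedChart P} {k : ℕ} {f : Yb → ℝ}
    (hf : ContDiffOn ℝ ∞ (fun w => f (c.bg.symm w)) c.bg.target) :
    SmoothOfOrder k c.domain fun p => f (c.bg.symm (p.1, p.2.1 0)) := by
  refine smoothOfOrder_base0 (h := fun w => f (c.bg.symm (w.1, w.2.1))) fun p hp => ?_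
  exact ContDiffAt.comp (g := fun w => f (c.bg.symm w)) (base0 p) (hf.contDiffAt (c.bg.open_target.mem_nhds hp.1))
    (contDiffAt_fst.prodMk (contDiffAt_fst.comp _ contDiffAt_snd))

lemma FiberedChart.smoothOfOrder_comp (c : FiberedChart P) {k : ℕ} (ξ : BaseField (n + 1) X)
    (i : Fin (n + 1)) :
    SmoothOfOrder k c.domain fun p => comp c.base ξ i (c.base.symm p.1) := by
  refine smoothOfOrder_base0 (h := fun w => comp c.base ξ i (c.base.symm w.1)) fun p hp => ?_
  exact ContDiffAt.comp (base0 p) ((contDiffOn_comp c.base_mem ξ i).contDiffAt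
    (c.base.open_target.mem_nhds (c.fib_bg.proj_symm hp.1).1)) contDiffAt_fst

/-- The order is that of τ, even when q < 2r, because the coefficients of the lift are functions of
order zero and the E_A have order q. -/
lemma smoothOfOrder_emFlux [T2Space X] (hτ : IsSourceForm lam τ) (hC : c.IsLiftCoeff l C₀ C₁)
    (hL : c.IsLocalLagrangian lam L) (ξ : BaseField (n + 1) X) (j : Fin (n + 1)) :
    SmoothOfOrder q c.domain (c.emFlux r C₁ L ξ j) :=
  SmoothOfOrder.sum _ fun i _ => (SmoothOfOrder.sum _ fun A _ =>
    (FiberedChart.smoothOfOrder_bg (hC.contDiffOn A j i)).mul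
      (smoothOfOrder_eulerLagrange hτ hL A)).mul (c.smoothOfOrder_comp ξ i)

lemma emFlux_coords (h : c.Mem γ) (ξ : BaseField (n + 1) X) (j : Fin (n + 1)) :
    c.emFlux r C₁ L ξ j (c.coords γ) =
      ∑ i, c.emComponent r C₁ L j i γ * comp c.base ξ i x := by
  have h1 : c.base.symm (c.coords γ).1 = x := c.base.left_inv h.mem_base
  simp only [FiberedChart.emFlux, FiberedChart.bg_symm_coords h, h1, FiberedChart.emComponent]

/-- The energy-momentum tensor in jet coordinates. -/
def FiberedChart.emForm (c : FiberedChart P) (r : ℕ)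
    (C₁ : Fin a → Fin (n + 1) → Fin (n + 1) → Yb → ℝ) (L : JetCoord (n + 1) a m → ℝ)
    (ξ : BaseField (n + 1) X) (p : JetCoord (n + 1) a m) : Rn (n + 1) [⋀^Fin n]→L[ℝ] ℝ :=
  ∑ j, c.emFlux r C₁ L ξ j p • (volForm (n + 1)).curryLeft (basisVec j)

lemma emForm_coords (h : c.Mem γ) (ξ : BaseField (n + 1) X) :
    c.emForm r C₁ L ξ (c.coords γ) = c.emExpr r C₁ L ξ γ := by
  simp only [FiberedChart.emForm, emFlux_coords h, FiberedChart.emExpr]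

lemma smoothOfOrder_emForm [T2Space X] (hτ : IsSourceForm lam τ) (hC : c.IsLiftCoeff l C₀ C₁)
    (hL : c.IsLocalLagrangian lam L) (ξ : BaseField (n + 1) X) :
    SmoothOfOrder q c.domain (c.emForm r C₁ L ξ) :=
  SmoothOfOrder.sum _ fun j _ => (smoothOfOrder_emFlux hτ hC hL ξ j).smul (smoothOfOrder_const _)

lemma emExpr_comp_coframe_change [T2Space X] (hτ : IsSourceForm lam τ)
    (hC : c.IsLiftCoeff l C₀ C₁) (hL : c.IsLocalLagrangian lam L)
    (hC' : c'.IsLiftCoeff l C₀' C₁') (hL' : c'.IsLocalLagrangian lam L') (h : c.Mem γ)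
    (h' : c'.Mem γ) (ξ : BaseField (n + 1) X) :
    (c'.emExpr r C₁' L' ξ γ).compContinuousLinearMap (coframe c'.base x) =
      (c.emExpr r C₁ L ξ γ).compContinuousLinearMap (coframe c.base x) := by
  rw [← emExpr_change hτ hC hL hC' hL' h h' ξ]
  ext v
  exact congrArg (fun w => c'.emExpr r C₁' L' ξ γ w)
    (funext fun i => coframe_change h.mem_base h'.mem_base (v i))

/-- The horizontal forms with the local expressions `T^j_i ξ^i ω_j`. -/
lemma exists_emTensor [T2Space X] (hτ : IsSourceForm lam τ) (hl : l.IndexLEOne) :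
    ∃ T : BaseField (n + 1) X → HorizontalForm P q n, ∀ (c : FiberedChart P) C₀ C₁ L,
      c.IsLiftCoeff l C₀ C₁ → c.IsLocalLagrangian lam L → ∀ ξ,
        c.IsLocalForm (T ξ) (c.emForm r C₁ L ξ) := by
  choose ch hch using fun (x : X) (γ : LocalSection P x) => γ.exists_mem
  choose Lag hLag using fun c : FiberedChart P => c.exists_isLocalLagrangian lam
  choose D₀ D₁ hD using hl
  have key : ∀ (c : FiberedChart P) C₀ C₁ L, c.IsLiftCoeff l C₀ C₁ → c.IsLocalLagrangian lam L →
      ∀ (ξ : BaseField (n + 1) X) (x : X) (γ : LocalSection P x), c.Mem γ →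
        ((ch x γ).emExpr r (D₁ (ch x γ)) (Lag (ch x γ)) ξ γ).compContinuousLinearMap
          (coframe (ch x γ).base x) =
        (c.emForm r C₁ L ξ (c.coords γ)).compContinuousLinearMap (coframe c.base x) := by
    intro c C₀ C₁ L hC hL ξ x γ h
    rw [emForm_coords h]
    exact emExpr_comp_coframe_change hτ hC hL (hD _) (hLag _) h (hch x γ) ξ
  choose T hT using fun ξ : BaseField (n + 1) X => HorizontalForm.exists_of_local (P := P) (q := q)
    (fun x γ => ((ch x γ).emExpr r (D₁ (ch x γ)) (Lag (ch x γ)) ξ γ).compContinuousLinearMap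
          (coframe (ch x γ).base x))
    (fun c => ⟨_, smoothOfOrder_emForm hτ (hD c) (hLag c) ξ, key c _ _ _ (hD c) (hLag c) ξ⟩)
  exact ⟨T, fun c C₀ C₁ L hC hL ξ => ⟨smoothOfOrder_emForm hτ hC hL ξ, fun x γ h =>
    (hT ξ x γ).trans (key c C₀ C₁ L hC hL ξ x γ h)⟩⟩

lemma extDeriv_const_form {E : Type*} [NormedAddCommGroup E] [NormedSpace ℝ E] {k : ℕ}
    (η : E [⋀^Fin k]→L[ℝ] ℝ) (u : E) : extDeriv (fun _ => η) u = 0 := by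
  ext v
  rw [extDeriv_apply (differentiableAt_const η)]
  simp

lemma extDeriv_sum_curryLeft {g : Fin (n + 1) → Rn (n + 1) → ℝ} {u : Rn (n + 1)}
    (hg : ∀ j, DifferentiableAt ℝ (g j) u) :
    extDeriv (fun u => ∑ j, g j u • (volForm (n + 1)).curryLeft (basisVec j)) u =
      (∑ j, pderiv j (g j) u) • volForm (n + 1) := by
  have h1 : ∀ s : Finset (Fin (n + 1)), DifferentiableAt ℝ (fun u =>
      ∑ j ∈ s, g j u • (volForm (n + 1)).curryLeft (basisVec j)) u ∧
      extDeriv (fun u => ∑ j ∈ s, g j u • (volForm (n + 1)).curryLeft (basisVec j)) u =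
      (∑ j ∈ s, pderiv j (g j) u) • volForm (n + 1) := by
    intro s
    induction s using Finset.induction_on with
    | empty =>
      refine ⟨by simp, ?_⟩
      simp only [Finset.sum_empty, zero_smul]
      exact extDeriv_const_form 0 u
    | insert i s hi ih =>
      have hd := (hg i).fun_smul (differentiableAt_const
        ((volForm (n + 1)).curryLeft (basisVec i)) (x := u))
      simp only [Finset.sum_insert hi]
      refine ⟨hd.fun_add ih.1, ?_⟩
      rw [extDeriv_fun_add hd ih.1, ih.2, extDeriv_smul_apply (hg i) (differentiableAt_const _),
        wedgeOne_curryLeft_volForm, add_smul]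
      rw [extDeriv_const_form, smul_zero, zero_add]
      rfl
  exact (h1 Finset.univ).2

/-- The horizontal differential of the energy-momentum tensor in a chart. -/
lemma hd_emTensor [T2Space X] (hτ : IsSourceForm lam τ) (hC : c.IsLiftCoeff l C₀ C₁)
    (hL : c.IsLocalLagrangian lam L) {ρ : HorizontalForm P q n}
    (hρ : c.IsLocalForm ρ (c.emForm r C₁ L ξ)) (h : c.Mem γ) :
    ρ.hd γ = (∑ j, totalDeriv j (c.emFlux r C₁ L ξ j) (c.coords γ)) • omegaZero c.base x := by
  have hs := fun j => smoothOfOrder_emFlux hτ hC hL ξ j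
  have hd : ∀ j, DifferentiableAt ℝ (fun u => c.emFlux r C₁ L ξ j
      (jetMap (c.bgRep γ) (c.matRep γ) u)) (c.base x) := fun j =>
    ((hs j).smoothNear_comp_jetMap c.isOpen_zeroDomain h.smoothNear_bg h.smoothNear_mat
      h.coords_mem).contDiffAt.differentiableAt (by simp)
  have ht : ∀ j, totalDeriv j (c.emFlux r C₁ L ξ j) (c.coords γ) = pderiv j
      (fun u => c.emFlux r C₁ L ξ j (jetMap (c.bgRep γ) (c.matRep γ) u)) (c.base x) := fun j =>
    totalDeriv_jetMap c.isOpen_zeroDomain (hs j) h.smoothNear_bg h.smoothNear_mat h.coords_mem j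
  rw [hρ.hd_eq h]
  simp only [FiberedChart.emForm, ht]
  rw [extDeriv_sum_curryLeft hd]
  rfl

/-- Existence and uniqueness of the energy-momentum tensor. -/
theorem existsUnique_isEnergyMomentumTensor [T2Space X] (hτ : IsSourceForm lam τ)
    (hl : l.IndexLEOne) :
    ∃! T : BaseField (n + 1) X → HorizontalForm P q n, IsEnergyMomentumTensor l τ T := by
  choose ch hch using fun (x : X) (γ : LocalSection P x) => γ.exists_mem
  choose Lag hLag using fun c : FiberedChart P => c.exists_isLocalLagrangian lam
  obtain ⟨T, hT⟩ := exists_emTensor hτ hl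
  choose D₀ D₁ hD using hl
  have hTv : ∀ (ξ : BaseField (n + 1) X) (x : X) (γ : LocalSection P x),
      (T ξ).toFun x (γ.jet q) = ((ch x γ).emExpr r (D₁ (ch x γ)) (Lag (ch x γ)) ξ
        γ).compContinuousLinearMap (coframe (ch x γ).base x) := fun ξ x γ => by
    rw [← emForm_coords (hch x γ)]
    exact (hT _ _ _ _ (hD _) (hLag _) ξ).2 x γ (hch x γ)
  have hTl : IsFunctionLinear T := by
    constructor
    · intro ξ η x j
      obtain ⟨γ, rfl⟩ := Quotient.exists_rep j
      change (T _).toFun x (γ.jet q) = (T _).toFun x (γ.jet q) + (T _).toFun x (γ.jet q)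
      rw [hTv, hTv, hTv]
      ext v
      simp only [FiberedChart.emExpr, comp_add, mul_add, Finset.sum_add_distrib, add_smul]
      rfl
    · intro f ξ η hη x j
      obtain ⟨γ, rfl⟩ := Quotient.exists_rep j
      change (T _).toFun x (γ.jet q) = f x • (T _).toFun x (γ.jet q)
      rw [hTv, hTv]
      have : (ch x γ).emExpr r (D₁ (ch x γ)) (Lag (ch x γ)) η γ =
          f x • (ch x γ).emExpr r (D₁ (ch x γ)) (Lag (ch x γ)) ξ γ := by
        simp only [FiberedChart.emExpr, comp_smul hη, mul_left_comm _ (f x), ← Finset.mul_sum,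
          mul_smul, ← Finset.smul_sum]
      rw [this]
      rfl
  -- B(ξ) is forced to be h i_Ξ τ - h d(T(ξ)). The local formulas show that it is a horizontal form
  -- of order q + 1: the contraction brings in the y^A_j, and h d brings in total derivatives.
  choose B hB using fun ξ : BaseField (n + 1) X =>
    HorizontalForm.exists_of_local (P := P) (q := q + 1) (k := n + 1)
    (fun x γ => hContract τ (l.bg ξ) γ - (T ξ).hd γ) (fun c => by
      refine ⟨fun p => (∑ A, eulerLagrange r (Lag c) A p *
        (c.vertComp (l.bg ξ) A (c.bg.symm (p.1, p.2.1 0)) - ∑ j, p.2.1 (Pi.single j 1) A *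
          comp c.base ξ j (c.base.symm p.1)) -
        ∑ j, totalDeriv j (c.emFlux r (D₁ c) (Lag c) ξ j) p) • volForm (n + 1), ?_, ?_⟩
      · refine SmoothOfOrder.smul (SmoothOfOrder.sub ?_ ?_) (smoothOfOrder_const _)
        · refine SmoothOfOrder.sum _ fun A _ => SmoothOfOrder.mul
            ((smoothOfOrder_eulerLagrange hτ (hLag c) A).mono q.le_succ)
            (SmoothOfOrder.sub (FiberedChart.smoothOfOrder_bg (c.contDiffOn_vertComp _ A))
              (SmoothOfOrder.sum _ fun j _ => SmoothOfOrder.mul ?_ (c.smoothOfOrder_comp ξ j)))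
          have hj : (Pi.single j 1 : Fin (n + 1) → ℕ) ∈ orderLE (n + 1) (q + 1) :=
            mem_orderLE.2 (by simp)
          exact (smoothOfOrder_bgCoord hj).comp (h := fun y : Rn a => y A) fun _ _ => by fun_prop
        · exact SmoothOfOrder.sum _ fun j _ => SmoothOfOrder.totalDeriv c.isOpen_zeroDomain
            (smoothOfOrder_emFlux hτ (hD c) (hLag c) ξ j) j
      · intro x γ h
        have h1 : c.base.symm (c.coords γ).1 = x := c.base.left_inv h.mem_base
        rw [hContract_eq hτ (hLag c) l ξ h, hd_emTensor hτ (hD c) (hLag c)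
          (hT c _ _ _ (hD c) (hLag c) ξ) h]
        simp only [FiberedChart.bg_symm_coords h, h1]
        ext v
        exact (sub_mul _ _ _).symm)
  have hBl : IsFunctionLinear B := by
    constructor
    · intro ξ η x j
      obtain ⟨γ, rfl⟩ := Quotient.exists_rep j
      change (B _).toFun x (γ.jet (q + 1)) =
        (B _).toFun x (γ.jet (q + 1)) + (B _).toFun x (γ.jet (q + 1))
      rw [hB, hB, hB, HorizontalForm.hd_add (hTl.1 ξ η), map_add, hContract_add]
      abel
    · intro f ξ η hη x j
      obtain ⟨γ, rfl⟩ := Quotient.exists_rep j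
      change (B _).toFun x (γ.jet (q + 1)) = f x • (B _).toFun x (γ.jet (q + 1))
      have h := hch x γ
      -- The contraction and the horizontal differential contribute the same term df ∧ T(ξ), and
      -- these cancel.
      rw [hB, hB, (hT _ _ _ _ (hD _) (hLag _) ξ).hd_smul h (hTl.2 f ξ η hη), emForm_coords h,
        hContract_smul_eq_wedge hτ (hD _) (hLag _) h hη, smul_sub]
      abel
  refine ⟨T, ⟨B, hTl, hBl, fun ξ x γ => ?_⟩, fun T' hT' => ?_⟩
  · rw [hB, sub_add_cancel]
  · funext ξ
    refine HorizontalForm.ext (funext fun x => funext fun j => ?_)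
    obtain ⟨γ, rfl⟩ := Quotient.exists_rep j
    exact (hT'.toFun_eq hτ (hD _) (hLag _) (hch x γ) ξ).trans (hTv ξ x γ).symm

end Existence

end

end EMTensor

end

theorem mainTheorem7 {n a m : ℕ} {X Yb Ym : Type*}
    [TopologicalSpace X] [T2Space X] [ChartedSpace (Rn (n + 1)) X]
    [TopologicalSpace Yb] [ChartedSpace (Rn (n + 1) × Rn a) Yb]
    [TopologicalSpace Ym] [ChartedSpace (Rn (n + 1) × Rn m) Ym]
    [IsManifold 𝓘(ℝ, Rn (n + 1)) ∞ X] [IsManifold 𝓘(ℝ, Rn (n + 1) × Rn a) ∞ Yb]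
    [IsManifold 𝓘(ℝ, Rn (n + 1) × Rn m) ∞ Ym]
    (P : Configuration (n + 1) a m X Yb Ym)
    (l : VectorLift P) (hl : l.IndexLEOne)
    (r q : ℕ) (lam : Lagrangian P r) :
    -- the energy-momentum source form exists, as a form of any order `q ≥ 2r`
    (2 * r ≤ q → ∃! τ : BackgroundForm P q (n + 2), IsSourceForm lam τ) ∧
    ∀ τ : BackgroundForm P q (n + 2), IsSourceForm lam τ →
      -- it determines the energy-momentum tensor
      (∃! T : BaseField (n + 1) X → HorizontalForm P q n, IsEnergyMomentumTensor l τ T) ∧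
      ∀ T : BaseField (n + 1) X → HorizontalForm P q n, IsEnergyMomentumTensor l τ T →
        -- local expression in any fibered chart
        (∀ (c : FiberedChart P) C₀ C₁ L, c.IsLiftCoeff l C₀ C₁ → c.IsLocalLagrangian lam L →
          ∀ (ξ : BaseField (n + 1) X) (x : X) (γ : LocalSection P x), c.Mem γ →
            (T ξ).toFun x (γ.jet q) =
              ∑ j, ∑ i, (c.emComponent r C₁ L j i γ * comp c.base ξ i x) • omega c.base j x) ∧
        -- transformation rule under fibered coordinate changes
        (∀ (c c' : FiberedChart P) C₀ C₁ L C₀' C₁' L',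
          c.IsLiftCoeff l C₀ C₁ → c.IsLocalLagrangian lam L →
          c'.IsLiftCoeff l C₀' C₁' → c'.IsLocalLagrangian lam L' →
          ∀ (x : X) (γ : LocalSection P x), c.Mem γ → c'.Mem γ → ∀ j i : Fin (n + 1),
            c.emComponent r C₁ L j i γ =
              ∑ j', ∑ i', c'.jacobian c x j j' * c.jacobian c' x i' i *
                (c.jacobian c' x).det * c'.emComponent r C₁' L' j' i' γ) := by
  refine ⟨fun hq => existsUnique_isSourceForm lam hq, fun τ hτ =>
    ⟨existsUnique_isEnergyMomentumTensor hτ hl, fun T hT =>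
      ⟨fun c C₀ C₁ L hC hL ξ x γ h => ?_, fun c c' C₀ C₁ L C₀' C₁' L' hC hL hC' hL' x γ h h' j i =>
        emComponent_change hτ hC hL hC' hL' h h' j i⟩⟩⟩
  rw [hT.toFun_eq hτ hC hL h ξ, emExpr_comp_coframe]
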